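/- **Theorem (Tractable Fragment).** An *attributed temporal causal hypergraph* $\mathcal H$ consists of a finite set $V$ of vertices; a finite set $\mathcal E$ of hyperedges, each with a non-empty finite array of participants from $V\cup\mathcal E$ (the position is the role of the participant), the nesting of hyperedges being well-founded; finite property lists $\mathcal A_V(v)$, $\mathcal A_E(e)$ of key–value pairs of strings; a valid time $\tau_v(e)$ and a transaction time $\tau_t(e)$, which are non-empty closed intervals of $\mathbb Q$, possibly infinite on either side; a confidence $\kappa(e)\in[0,1]\cap\mathbb Q$; and a strict partial order $\prec$ on $\mathcal E$ (causality). A *query* $Q$ is a finite conjunction of atoms and causal chains, together with a list $x_1,\dots,x_r$ of output variables. Terms are variables or constants naming a vertex or a hyperedge. The atoms are: "$z$ is a hyperedge with participant array $(t_1,\dots,t_k)$"; "$t$ is a participant of the hyperedge $z$"; "the vertex $t$ (the hyperedge $z$) has property $p$"; "$\tau_v(z)$ is contained in / contains / meets $[a,b]$" for a bounded window $[a,b]$, $a\le b$ in $\mathbb Q$; and "$\kappa(z)\ge\theta$", "$\kappa(z)>\theta$" for a threshold $\theta\in\mathbb Q$. A *causal chain* of depth $k$ is a condition $z_0\prec z_1\prec\dots\prec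 z_k$ on hyperedge terms. A *match* of $Q$ in $\mathcal H$ is a map of the variables of $Q$ to vertices and hyperedges of $\mathcal H$ that satisfies all atoms and chains (it need not be injective); the answer set $Q(\mathcal H)$ is the set of the tuples $(\nu(x_1),\dots,\nu(x_r))$ over all matches $\nu$. A finite family of sets is *$\alpha$-acyclic* if it has a join tree (equivalently, a join forest): a forest on the members of the family such that, for every point $x$, the members containing $x$ induce a connected subgraph. For constants $c,d\in\mathbb N$ let $\mathcal Q_{c,d}$ be the class of the queries in which every causal chain has depth at most $d$ and for which one can set aside at most $c$ of the chains so that the variable sets of all atoms and of the remaining chains form an $\alpha$-acyclic family. (So $\mathcal Q_{c,d}$ contains every query whose atoms form an $\alpha$-acyclic pattern and which has at most $c$ chains, each of depth at most $d$, and any number of chains of depth at most $d$ is allowed if they keep the pattern $\alpha$-acyclic.) Then, for all constants $c,d$, query evaluation for $\mathcal Q_{c,d}$ is in PTIME in combined complexity: there is a Turing machine that, given the standard encoding (numbers in binary) of an attributed temporal causal hypergraph $\mathcal H$, a query $Q$ and a tuple $t$, decides in time polynomial in the length of the input whether $Q\in\mathcal Q_{c,d}$ and $t\in Q(\mathcal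 H)$. -/

import Mathlib

/-! Attributed temporal causal hypergraphs, conjunctive queries over them, and a binary encoding. -/

namespace Atch

/-- A property: a key together with its value, both strings over `{0,1}`. -/
abbrev Property := List Bool × List Bool

/-- A non-empty closed interval of time points; an end that is `none` is infinite. -/
structure Interval where
  lower : Option ℚ
  upper : Option ℚ
  ordered : ∀ a ∈ lower, ∀ b ∈ upper, a ≤ b

/-- The time points of an interval. -/
def Interval.points (I : Interval) : Set ℚ :=
  {t | (∀ a ∈ I.lower, a ≤ t) ∧ (∀ b ∈ I.upper, t ≤ b)}

/-- An attributed temporal causal hypergraph. The vertices are `Fin numV`. The hyperedges have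
the identities `Fin numE`; each has a non-empty array of participants (position = role), which are
vertices or other hyperedges, and the nesting of hyperedges is well-founded. -/
structure Hypergraph where
  numV : ℕ
  numE : ℕ
  nodes : Fin numE → List (Fin numV ⊕ Fin numE)
  nodes_nonempty : ∀ e, nodes e ≠ []
  nesting_wf : WellFounded fun f e : Fin numE => Sum.inr f ∈ nodes e
  vertexAttr : Fin numV → List Property
  edgeAttr : Fin numE → List Property
  validTime : Fin numE → Interval
  transTime : Fin numE → Interval
  conf : Fin numE → ℚ
  conf_mem : ∀ e, conf e ∈ Set.Icc (0 : ℚ) 1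
  /-- the causal order: `prec e f` means that `e` is a cause of `f` -/
  prec : Fin numE → Fin numE → Bool
  prec_irrefl : ∀ e, prec e e = false
  prec_trans : ∀ e f g, prec e f = true → prec f g = true → prec e g = true

/-- Names of objects: `inl i` names the `i`-th vertex, `inr j` the `j`-th hyperedge. -/
abbrev Obj := ℕ ⊕ ℕ

/-- The name of a vertex or hyperedge. -/
def Hypergraph.name (H : Hypergraph) : Fin H.numV ⊕ Fin H.numE → Obj :=
  Sum.map Fin.val Fin.val

/-- The set of hyperedges and vertices of `H`, by name. -/
def Hypergraph.objects (H : Hypergraph) : Set Obj := Set.range H.name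

/-- A term of a query is a variable or a constant. -/
inductive Term where
  | var (x : ℕ)
  | const (o : Obj)

def Term.vars : Term → Finset ℕ
  | .var x => {x}
  | .const _ => ∅

def Term.val (ν : ℕ → Obj) : Term → Obj
  | .var x => ν x
  | .const o => o

/-- A bounded time window. -/
structure Window where
  lo : ℚ
  hi : ℚ
  ordered : lo ≤ hi

/-- The range predicates that compare a valid time with a window. -/
inductive RangePred where
  | within
  | covers
  | overlaps

def RangePred.Holds (r : RangePred) (I : Interval) (W : Window) : Prop :=
  match r with
  | .within => I.points ⊆ Set.Icc W.lo W.hi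
  | .covers => Set.Icc W.lo W.hi ⊆ I.points
  | .overlaps => (I.points ∩ Set.Icc W.lo W.hi).Nonempty

/-- Atoms of a query. -/
inductive Atom where
  /-- `z` is a hyperedge whose array of participants is `ts` -/
  | hyperedge (z : Term) (ts : List Term)
  /-- `z` is a hyperedge and `t` is one of its participants -/
  | participant (t z : Term)
  /-- `t` is a vertex with property `p` -/
  | vertexAttr (t : Term) (p : Property)
  /-- `z` is a hyperedge with property `p` -/
  | edgeAttr (z : Term) (p : Property)
  /-- `z` is a hyperedge whose valid time stands in relation `r` to the window `W` -/
  | window (z : Term) (r : RangePred) (W : Window)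
  /-- `z` is a hyperedge of confidence at least `θ` -/
  | confGe (z : Term) (θ : ℚ)
  /-- `z` is a hyperedge of confidence greater than `θ` -/
  | confGt (z : Term) (θ : ℚ)

/-- The set of variables of a list of terms. -/
def termVars (ts : List Term) : Finset ℕ := ts.foldr (fun t s => t.vars ∪ s) ∅

def Atom.vars : Atom → Finset ℕ
  | .hyperedge z ts => z.vars ∪ termVars ts
  | .participant t z => t.vars ∪ z.vars
  | .vertexAttr t _ => t.vars
  | .edgeAttr z _ => z.vars
  | .window z _ _ => z.vars
  | .confGe z _ => z.vars
  | .confGt z _ => z.vars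

def Atom.Holds (H : Hypergraph) (ν : ℕ → Obj) : Atom → Prop
  | .hyperedge z ts =>
      ∃ e : Fin H.numE, z.val ν = H.name (.inr e) ∧ ts.map (Term.val ν) = (H.nodes e).map H.name
  | .participant t z =>
      ∃ e : Fin H.numE, z.val ν = H.name (.inr e) ∧ ∃ o ∈ H.nodes e, t.val ν = H.name o
  | .vertexAttr t p =>
      ∃ v : Fin H.numV, t.val ν = H.name (.inl v) ∧ p ∈ H.vertexAttr v
  | .edgeAttr z p =>
      ∃ e : Fin H.numE, z.val ν = H.name (.inr e) ∧ p ∈ H.edgeAttr e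
  | .window z r W =>
      ∃ e : Fin H.numE, z.val ν = H.name (.inr e) ∧ r.Holds (H.validTime e) W
  | .confGe z θ =>
      ∃ e : Fin H.numE, z.val ν = H.name (.inr e) ∧ θ ≤ H.conf e
  | .confGt z θ =>
      ∃ e : Fin H.numE, z.val ν = H.name (.inr e) ∧ θ < H.conf e

/-- The chain `z₀, …, z_k` holds if the terms denote hyperedges with `z₀ ≺ z₁ ≺ ⋯ ≺ z_k`. -/
def ChainHolds (H : Hypergraph) (ν : ℕ → Obj) (zs : List Term) : Prop :=
  ∃ es : List (Fin H.numE), zs.map (Term.val ν) = es.map (fun e => H.name (.inr e)) ∧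
    es.IsChain (fun e f => H.prec e f = true)

/-- A conjunctive query: atoms, causal chains (each the list of its hyperedge terms) and output
variables. All other variables are existentially quantified. -/
structure Query where
  atoms : List Atom
  chains : List (List Term)
  output : List ℕ

def Query.vars (Q : Query) : Finset ℕ :=
  Q.atoms.foldr (fun a s => a.vars ∪ s) ∅ ∪ Q.chains.foldr (fun c s => termVars c ∪ s) ∅ ∪
    Q.output.toFinset

/-- `ν` is a match of `Q` in `H`. -/
structure Query.IsMatch (Q : Query) (H : Hypergraph) (ν : ℕ → Obj) : Prop where
  objects : ∀ x ∈ Q.vars, ν x ∈ H.objects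
  atoms : ∀ a ∈ Q.atoms, a.Holds H ν
  chains : ∀ zs ∈ Q.chains, ChainHolds H ν zs

/-- The answers of `Q` on `H`. -/
def Query.answers (Q : Query) (H : Hypergraph) : Set (List Obj) :=
  {t | ∃ ν, Q.IsMatch H ν ∧ t = Q.output.map ν}

/-- A finite family of finite sets is α-acyclic if it has a join tree: a forest on the members of
the family in which, for every point `x`, the members that contain `x` are connected. (The
components of such a forest can be linked up to a tree.) -/
def AlphaAcyclic (es : List (Finset ℕ)) : Prop :=
  ∃ T : SimpleGraph (Fin es.length), T.IsAcyclic ∧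
    ∀ x : ℕ, (T.induce {i | x ∈ es.get i}).Preconnected

/-- The tractable class: every causal chain has depth at most `d`, that is, at most `d` links; and
up to at most `c` chains (`free`), which may join the pattern in an arbitrary way, the variable
sets of the atoms and of the chains (`tied`) form an α-acyclic hypergraph. -/
def Query.Tractable (c d : ℕ) (Q : Query) : Prop :=
  (∀ zs ∈ Q.chains, zs.length ≤ d + 1) ∧
    ∃ free tied : List (List Term), Q.chains.Perm (free ++ tied) ∧ free.length ≤ c ∧
      AlphaAcyclic (Q.atoms.map Atom.vars ++ tied.map termVars)

/-- An input of the evaluation problem: a hypergraph, a query and a candidate answer. -/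
structure Instance where
  db : Hypergraph
  query : Query
  tuple : List Obj

open Classical in
/-- The evaluation problem for the tractable class, as a decision problem on all inputs. -/
noncomputable def evaluation (c d : ℕ) (x : Instance) : Bool :=
  decide (x.query.Tractable c d ∧ x.tuple ∈ x.query.answers x.db)

/-! The encoding: numbers are written in binary, everything else by nested brackets. -/

inductive Sym where
  | lpar
  | rpar
  | zero
  | one

def group (parts : List (List Sym)) : List Sym := .lpar :: (parts.flatten ++ [.rpar])

def encBits (l : List Bool) : List Sym := group [l.map fun b => if b then .one else .zero]

def encNat (n : ℕ) : List Sym := encBits n.bits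

def encRat (q : ℚ) : List Sym :=
  group [encBits [decide (q < 0)], encNat q.num.natAbs, encNat q.den]

def encList {α : Type} (f : α → List Sym) (l : List α) : List Sym := group (l.map f)

def encFun {α : Type} {n : ℕ} (f : α → List Sym) (g : Fin n → α) : List Sym :=
  encList f (List.ofFn g)

def encOption {α : Type} (f : α → List Sym) (o : Option α) : List Sym := encList f o.toList

def encObj : Obj → List Sym
  | .inl i => group [encBits [false], encNat i]
  | .inr j => group [encBits [true], encNat j]

def encProperty (p : Property) : List Sym := group [encBits p.1, encBits p.2]

def encInterval (I : Interval) : List Sym :=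
  group [encOption encRat I.lower, encOption encRat I.upper]

def encHypergraph (H : Hypergraph) : List Sym :=
  group [encFun (encList encProperty) H.vertexAttr,
    encFun (encList fun o => encObj (H.name o)) H.nodes,
    encFun (encList encProperty) H.edgeAttr,
    encFun encInterval H.validTime,
    encFun encInterval H.transTime,
    encFun encRat H.conf,
    encFun (fun row => encBits (List.ofFn row)) H.prec]

def encTerm : Term → List Sym
  | .var x => group [encBits [false], encNat x]
  | .const o => group [encBits [true], encObj o]

def encRangePred : RangePred → List Sym
  | .within => encNat 0
  | .covers => encNat 1
  | .overlaps => encNat 2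

def encAtom : Atom → List Sym
  | .hyperedge z ts => group [encNat 0, encTerm z, encList encTerm ts]
  | .participant t z => group [encNat 1, encTerm t, encTerm z]
  | .vertexAttr t p => group [encNat 2, encTerm t, encProperty p]
  | .edgeAttr z p => group [encNat 3, encTerm z, encProperty p]
  | .window z r W =>
      group [encNat 4, encTerm z, encRangePred r, encRat W.lo, encRat W.hi]
  | .confGe z θ => group [encNat 5, encTerm z, encRat θ]
  | .confGt z θ => group [encNat 6, encTerm z, encRat θ]

def encQuery (Q : Query) : List Sym :=
  group [encList encAtom Q.atoms, encList (encList encTerm) Q.chains, encList encNat Q.output]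

def encInstance (x : Instance) : List Sym :=
  group [encHypergraph x.db, encQuery x.query, encList encObj x.tuple]

end Atch

/-! ### Structured programs over finitely many stacks -/

/-! There are two independent matters: a correct algorithm, and its realization by a machine in
polynomial time.

Algorithm. Over a given hypergraph, an atom holds under a valuation iff the valuation solves one of
polynomially many systems of equations "term = object", each of which binds exactly the variables of
the atom (`atom_holds_iff`, `eqVars_of_mem_atomEqs`). A chain of depth at most `d` is treated alike
by listing all lists of at most `d + 1` hyperedges, which is polynomial because `d` is constant
(`chain_holds_iff`). So the atoms and the tied chains become explicit relations over an α-acyclic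
family. For the at most `c` free chains all combinations of systems are tried, again polynomially
many. Such a combination, together with the output equations, fixes some variables, and systems that
contradict it are discarded; the variable sets stay as they were, so acyclicity is kept. The rest is
the classical evaluation of acyclic joins: systems without a compatible partner in some relation are
discarded until nothing changes, and on an acyclic family non-empty pairwise consistent relations
have a common solution (`Acyc.exists_sat`). That solution is built by adding ears: an ear shares
variables with the other members only inside a single one, so a partner there suffices. Every way to
set aside at most `c` chains is tried. Acyclicity is tested by greedy removal of ears. This is
correct because a family has a join forest iff it can be built by adding ears (`alphaAcyclic_iff`),
and because removing any ear keeps an acyclic family acyclic (`Acyc.of_cons`).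

Machine. All data are binary trees, written in prefix code on one stack. The functions in `PolyTime`
are closed under composition, pairing, case distinction and folds with states of polynomial size,
and `polyTime_evaluate` follows from these closure rules. Structured stack programs compile to
multi-stack machines (`Run.stepsTo`). The bracket encoding of the input turns into the prefix code
of a tree symbol by symbol (`rep_instance`), so no parser is needed, and `PolyTime.computable` gives
the machine. -/

namespace StackProg

open Turing

variable {K : Type} {Γ : K → Type}

/-- Structured programs that act on a family of stacks. -/
inductive Prog (Γ : K → Type) where
  | skip
  | push (k : K) (g : Γ k)
  | pop (k : K)
  | seq (p q : Prog Γ)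
  | ite (k : K) (c : Option (Γ k) → Bool) (p q : Prog Γ)
  | loop (k : K) (c : Option (Γ k) → Bool) (p : Prog Γ)

/-- The control points of a program. -/
def Prog.Label : Prog Γ → Type
  | .skip => Unit
  | .push _ _ => Unit
  | .pop _ => Unit
  | .seq p q => p.Label ⊕ q.Label
  | .ite _ _ p q => Option (p.Label ⊕ q.Label)
  | .loop _ _ p => Option p.Label

theorem Prog.finite_label : ∀ p : Prog Γ, Finite p.Label
  | .skip => inferInstanceAs (Finite Unit)
  | .push _ _ => inferInstanceAs (Finite Unit)
  | .pop _ => inferInstanceAs (Finite Unit)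
  | .seq p q =>
    have := p.finite_label
    have := q.finite_label
    inferInstanceAs (Finite (p.Label ⊕ q.Label))
  | .ite _ _ p q =>
    have := p.finite_label
    have := q.finite_label
    inferInstanceAs (Finite (Option (p.Label ⊕ q.Label)))
  | .loop _ _ p =>
    have := p.finite_label
    inferInstanceAs (Finite (Option p.Label))

variable [DecidableEq K]

/-- `Run p S t S'`: started on the stacks `S`, the program `p` stops within `t` steps with the
stacks `S'`. -/
inductive Run : Prog Γ → (∀ k, List (Γ k)) → ℕ → (∀ k, List (Γ k)) → Prop
  | skip (S) : Run .skip S 1 S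
  | push (k g S) : Run (.push k g) S 1 (Function.update S k (g :: S k))
  | pop (k S) : Run (.pop k) S 1 (Function.update S k (S k).tail)
  | seq {p q S t S' t' S''} : Run p S t S' → Run q S' t' S'' → Run (.seq p q) S (t + t') S''
  | iteTrue {k c p q S t S'} : c (S k).head? = true → Run p S t S' →
      Run (.ite k c p q) S (1 + t) S'
  | iteFalse {k c p q S t S'} : c (S k).head? = false → Run q S t S' →
      Run (.ite k c p q) S (1 + t) S'
  | loopTrue {k c p S t S' t' S''} : c (S k).head? = true → Run p S t S' →
      Run (.loop k c p) S' t' S'' → Run (.loop k c p) S (1 + t + t') S''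
  | loopFalse {k c p S} : c (S k).head? = false → Run (.loop k c p) S 1 S
  | mono {p S t t' S'} : Run p S t S' → t ≤ t' → Run p S t' S'

/-! ### Compilation of programs into multi-stack machines. -/

/-- The control point at which a program starts. -/
def Prog.start : (p : Prog Γ) → p.Label
  | .skip => ()
  | .push _ _ => ()
  | .pop _ => ()
  | .seq p _ => Sum.inl p.start
  | .ite _ _ _ _ => none
  | .loop _ _ _ => none

/-- The machine statement at a control point of a program whose control points are embedded by
`emb` into the labels of a machine and which continues at the label `exit`. -/
def Prog.stmt {Λ : Type} : (p : Prog Γ) → (p.Label → Λ) → Λ → p.Label → TM2.Stmt Γ Λ Bool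
  | .skip, _, exit, _ => .goto fun _ => exit
  | .push k g, _, exit, _ => .push k (fun _ => g) (.goto fun _ => exit)
  | .pop k, _, exit, _ => .pop k (fun v _ => v) (.goto fun _ => exit)
  | .seq p q, emb, exit, l =>
    match l with
    | Sum.inl l => p.stmt (fun l => emb (Sum.inl l)) (emb (Sum.inr q.start)) l
    | Sum.inr l => q.stmt (fun l => emb (Sum.inr l)) exit l
  | .ite k c p q, emb, exit, l =>
    match l with
    | none => .peek k (fun _ o => c o) (.branch id (.goto fun _ => emb (some (Sum.inl p.start)))
        (.goto fun _ => emb (some (Sum.inr q.start))))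
    | some (Sum.inl l) => p.stmt (fun l => emb (some (Sum.inl l))) exit l
    | some (Sum.inr l) => q.stmt (fun l => emb (some (Sum.inr l))) exit l
  | .loop k c p, emb, exit, l =>
    match l with
    | none => .peek k (fun _ o => c o) (.branch id (.goto fun _ => emb (some p.start))
        (.goto fun _ => exit))
    | some l => p.stmt (fun l => emb (some l)) (emb none) l

/-- `m` steps lead from one configuration to another. -/
def StepsTo {Λ : Type} (M : Λ → TM2.Stmt Γ Λ Bool) (m : ℕ) (a b : TM2.Cfg Γ Λ Bool) : Prop :=
  (flip bind (TM2.step M))^[m] (some a) = some b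

theorem StepsTo.trans {Λ : Type} {M : Λ → TM2.Stmt Γ Λ Bool} {m n : ℕ} {a b c}
    (h : StepsTo M m a b) (h' : StepsTo M n b c) : StepsTo M (m + n) a c := by
  unfold StepsTo at *
  rw [Nat.add_comm, Function.iterate_add_apply, h, h']

theorem StepsTo.single {Λ : Type} {M : Λ → TM2.Stmt Γ Λ Bool} {a b}
    (h : TM2.step M a = some b) : StepsTo M 1 a b := h

/-- A machine that contains the code of a program carries out every run of it. -/
theorem Run.stepsTo {Λ : Type} {M : Λ → TM2.Stmt Γ Λ Bool} {p : Prog Γ} {S t S'}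
    (h : Run p S t S') : ∀ (emb : p.Label → Λ) (exit : Λ)
    (_ : ∀ l, M (emb l) = p.stmt emb exit l) (v : Bool),
    ∃ m ≤ t, ∃ v', StepsTo M m ⟨some (emb p.start), v, S⟩ ⟨some exit, v', S'⟩ := by
  induction h with
  | skip S =>
    intro emb exit hM v
    exact ⟨1, le_rfl, v, .single (by simp [TM2.step, hM, Prog.stmt])⟩
  | push k g S =>
    intro emb exit hM v
    exact ⟨1, le_rfl, v, .single (by simp [TM2.step, hM, Prog.stmt])⟩
  | pop k S =>
    intro emb exit hM v
    exact ⟨1, le_rfl, v, .single (by simp [TM2.step, hM, Prog.stmt])⟩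
  | @seq p q S t S' t' S'' _ _ ih₁ ih₂ =>
    intro emb exit hM v
    obtain ⟨m, hm, v', h⟩ := ih₁ (fun l => emb (Sum.inl l)) (emb (Sum.inr q.start))
      (fun l => hM (Sum.inl l)) v
    obtain ⟨m', hm', v'', h'⟩ := ih₂ (fun l => emb (Sum.inr l)) exit
      (fun l => hM (Sum.inr l)) v'
    exact ⟨m + m', add_le_add hm hm', v'', h.trans h'⟩
  | @iteTrue k c p q S t S' hc _ ih =>
    intro emb exit hM v
    obtain ⟨m, hm, v', h⟩ := ih (fun l => emb (some (Sum.inl l))) exit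
      (fun l => hM (some (Sum.inl l))) true
    refine ⟨1 + m, by omega, v', StepsTo.trans (.single ?_) h⟩
    have := hM none
    simp only [Prog.start, TM2.step]
    rw [this]
    simp [Prog.stmt, hc]
  | @iteFalse k c p q S t S' hc _ ih =>
    intro emb exit hM v
    obtain ⟨m, hm, v', h⟩ := ih (fun l => emb (some (Sum.inr l))) exit
      (fun l => hM (some (Sum.inr l))) false
    refine ⟨1 + m, by omega, v', StepsTo.trans (.single ?_) h⟩
    have := hM none
    simp only [Prog.start, TM2.step]
    rw [this]
    simp [Prog.stmt, hc]
  | @loopTrue k c p S t S' t' S'' hc _ _ ih₁ ih₂ =>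
    intro emb exit hM v
    -- The body is compiled with the test of the loop as its exit; the second induction hypothesis
    -- resumes from that test.
    obtain ⟨m, hm, v', h⟩ := ih₁ (fun l => emb (some l)) (emb none)
      (fun l => hM (some l)) true
    obtain ⟨m', hm', v'', h'⟩ := ih₂ emb exit hM v'
    refine ⟨1 + m + m', by omega, v'', StepsTo.trans (StepsTo.trans (.single ?_) h) h'⟩
    have := hM none
    simp only [Prog.start, TM2.step]
    rw [this]
    simp [Prog.stmt, hc]
  | @loopFalse k c p S hc =>
    intro emb exit hM v
    refine ⟨1, le_rfl, false, .single ?_⟩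
    have := hM none
    simp only [Prog.start, TM2.step]
    rw [this]
    simp [Prog.stmt, hc]
  | mono _ hle ih =>
    intro emb exit hM v
    obtain ⟨m, hm, h⟩ := ih emb exit hM v
    exact ⟨m, hm.trans hle, h⟩

/-- The machine that runs a program and halts. -/
def Prog.code (p : Prog Γ) : Option p.Label → TM2.Stmt Γ (Option p.Label) Bool
  | none => .load (fun _ => false) .halt
  | some l => p.stmt some none l

/-- The extra step is taken at the exit label, which resets the internal Boolean: a halting
configuration must carry the initial internal state. -/
theorem Run.exists_steps {p : Prog Γ} {S t S'} (h : Run p S t S') :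
    ∃ m ≤ t + 1, StepsTo p.code m ⟨some (some p.start), false, S⟩ ⟨none, false, S'⟩ := by
  obtain ⟨m, hm, v, h⟩ := h.stepsTo (M := p.code) some none (fun _ => rfl) false
  exact ⟨m + 1, by omega, h.trans (.single rfl)⟩

/-- The bundled machine of a program. -/
noncomputable def Prog.machine [Fintype K] (p : Prog Γ) (k₀ k₁ : K) [Fintype (Γ k₀)] : FinTM2 :=
  haveI := p.finite_label
  haveI : Fintype (Option p.Label) := Fintype.ofFinite _
  { K := K, k₀ := k₀, k₁ := k₁, Γ := Γ, Λ := Option p.Label, main := some p.start, σ := Bool,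
    initialState := false, m := p.code }

end StackProg

/-! ### Binary trees on a stack -/

namespace StackProg

/-- Binary trees, the universal data type. -/
inductive D where
  | nil
  | cons (a b : D)
  deriving DecidableEq

namespace D

/-- The prefix code of a tree. -/
def code : D → List Bool
  | nil => [false]
  | cons a b => true :: (a.code ++ b.code)

/-- The first component of a tree. -/
def fst : D → D
  | nil => nil
  | cons a _ => a

/-- The second component of a tree. -/
def snd : D → D
  | nil => nil
  | cons _ b => b

/-- The tree of a list of trees. -/
def list : List D → D
  | [] => nil
  | a :: l => cons a (list l)

@[simp] theorem fst_cons (a b : D) : (cons a b).fst = a := rfl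
@[simp] theorem snd_cons (a b : D) : (cons a b).snd = b := rfl
@[simp] theorem list_nil : list [] = nil := rfl
@[simp] theorem list_cons (a : D) (l : List D) : list (a :: l) = cons a (list l) := rfl

end D

/-- The stacks: input, data, two buffers, a counter, output. -/
inductive Stack where
  | input
  | data
  | bufA
  | bufB
  | counter
  | output
  deriving DecidableEq

instance : Fintype Stack :=
  ⟨{.input, .data, .bufA, .bufB, .counter, .output}, fun k => by cases k <;> decide⟩

/-- The stack alphabets. -/
@[reducible] def Alphabet : Stack → Type
  | .input => Atch.Sym
  | _ => Bool

/-- The stack contents with given data and buffers and with empty input and output. -/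
def contents (m a b c : List Bool) : ∀ k, List (Alphabet k)
  | .input => ([] : List Atch.Sym)
  | .data => m
  | .bufA => a
  | .bufB => b
  | .counter => c
  | .output => ([] : List Bool)

section update

variable (m a b c x : List Bool)

@[simp] theorem contents_data : contents m a b c .data = m := rfl
@[simp] theorem contents_bufA : contents m a b c .bufA = a := rfl
@[simp] theorem contents_bufB : contents m a b c .bufB = b := rfl
@[simp] theorem contents_counter : contents m a b c .counter = c := rfl

@[simp] theorem update_data :
    Function.update (contents m a b c) .data x = contents x a b c := by
  funext k; cases k <;> rfl
@[simp] theorem update_bufA :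
    Function.update (contents m a b c) .bufA x = contents m x b c := by
  funext k; cases k <;> rfl
@[simp] theorem update_bufB :
    Function.update (contents m a b c) .bufB x = contents m a x c := by
  funext k; cases k <;> rfl
@[simp] theorem update_counter :
    Function.update (contents m a b c) .counter x = contents m a b x := by
  funext k; cases k <;> rfl

end update

/-- Programs over the stacks for trees. -/
abbrev TreeProg := Prog Alphabet

open Prog Stack

theorem run_push_data (g : Bool) (m a b c : List Bool) :
    Run (.push data g : TreeProg) (contents m a b c) 1 (contents (g :: m) a b c) := by
  exact (congrArg (Run _ _ 1) (update_data ..)).mp (Run.push (Γ := Alphabet) data g (contents m a b c))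

theorem run_push_bufA (g : Bool) (m a b c : List Bool) :
    Run (.push bufA g : TreeProg) (contents m a b c) 1 (contents m (g :: a) b c) := by
  exact (congrArg (Run _ _ 1) (update_bufA ..)).mp (Run.push (Γ := Alphabet) bufA g (contents m a b c))

theorem run_push_bufB (g : Bool) (m a b c : List Bool) :
    Run (.push bufB g : TreeProg) (contents m a b c) 1 (contents m a (g :: b) c) := by
  exact (congrArg (Run _ _ 1) (update_bufB ..)).mp (Run.push (Γ := Alphabet) bufB g (contents m a b c))

theorem run_push_counter (g : Bool) (m a b c : List Bool) :
    Run (.push counter g : TreeProg) (contents m a b c) 1 (contents m a b (g :: c)) := by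
  exact (congrArg (Run _ _ 1) (update_counter ..)).mp (Run.push (Γ := Alphabet) counter g (contents m a b c))

theorem run_pop_data (g : Bool) (m a b c : List Bool) :
    Run (.pop data : TreeProg) (contents (g :: m) a b c) 1 (contents m a b c) := by
  exact (congrArg (Run _ _ 1) (update_data ..)).mp (Run.pop (Γ := Alphabet) data (contents (g :: m) a b c))

theorem run_pop_bufA (g : Bool) (m a b c : List Bool) :
    Run (.pop bufA : TreeProg) (contents m (g :: a) b c) 1 (contents m a b c) := by
  exact (congrArg (Run _ _ 1) (update_bufA ..)).mp (Run.pop (Γ := Alphabet) bufA (contents m (g :: a) b c))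

theorem run_pop_bufB (g : Bool) (m a b c : List Bool) :
    Run (.pop bufB : TreeProg) (contents m a (g :: b) c) 1 (contents m a b c) := by
  exact (congrArg (Run _ _ 1) (update_bufB ..)).mp (Run.pop (Γ := Alphabet) bufB (contents m a (g :: b) c))

theorem run_pop_counter (g : Bool) (m a b c : List Bool) :
    Run (.pop counter : TreeProg) (contents m a b (g :: c)) 1 (contents m a b c) := by
  exact (congrArg (Run _ _ 1) (update_counter ..)).mp (Run.pop (Γ := Alphabet) counter (contents m a b (g :: c)))

/-- Whether the top of a stack of Booleans is `true`. -/
def isTrue : Option Bool → Bool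
  | some true => true
  | _ => false

/-- Push a bit onto the chosen buffers. -/
def pushBuf (x y g : Bool) : TreeProg :=
  .seq (if x then .push bufA g else .skip) (if y then .push bufB g else .skip)

theorem run_pushBuf (x y g : Bool) (m a b c : List Bool) :
    Run (pushBuf x y g) (contents m a b c) 2
      (contents m (if x then g :: a else a) (if y then g :: b else b) c) := by
  refine Run.seq (t := 1) (t' := 1) (S' := contents m (if x then g :: a else a) b c) ?_ ?_
  · cases x
    · exact Run.skip _
    · exact run_push_bufA ..
  · cases y
    · exact Run.skip _
    · exact run_push_bufB ..

/-- The loop of `moveTree`. -/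
def moveLoop (x y : Bool) : TreeProg :=
  .loop counter Option.isSome <|
    .ite data isTrue (.seq (.pop data) (.seq (pushBuf x y true) (.push counter true)))
      (.seq (.pop data) (.seq (pushBuf x y false) (.pop counter)))

/-- Move the tree on top of the data stack, reversed, to the chosen buffers. -/
def moveTree (x y : Bool) : TreeProg := .seq (.push counter true) (moveLoop x y)

/-- The counter holds one mark for each tree still to be read: a leaf removes a mark, a node adds
one. Finishing a subtree does not end the loop, so the run that follows enters as the hypothesis
`h`; this makes the induction on the tree work. Six steps per bit: loop test, branch, pop, two for
the buffers, one for the counter. -/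
theorem run_moveLoop (x y : Bool) (d : D) (m a b c : List Bool) (t : ℕ) (S)
    (h : Run (moveLoop x y) (contents m (if x then d.code.reverse ++ a else a)
      (if y then d.code.reverse ++ b else b) c) t S) :
    Run (moveLoop x y) (contents (d.code ++ m) a b (true :: c)) (6 * d.code.length + t) S := by
  induction d generalizing m a b c t with
  | nil =>
    refine Run.mono (Run.loopTrue (k := counter) (t := 5) (t' := t) rfl (Run.iteFalse (t := 4) rfl
      (Run.seq (t := 1) (run_pop_data ..) (Run.seq (t := 2) (t' := 1) (run_pushBuf ..)
        (run_pop_counter ..)))) ?_) (by simp [D.code])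
    change Run (moveLoop x y) _ _ _
    simpa [D.code] using h
  | cons d e ihd ihe =>
    refine Run.mono (Run.loopTrue (k := counter) (t := 5)
      (t' := 6 * d.code.length + (6 * e.code.length + t)) rfl (Run.iteTrue (t := 4) rfl
      (Run.seq (t := 1) (run_pop_data ..) (Run.seq (t := 2) (t' := 1) (run_pushBuf ..)
        (run_push_counter ..)))) ?_) (by simp [D.code]; omega)
    change Run (moveLoop x y) (contents ((d.code ++ e.code) ++ m) _ _ _) _ _
    rw [List.append_assoc]
    apply ihd
    apply ihe
    convert h using 2
    · cases x <;> simp [D.code]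
    · cases y <;> simp [D.code]

theorem run_moveTree (x y : Bool) (d : D) (m a b : List Bool) :
    Run (moveTree x y) (contents (d.code ++ m) a b []) (6 * d.code.length + 2)
      (contents m (if x then d.code.reverse ++ a else a)
        (if y then d.code.reverse ++ b else b) []) := by
  refine Run.mono (Run.seq (t := 1) (run_push_counter ..)
    (run_moveLoop x y d m a b [] 1 _ (Run.loopFalse rfl))) (by omega)

/-- Empty the first buffer onto the data stack. -/
def flushA : TreeProg :=
  .loop bufA Option.isSome <|
    .seq (.ite bufA isTrue (.push data true) (.push data false)) (.pop bufA)

/-- Empty the second buffer onto the data stack. -/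
def flushB : TreeProg :=
  .loop bufB Option.isSome <|
    .seq (.ite bufB isTrue (.push data true) (.push data false)) (.pop bufB)

theorem run_flushA (m a b c : List Bool) :
    Run flushA (contents m a b c) (4 * a.length + 1) (contents (a.reverse ++ m) [] b c) := by
  induction a generalizing m with
  | nil => exact Run.loopFalse rfl
  | cons g a ih =>
    have h : Run (.ite bufA isTrue (.push data true) (.push data false) : TreeProg)
        (contents m (g :: a) b c) 2 (contents (g :: m) (g :: a) b c) := by
      cases g
      · exact Run.iteFalse rfl (run_push_data ..)
      · exact Run.iteTrue rfl (run_push_data ..)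
    have h' := (Run.loopTrue (k := bufA) (c := Option.isSome) rfl
      (h.seq (run_pop_bufA ..)) (ih (g :: m))).mono (t' := 4 * (g :: a).length + 1)
      (by simp; omega)
    simpa [flushA] using h'

theorem run_flushB (m a b c : List Bool) :
    Run flushB (contents m a b c) (4 * b.length + 1) (contents (b.reverse ++ m) a [] c) := by
  induction b generalizing m with
  | nil => exact Run.loopFalse rfl
  | cons g b ih =>
    have h : Run (.ite bufB isTrue (.push data true) (.push data false) : TreeProg)
        (contents m a (g :: b) c) 2 (contents (g :: m) a (g :: b) c) := by
      cases g
      · exact Run.iteFalse rfl (run_push_data ..)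
      · exact Run.iteTrue rfl (run_push_data ..)
    have h' := (Run.loopTrue (k := bufB) (c := Option.isSome) rfl
      (h.seq (run_pop_bufB ..)) (ih (g :: m))).mono (t' := 4 * (g :: b).length + 1)
      (by simp; omega)
    simpa [flushB] using h'

/-- Duplicate the tree on top of the data stack. -/
def dup : TreeProg := .seq (moveTree true true) (.seq flushA flushB)

/-- Exchange the two trees on top of the data stack. -/
def swap : TreeProg :=
  .seq (moveTree true false) (.seq (moveTree false true) (.seq flushA flushB))

/-- Remove the tree on top of the data stack. -/
def drop : TreeProg := moveTree false false

/-- The buffers receive reversed copies, and emptying a buffer reverses once more. -/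
theorem run_dup (d : D) (m : List Bool) :
    Run dup (contents (d.code ++ m) [] [] []) (14 * d.code.length + 4)
      (contents (d.code ++ (d.code ++ m)) [] [] []) := by
  have h₁ := run_moveTree true true d m [] []
  have h₂ := run_flushA m d.code.reverse d.code.reverse []
  have h₃ := run_flushB (d.code ++ m) [] d.code.reverse []
  simp only [if_true, List.append_nil, List.reverse_reverse, List.length_reverse] at h₁ h₂ h₃
  exact (h₁.seq (h₂.seq h₃)).mono (by omega)

theorem run_swap (d e : D) (m : List Bool) :
    Run swap (contents (d.code ++ (e.code ++ m)) [] [] [])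
      (10 * d.code.length + 10 * e.code.length + 6)
      (contents (e.code ++ (d.code ++ m)) [] [] []) := by
  have h₁ := run_moveTree true false d (e.code ++ m) [] []
  have h₂ := run_moveTree false true e m d.code.reverse []
  have h₃ := run_flushA m d.code.reverse e.code.reverse []
  have h₄ := run_flushB (d.code ++ m) [] e.code.reverse []
  simp only [if_true, List.append_nil, List.reverse_reverse, List.length_reverse,
    Bool.false_eq_true, if_false] at h₁ h₂ h₃ h₄
  exact (h₁.seq (h₂.seq (h₃.seq h₄))).mono (by omega)

theorem run_drop (d : D) (m : List Bool) :
    Run drop (contents (d.code ++ m) [] [] []) (6 * d.code.length + 2) (contents m [] [] []) := by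
  exact run_moveTree false false d m [] []

end StackProg

/-! ### Polynomial-time functions on encoded data -/

namespace StackProg

/-- Types whose elements are represented by trees. -/
class Code (α : Type) where
  toD : α → D

open Code

instance : Code D := ⟨id⟩
instance : Code Unit := ⟨fun _ => .nil⟩
instance : Code Bool := ⟨fun b => if b then .cons .nil .nil else .nil⟩
instance {α β : Type} [Code α] [Code β] : Code (α × β) := ⟨fun x => .cons (toD x.1) (toD x.2)⟩
instance {α : Type} [Code α] : Code (List α) := ⟨fun l => .list (l.map toD)⟩

variable {α β γ δ : Type} [Code α] [Code β] [Code γ] [Code δ]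

@[simp] theorem toD_D (x : D) : toD x = x := rfl
@[simp] theorem toD_unit (x : Unit) : toD x = .nil := rfl
@[simp] theorem toD_true : toD true = .cons .nil .nil := rfl
@[simp] theorem toD_false : toD false = .nil := rfl
@[simp] theorem toD_pair (a : α) (b : β) : toD (a, b) = .cons (toD a) (toD b) := rfl
@[simp] theorem toD_nil : toD ([] : List α) = .nil := rfl
@[simp] theorem toD_cons (a : α) (l : List α) : toD (a :: l) = .cons (toD a) (toD l) := rfl

/-- The length of the code of an element. -/
def size (x : α) : ℕ := (toD x).code.length

theorem size_eq (x : α) : size x = size (toD x) := rfl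
@[simp] theorem size_D_nil : size D.nil = 1 := rfl
@[simp] theorem size_D_cons (a b : D) : size (D.cons a b) = size a + size b + 1 := by
  simp [size, D.code]
@[simp] theorem size_unit (x : Unit) : size x = 1 := rfl
@[simp] theorem size_true : size true = 3 := rfl
@[simp] theorem size_false : size false = 1 := rfl
theorem size_bool_le (b : Bool) : size b ≤ 3 := by cases b <;> simp
@[simp] theorem size_pair (a : α) (b : β) : size (a, b) = size a + size b + 1 := by
  simp [size_eq (a, b), ← size_eq]
@[simp] theorem size_nil : size ([] : List α) = 1 := rfl
@[simp] theorem size_cons (a : α) (l : List α) : size (a :: l) = size a + size l + 1 := by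
  simp [size_eq (a :: l), ← size_eq]

theorem size_pos (x : α) : 0 < size x := by
  unfold size
  cases toD x <;> simp [D.code]

theorem size_le_of_mem {a : α} {l : List α} (h : a ∈ l) : size a ≤ size l := by
  induction l with
  | nil => simp at h
  | cons b l ih =>
    rcases List.mem_cons.1 h with rfl | h
    · simp; omega
    · have := ih h
      simp; omega

theorem length_le_size (l : List α) : l.length ≤ size l := by
  induction l with
  | nil => simp
  | cons b l ih => simp; omega

/-- The leaf that ends `l` is replaced by `l'`, which accounts for the one symbol. -/
theorem size_append (l l' : List α) : size (l ++ l') + 1 = size l + size l' := by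
  induction l with
  | nil => simp; omega
  | cons a l ih => simp; omega

theorem size_le_of_sublist {l l' : List α} (h : l.Sublist l') : size l ≤ size l' := by
  induction h with
  | slnil => simp
  | cons a _ ih => simp; omega
  | cons_cons a _ ih => simp; omega

/-! #### Polynomial bounds -/

/-- A quantity bounded by a polynomial in the size of the argument. -/
def PolyBdd (t : α → ℕ) : Prop := ∃ p : Polynomial ℕ, ∀ x, t x ≤ p.eval (size x)

/-- The coefficients are natural numbers. Monotonicity is what allows bounds to be composed. -/
theorem eval_mono (p : Polynomial ℕ) : Monotone fun n => p.eval n := by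
  intro m n h
  induction p using Polynomial.induction_on' with
  | add p q hp hq => simpa using add_le_add hp hq
  | monomial k a => simpa using Nat.mul_le_mul_left a (Nat.pow_le_pow_left h k)

namespace PolyBdd

theorem mono {s t : α → ℕ} (h : PolyBdd t) (hle : ∀ x, s x ≤ t x) : PolyBdd s :=
  let ⟨p, hp⟩ := h
  ⟨p, fun x => (hle x).trans (hp x)⟩

theorem const (n : ℕ) : PolyBdd fun _ : α => n := ⟨Polynomial.C n, by simp⟩

theorem size : PolyBdd fun x : α => size x := ⟨Polynomial.X, by simp⟩

theorem add {s t : α → ℕ} (hs : PolyBdd s) (ht : PolyBdd t) : PolyBdd fun x => s x + t x :=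
  let ⟨p, hp⟩ := hs
  let ⟨q, hq⟩ := ht
  ⟨p + q, fun x => by simpa using add_le_add (hp x) (hq x)⟩

theorem mul {s t : α → ℕ} (hs : PolyBdd s) (ht : PolyBdd t) : PolyBdd fun x => s x * t x :=
  let ⟨p, hp⟩ := hs
  let ⟨q, hq⟩ := ht
  ⟨p * q, fun x => by simpa using Nat.mul_le_mul (hp x) (hq x)⟩

theorem comp {t : β → ℕ} {f : α → β} (ht : PolyBdd t) (hf : PolyBdd fun x => StackProg.size (f x)) :
    PolyBdd fun x => t (f x) :=
  let ⟨p, hp⟩ := hf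
  let ⟨q, hq⟩ := ht
  ⟨q.comp p, fun x => by
    rw [Polynomial.eval_comp]
    exact (hq _).trans (eval_mono q (hp x))⟩

theorem eval {t : α → ℕ} (p : Polynomial ℕ) (ht : PolyBdd t) : PolyBdd fun x => p.eval (t x) :=
  let ⟨q, hq⟩ := ht
  ⟨p.comp q, fun x => by
    rw [Polynomial.eval_comp]
    exact eval_mono p (hq x)⟩

end PolyBdd

/-! #### Polynomial-time functions -/

/-- The data stack with the code of `x` on top. -/
abbrev top (x : α) (m : List Bool) : ∀ k, List (Alphabet k) :=
  contents ((toD x).code ++ m) [] [] []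

/-- Functions computed by a program in polynomial time, argument and value being on top of the
data stack. -/
@[fun_prop]
def PolyTime (f : α → β) : Prop :=
  ∃ (P : TreeProg) (t : α → ℕ), PolyBdd t ∧ PolyBdd (fun x => size (f x)) ∧
    ∀ x m, Run P (top x m) (t x) (top (f x) m)

/-- Case distinction on a list. -/
def listCase {β γ : Type} (l : List β) (z : γ) (s : β → List β → γ) : γ :=
  match l with
  | [] => z
  | b :: k => s b k

@[simp] theorem listCase_nil {β γ : Type} (z : γ) (s : β → List β → γ) :
    listCase [] z s = z := rfl

@[simp] theorem listCase_cons {β γ : Type} (b : β) (k : List β) (z : γ) (s : β → List β → γ) :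
    listCase (b :: k) z s = s b k := rfl

namespace PolyTime

theorem size_bdd {f : α → β} (h : PolyTime f) : PolyBdd fun x => size (f x) :=
  let ⟨_, _, _, h, _⟩ := h
  h

/-- Polynomial-time functions through the representation. -/
theorem of_toD {f : α → β} (g : D → D) (hg : PolyTime g) (h : ∀ x, toD (f x) = g (toD x)) :
    PolyTime f := by
  obtain ⟨P, t, ⟨p, hp⟩, ⟨q, hq⟩, hP⟩ := hg
  refine ⟨P, fun x => t (toD x), ⟨p, fun x => hp (toD x)⟩, ⟨q, fun x => ?_⟩, fun x m => ?_⟩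
  · have := hq (toD x)
    simp only [← h] at this
    exact this
  · have := hP (toD x) m
    rw [← h] at this
    exact this

@[fun_prop]
theorem id : PolyTime (fun x : α => x) :=
  ⟨.skip, fun _ => 1, .const 1, .size, fun _ _ => Run.skip _⟩

@[fun_prop]
theorem comp {f : β → γ} {g : α → β} (hf : PolyTime f) (hg : PolyTime g) :
    PolyTime fun x => f (g x) := by
  obtain ⟨P, t, ht, hs, hP⟩ := hf
  obtain ⟨Q, u, hu, hv, hQ⟩ := hg
  exact ⟨.seq Q P, fun x => u x + t (g x), hu.add (ht.comp hv), hs.comp hv,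
    fun x m => (hQ x m).seq (hP (g x) m)⟩

/-- Such functions only reread a tree as an element of another type, for instance a pair as a list
cell; the empty program computes them. -/
theorem same {f : α → β} (h : ∀ x, toD (f x) = toD x) : PolyTime f := of_toD _ id h

-- The argument is duplicated, `g` consumes the upper copy, and after the exchange `f` consumes the
-- lower one. A single `true` then joins the two adjacent codes to the code of a node.
@[fun_prop]
theorem pair {f : α → β} {g : α → γ} (hf : PolyTime f) (hg : PolyTime g) :
    PolyTime fun x => (f x, g x) := by
  obtain ⟨P, t, ht, hs, hP⟩ := hf
  obtain ⟨Q, u, hu, hv, hQ⟩ := hg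
  refine ⟨.seq dup (.seq Q (.seq swap (.seq P (.push .data true)))),
    fun x => (14 * size x + 4) + (u x + ((10 * size (g x) + 10 * size x + 6) + (t x + 1))),
    ?_, ?_, fun x m => ?_⟩
  · exact (((PolyBdd.const 14).mul .size).add (.const 4)).add (hu.add (((((PolyBdd.const 10).mul
      hv).add ((PolyBdd.const 10).mul .size)).add (.const 6)).add (ht.add (.const 1))))
  · simpa using (hs.add hv).add (.const 1)
  · refine (run_dup (toD x) m).seq ((hQ x _).seq ((run_swap (toD (g x)) (toD x) m).seq
      ((hP x _).seq ?_)))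
    have := run_push_data true ((toD (f x)).code ++ ((toD (g x)).code ++ m)) [] [] []
    simpa [top, D.code] using this

theorem unconsD : PolyTime fun x : D => x.snd := by
  refine ⟨.ite .data isTrue (.seq (.pop .data) drop) .skip, fun x => 6 * size x + 4,
    ((PolyBdd.const 6).mul .size).add (.const 4), PolyBdd.size.mono fun x => ?_, fun x m => ?_⟩
  · cases x <;> simp [D.snd]; omega
  · cases x with
    | nil => exact (Run.iteFalse rfl (Run.skip _)).mono (by simp)
    | cons a b =>
      have h₁ := run_pop_data true (a.code ++ (b.code ++ m)) [] [] []
      have h₂ := run_drop a (b.code ++ m)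
      have := (Run.iteTrue (k := .data) (c := isTrue) (q := .skip) rfl (h₁.seq h₂)).mono
        (t' := 6 * size (D.cons a b) + 4) (by simp [size, D.code]; omega)
      simpa [top, D.code, List.append_assoc] using this

theorem fstD : PolyTime fun x : D => x.fst := by
  refine ⟨.ite .data isTrue (.seq (.pop .data) (.seq swap drop)) .skip, fun x => 16 * size x + 10,
    ((PolyBdd.const 16).mul .size).add (.const 10), PolyBdd.size.mono fun x => ?_, fun x m => ?_⟩
  · cases x <;> simp [D.fst]; omega
  · cases x with
    | nil => exact (Run.iteFalse rfl (Run.skip _)).mono (by simp)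
    | cons a b =>
      have h₁ := run_pop_data true (a.code ++ (b.code ++ m)) [] [] []
      have h₂ := run_swap a b m
      have h₃ := run_drop b (a.code ++ m)
      have := (Run.iteTrue (k := .data) (c := isTrue) (q := .skip) rfl
        (h₁.seq (h₂.seq h₃))).mono (t' := 16 * size (D.cons a b) + 10)
        (by simp [size, D.code]; omega)
      simpa [top, D.code, List.append_assoc] using this

@[fun_prop]
theorem dFst {f : α → D} (hf : PolyTime f) : PolyTime fun x => (f x).fst := fstD.comp hf

@[fun_prop]
theorem dSnd {f : α → D} (hf : PolyTime f) : PolyTime fun x => (f x).snd := unconsD.comp hf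

@[fun_prop]
theorem fst {f : α → β × γ} (hf : PolyTime f) : PolyTime fun x => (f x).1 :=
  comp (f := fun p : β × γ => p.1) (of_toD _ fstD fun _ => rfl) hf

@[fun_prop]
theorem snd {f : α → β × γ} (hf : PolyTime f) : PolyTime fun x => (f x).2 :=
  comp (f := fun p : β × γ => p.2) (of_toD _ unconsD fun _ => rfl) hf

theorem constD (d : D) : PolyTime fun _ : α => d := by
  have hnil : PolyTime fun _ : α => D.nil := by
    refine ⟨.seq drop (.push .data false), fun x => 6 * size x + 3,
      ((PolyBdd.const 6).mul .size).add (.const 3), .const 1, fun x m => ?_⟩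
    have h₁ := run_drop (toD x) m
    exact (h₁.seq (run_push_data false m [] [] [])).mono (by simp [size])
  induction d with
  | nil => exact hnil
  | cons a b iha ihb =>
    exact comp (f := fun p : D × D => D.cons p.1 p.2) (same fun _ => rfl) (iha.pair ihb)

@[fun_prop]
theorem const (b : β) : PolyTime fun _ : α => b :=
  comp (f := fun _ : D => b) (of_toD _ (constD (toD b)) fun _ => rfl) (constD .nil)

@[fun_prop]
theorem dCons {f g : α → D} (hf : PolyTime f) (hg : PolyTime g) :
    PolyTime fun x => D.cons (f x) (g x) :=
  comp (f := fun p : D × D => D.cons p.1 p.2) (same fun _ => rfl) (hf.pair hg)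

@[fun_prop]
theorem cons {f : α → β} {g : α → List β} (hf : PolyTime f) (hg : PolyTime g) :
    PolyTime fun x => f x :: g x :=
  comp (f := fun p : β × List β => p.1 :: p.2) (same fun _ => rfl) (hf.pair hg)

@[fun_prop]
theorem tail {f : α → List β} (hf : PolyTime f) : PolyTime fun x => (f x).tail :=
  comp (f := fun l : List β => l.tail) (of_toD _ unconsD fun l => by cases l <;> rfl) hf

/-- Case distinction. -/
@[fun_prop]
theorem cond {c : α → Bool} {f g : α → β} (hc : PolyTime c) (hf : PolyTime f) (hg : PolyTime g) :
    PolyTime fun x => bif c x then f x else g x := by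
  obtain ⟨P, t, ht, hs, hP⟩ := hf
  obtain ⟨Q, u, hu, hv, hQ⟩ := hg
  obtain ⟨R, v, hv', -, hR⟩ := hc.pair (id (α := α))
  -- The first pop removes the constructor of the pair. The code of `true` has three bits and that
  -- of `false` one, hence three pops in one branch and one in the other.
  refine ⟨.seq R (.seq (.pop .data) (.ite .data isTrue
    (.seq (.pop .data) (.seq (.pop .data) (.seq (.pop .data) P))) (.seq (.pop .data) Q))),
    fun x => v x + (1 + (1 + (3 + t x + u x))), ?_, ?_, fun x m => ?_⟩
  · exact hv'.add ((PolyBdd.const 1).add ((PolyBdd.const 1).add (((PolyBdd.const 3).add ht).add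
      hu)))
  · refine (hs.add hv).mono fun x => ?_
    cases h : c x <;> simp [h]
  · refine (hR x m).seq (Run.seq (t := 1) (run_pop_data ..) ?_)
    have key : ∀ b : Bool, Run (.ite .data isTrue
        (.seq (.pop .data) (.seq (.pop .data) (.seq (.pop .data) P))) (.seq (.pop .data) Q))
        (contents ((toD b).code ++ ((toD x).code ++ m)) [] [] []) (1 + (3 + t x + u x))
        (top (bif b then f x else g x) m) := by
      rintro (_ | _)
      · exact Run.mono (Run.iteFalse (k := .data) rfl (Run.seq (run_pop_data ..) (hQ x m)))
          (by omega)
      · exact Run.mono (Run.iteTrue (k := .data) rfl (Run.seq (run_pop_data ..)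
          (Run.seq (run_pop_data ..) (Run.seq (run_pop_data ..) (hP x m))))) (by omega)
    have h := key (c x)
    rw [← List.append_assoc] at h
    exact h

/-- Whether a tree is a leaf. -/
theorem isNilD : PolyTime fun x : D => decide (x = .nil) := by
  refine ⟨.ite .data isTrue (.seq drop (.push .data false))
    (.seq (.push .data false) (.push .data true)), fun x => 6 * size x + 4,
    ((PolyBdd.const 6).mul .size).add (.const 4), (PolyBdd.const 3).mono fun _ => size_bool_le _,
    fun x m => ?_⟩
  cases x with
  | nil =>
    exact (Run.iteFalse rfl ((run_push_data ..).seq (run_push_data ..))).mono (by simp)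
  | cons a b =>
    exact (Run.iteTrue rfl ((run_drop (D.cons a b) m).seq (run_push_data ..))).mono
      (by simp [size]; omega)

@[fun_prop]
theorem listCase {l : α → List β} {f : α → γ} {g : α → β → List β → γ} (hl : PolyTime l)
    (hf : PolyTime f) (hg : PolyTime fun p : α × β × List β => g p.1 p.2.1 p.2.2) :
    PolyTime fun x => StackProg.listCase (l x) (f x) (g x) := by
  obtain ⟨P, t, ht, hs, hP⟩ := hf
  obtain ⟨Q, u, hu, hv, hQ⟩ := hg
  obtain ⟨R, v, hv', hw, hR⟩ := hl.pair (id (α := α))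
  -- The list `b :: k` and the pair `(b, k)` have the same tree, so exchanging list and context and
  -- pushing one `true` yields the code of `(x, b, k)`.
  refine ⟨.seq R (.seq (.pop .data) (.ite .data isTrue
    (.seq swap (.seq (.push .data true) Q)) (.seq (.pop .data) P))),
    fun x => v x + (1 + (1 + (10 * size (l x, x) + 7 + t x +
      StackProg.listCase (l x) 0 fun b k => u (x, b, k)))), ?_, ?_, fun x m => ?_⟩
  · obtain ⟨p, hp⟩ := hu
    refine hv'.add ((PolyBdd.const 1).add ((PolyBdd.const 1).add (((((PolyBdd.const 10).mul
      hw).add (.const 7)).add ht).add ((PolyBdd.eval p hw).mono fun x => ?_))))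
    cases h : l x with
    | nil => simp
    | cons b k =>
      refine (hp (x, b, k)).trans (eval_mono p ?_)
      simp [h]; omega
  · obtain ⟨p, hp⟩ := hv
    refine (hs.add (PolyBdd.eval p hw)).mono fun x => ?_
    cases h : l x with
    | nil => simp [h]
    | cons b k =>
      simp only [h, StackProg.listCase_cons]
      refine le_add_left ((hp (x, b, k)).trans (eval_mono p ?_))
      simp; omega
  · refine (hR x m).seq (Run.seq (t := 1) (run_pop_data ..) ?_)
    have key : ∀ k : List β, Run (.ite .data isTrue
        (.seq swap (.seq (.push .data true) Q)) (.seq (.pop .data) P))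
        (contents ((toD k).code ++ ((toD x).code ++ m)) [] [] [])
        (1 + (10 * size (k, x) + 7 + t x + StackProg.listCase k 0 fun b k => u (x, b, k)))
        (top (StackProg.listCase k (f x) (g x)) m) := by
      rintro (_ | ⟨b, k⟩)
      · exact Run.mono (Run.iteFalse (k := .data) rfl (Run.seq (run_pop_data ..) (hP x m)))
          (by simp)
      · have h := hQ (x, b, k) m
        simp only [top, toD_pair, D.code, List.cons_append, List.append_assoc] at h
        refine Run.mono (Run.iteTrue (k := .data) rfl (Run.seq (run_swap (toD (b :: k)) (toD x) m)
          (Run.seq (t' := u (x, b, k)) (run_push_data ..) ?_))) ?_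
        · simpa [D.code] using h
        · simp only [← size.eq_def, size_pair, StackProg.listCase_cons]; omega
    have h := key (l x)
    rw [← List.append_assoc] at h
    exact h

/-- Iteration of a step that announces when to stop. -/
theorem loop {B : β → Bool × β} (hB : PolyTime B) {base : α → β} (hbase : PolyTime base)
    {n : α → ℕ} (hn : PolyBdd n) {s : α → ℕ} (hs : PolyBdd s)
    (hsize : ∀ x, ∀ i ≤ n x, size ((fun y => (B y).2)^[i] (base x)) ≤ s x)
    (htrue : ∀ x, ∀ i < n x, (B ((fun y => (B y).2)^[i] (base x))).1 = true)
    (hfalse : ∀ x, (B ((fun y => (B y).2)^[n x] (base x))).1 = false) :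
    PolyTime fun x => (fun y => (B y).2)^[n x + 1] (base x) := by
  obtain ⟨P, t, ⟨p, hp⟩, ⟨q, hq⟩, hP⟩ := hB
  obtain ⟨Q, u, hu, hv, hQ⟩ := hbase
  set body : TreeProg := .seq (.pop .data) (.seq (.pop .data) (.seq (.pop .data) (.seq P
    (.pop .data)))) with hbody
  set L : TreeProg := .loop .data isTrue body with hL
  have hbodyRun (y : β) (m : List Bool) : Run body
      (contents ((toD true).code ++ ((toD y).code ++ m)) [] [] []) (4 + t y)
      (contents ((toD (B y).1).code ++ ((toD (B y).2).code ++ m)) [] [] []) := by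
    have h := hP y m
    simp only [top] at h
    have e : (toD (B y)).code ++ m =
        true :: ((toD (B y).1).code ++ ((toD (B y).2).code ++ m)) := by
      change (D.cons (toD (B y).1) (toD (B y).2)).code ++ m = _
      simp [D.code]
    rw [e] at h
    exact Run.mono (Run.seq (run_pop_data ..) (Run.seq (run_pop_data ..) (Run.seq
      (run_pop_data ..) (h.seq (run_pop_data ..))))) (by omega)
  -- A round costs one step for the test and at most `4 + T` for the body: three pops for the flag
  -- `true`, the program `P`, one pop for the constructor of its result.
  have hloop (k : ℕ) : ∀ (y : β) (m : List Bool) (T : ℕ),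
      (∀ i ≤ k, t ((fun y => (B y).2)^[i] y) ≤ T) →
      (∀ i < k, (B ((fun y => (B y).2)^[i] y)).1 = true) →
      (B ((fun y => (B y).2)^[k] y)).1 = false →
      Run L (contents ((toD true).code ++ ((toD y).code ++ m)) [] [] [])
        ((k + 1) * (5 + T) + 1)
        (contents ((toD false).code ++
          ((toD ((fun y => (B y).2)^[k + 1] y)).code ++ m)) [] [] []) := by
    induction k with
    | zero =>
      intro y m T hT _ hf
      have h := hbodyRun y m
      simp only [Function.iterate_zero, id_eq] at hf
      rw [hf] at h
      have := hT 0 le_rfl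
      simp only [Function.iterate_zero, id_eq] at this
      exact Run.mono (Run.loopTrue (k := Stack.data) rfl h (Run.loopFalse (k := Stack.data) rfl))
        (by omega)
    | succ k ih =>
      intro y m T hT ht hf
      have h := hbodyRun y m
      have h0 := ht 0 (by omega)
      simp only [Function.iterate_zero, id_eq] at h0
      rw [h0] at h
      have := hT 0 (by omega)
      simp only [Function.iterate_zero, id_eq] at this
      have h' := ih (B y).2 m T (fun i hi => hT (i + 1) (by omega))
        (fun i hi => ht (i + 1) (by omega)) hf
      exact Run.mono (Run.loopTrue (k := .data) rfl h h') (by ring_nf; omega)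
  have hrest : PolyBdd fun x => p.eval (s x) := hs.eval p
  -- The three pushed bits spell the code of `true`, so the first test succeeds; the last pop
  -- removes the final flag `false`.
  refine ⟨.seq Q (.seq (.push .data false) (.seq (.push .data false) (.seq (.push .data true)
    (.seq L (.pop .data))))),
    fun x => u x + ((n x + 1) * (5 + p.eval (s x)) + 5), ?_, ?_, fun x m => ?_⟩
  · exact hu.add (((hn.add (.const 1)).mul ((PolyBdd.const 5).add hrest)).add (.const 5))
  · refine (hs.eval q).mono fun x => ?_
    simp only
    rw [Function.iterate_succ_apply']
    refine le_trans ?_ ((hq ((fun y => (B y).2)^[n x] (base x))).trans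
      (eval_mono q (hsize x _ le_rfl)))
    change _ ≤ size ((B _).1, (B _).2)
    rw [size_pair]
    omega
  · have h := hloop (n x) (base x) m (p.eval (s x))
      (fun i hi => (hp _).trans (eval_mono p (hsize x i hi))) (htrue x) (hfalse x)
    exact Run.mono (Run.seq (hQ x m) (Run.seq (run_push_data ..) (Run.seq (run_push_data ..)
      (Run.seq (run_push_data ..) (Run.seq h (run_pop_data ..)))))) (by simp only; omega)

/-- Folding over a list with a state of polynomial size. -/
theorem foldl_of_bdd {step : α → γ → β → γ} {l : α → List β} {base : α → γ} (hl : PolyTime l)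
    (hbase : PolyTime base) (hstep : PolyTime fun p : α × γ × β => step p.1 p.2.1 p.2.2)
    {s : α → ℕ} (hs : PolyBdd s)
    (hsize : ∀ x i, size (((l x).take i).foldl (step x) (base x)) ≤ s x) :
    PolyTime fun x => (l x).foldl (step x) (base x) := by
  -- The state consists of the unread entries, the context and the accumulator. On an empty list the
  -- accumulator is left alone, which absorbs the surplus iteration of `loop`.
  let B : List β × α × γ → Bool × List β × α × γ := fun y =>
    StackProg.listCase y.1 (false, [], y.2) fun b k => (true, k, y.2.1, step y.2.1 y.2.2 b)
  have hB : PolyTime B := by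
    have := hstep.comp (g := fun q : (List β × α × γ) × β × List β => (q.1.2.1, q.1.2.2, q.2.1))
      (by fun_prop)
    simp only [B]
    fun_prop
  have hit (i : ℕ) : ∀ (k : List β) (a : α) (c : γ), i ≤ k.length →
      (fun y => (B y).2)^[i] (k, a, c) = (k.drop i, a, (k.take i).foldl (step a) c) := by
    induction i with
    | zero => simp
    | succ i ih =>
      rintro (_ | ⟨b, k⟩) a c hi
      · simp at hi
      · rw [Function.iterate_succ_apply]
        exact ih k a _ (by simpa using hi)
  have key := loop hB (base := fun x => (l x, x, base x)) (by fun_prop)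
    (n := fun x => (l x).length) (hl.size_bdd.mono fun x => length_le_size _)
    (s := fun x => size (l x) + (size x + s x + 1) + 1)
    ((hl.size_bdd.add ((PolyBdd.size.add hs).add (.const 1))).add (.const 1)) ?_ ?_ ?_
  · refine PolyTime.comp (f := fun y : List β × α × γ => y.2.2) (by fun_prop) key |> Eq.subst ?_
    funext x
    simp only [Function.iterate_succ_apply', hit _ _ _ _ le_rfl]
    simp [B]
  · intro x i hi
    rw [hit _ _ _ _ hi]
    have h₁ := size_le_of_sublist ((l x).drop_sublist i)
    have h₂ := hsize x i
    simp only [size_pair]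
    omega
  · intro x i hi
    rw [hit _ _ _ _ hi.le, List.drop_eq_getElem_cons hi]
    rfl
  · intro x
    rw [hit _ _ _ _ le_rfl]
    simp [B]

/-- Folding over a list. Each step may enlarge the state by an amount that is polynomial in the
sizes of the context and of the entry of the list. -/
theorem foldl {step : α → γ → β → γ} {l : α → List β} {base : α → γ} (hl : PolyTime l)
    (hbase : PolyTime base) (hstep : PolyTime fun p : α × γ × β => step p.1 p.2.1 p.2.2)
    {t : α × β → ℕ} (ht : PolyBdd t) (hsize : ∀ a s b, size (step a s b) ≤ size s + t (a, b)) :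
    PolyTime fun x => (l x).foldl (step x) (base x) := by
  -- A bound that depends on the sum of the two sizes lets monotonicity replace the size of each
  -- entry by a common `M`, so the total growth is at most the number of entries times one value of
  -- `p`. The shift by one is the constructor of the pair.
  obtain ⟨p, hp⟩ : ∃ p : Polynomial ℕ, ∀ a s b,
      size (step a s b) ≤ size s + p.eval (size a + size b) := by
    obtain ⟨p, hp⟩ := ht
    refine ⟨p.comp (.X + 1), fun a s b => (hsize a s b).trans ?_⟩
    simpa using hp (a, b)
  have hfold (a : α) (M : ℕ) : ∀ (k : List β) (c : γ), (∀ b ∈ k, size b ≤ M) →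
      size (k.foldl (step a) c) ≤ size c + k.length * p.eval (size a + M) := by
    intro k
    induction k with
    | nil => simp
    | cons b k ih =>
      intro c hb
      have h₁ := ih (step a c b) fun b hb' => hb b (by simp [hb'])
      have h₂ := hp a c b
      have h₃ := eval_mono p (Nat.add_le_add_left (hb b (by simp)) (size a))
      simp only at h₃
      simp only [List.foldl_cons, List.length_cons]
      linarith
  refine foldl_of_bdd hl hbase hstep
    (s := fun x => size (base x) + size (l x) * p.eval (size x + size (l x)))
    (hbase.size_bdd.add (hl.size_bdd.mul ((PolyBdd.size.add hl.size_bdd).eval p))) fun x i => ?_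
  have h₂ := hfold x (size (l x)) ((l x).take i) (base x)
    fun b hb => size_le_of_mem (List.mem_of_mem_take hb)
  have h₃ : ((l x).take i).length * p.eval (size x + size (l x)) ≤
      size (l x) * p.eval (size x + size (l x)) :=
    Nat.mul_le_mul_right _ ((List.length_take_le' _ _).trans (length_le_size _))
  omega

end PolyTime

end StackProg

/-! ### Equality of trees and the usual list operations in polynomial time. -/

namespace StackProg

open Code

/-- Types with an injective representation. -/
class InjCode (α : Type) [Code α] : Prop where
  injective : Function.Injective (toD : α → D)

instance : InjCode D := ⟨fun _ _ h => h⟩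
instance : InjCode Unit := ⟨fun _ _ _ => rfl⟩
instance : InjCode Bool := ⟨by rintro (_ | _) (_ | _) h <;> simp at h ⊢⟩

instance {α β : Type} [Code α] [Code β] [InjCode α] [InjCode β] : InjCode (α × β) :=
  ⟨by
    rintro ⟨a, b⟩ ⟨a', b'⟩ h
    simp only [toD_pair, D.cons.injEq] at h
    rw [InjCode.injective h.1, InjCode.injective h.2]⟩

instance {α : Type} [Code α] [InjCode α] : InjCode (List α) :=
  ⟨by
    intro l
    induction l with
    | nil => rintro (_ | ⟨b, k⟩) h <;> simp at h ⊢
    | cons a l ih =>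
      rintro (_ | ⟨b, k⟩) h
      · simp at h
      · simp only [toD_cons, D.cons.injEq] at h
        rw [InjCode.injective h.1, ih h.2]⟩

variable {α β γ δ : Type} [Code α] [Code β] [Code γ] [Code δ]

namespace PolyTime

@[fun_prop]
theorem not {c : α → Bool} (hc : PolyTime c) : PolyTime fun x => !c x := by
  have : (fun x => !c x) = fun x => bif c x then false else true := by
    funext x; cases c x <;> rfl
  rw [this]; fun_prop

@[fun_prop]
theorem and {c d : α → Bool} (hc : PolyTime c) (hd : PolyTime d) :
    PolyTime fun x => c x && d x := by
  have : (fun x => c x && d x) = fun x => bif c x then d x else false := by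
    funext x; cases c x <;> rfl
  rw [this]; fun_prop

@[fun_prop]
theorem or {c d : α → Bool} (hc : PolyTime c) (hd : PolyTime d) :
    PolyTime fun x => c x || d x := by
  have : (fun x => c x || d x) = fun x => bif c x then true else d x := by
    funext x; cases c x <;> rfl
  rw [this]; fun_prop

@[fun_prop]
theorem isEmpty {l : α → List β} (hl : PolyTime l) : PolyTime fun x => (l x).isEmpty := by
  have : (fun x => (l x).isEmpty) = fun x => StackProg.listCase (l x) true fun _ _ => false := by
    funext x; cases l x <;> rfl
  rw [this]; fun_prop

@[fun_prop]
theorem dIsNil {f : α → D} (hf : PolyTime f) : PolyTime fun x => decide (f x = .nil) :=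
  isNilD.comp hf

/-- One step of the comparison of trees. -/
def eqStep (y : List (D × D) × Bool) : Bool × List (D × D) × Bool :=
  StackProg.listCase y.1 (false, [], y.2) fun p k =>
    bif decide (p.1 = .nil) then (true, k, y.2 && decide (p.2 = .nil))
    else (true, (p.1.fst, p.2.fst) :: (p.1.snd, p.2.snd) :: k, y.2 && !decide (p.2 = .nil))

theorem eqStep_polyTime : PolyTime eqStep := by
  unfold eqStep
  fun_prop

/-- The remaining work in the comparison of trees. -/
def eqWork (y : List (D × D) × Bool) : ℕ := (y.1.map fun p => size p.1).sum

/-- The verdict of the comparison of trees. -/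
def eqVerdict (y : List (D × D) × Bool) : Bool := y.2 && y.1.all fun p => decide (p.1 = p.2)

/-- The list holds the pairs still to be compared. Each step consumes one symbol of a first
component, so `eqWork` drops by one, and the verdict is invariant. When a node meets a leaf the flag
falls, and the walk goes on with `nil` as the components of the leaf; so the number of rounds
depends on the first tree alone. -/
theorem eqStep_spec (y : List (D × D) × Bool) :
    (eqStep y).1 = decide (eqWork y ≠ 0) ∧ eqWork (eqStep y).2 = eqWork y - 1 ∧
      eqVerdict (eqStep y).2 = eqVerdict y ∧ size (eqStep y).2 ≤ size y + 8 := by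
  obtain ⟨_ | ⟨⟨d, e⟩, k⟩, b⟩ := y
  · simp [eqStep, eqWork, eqVerdict]
  · have hb : ∀ c : Bool, size (b && c) ≤ size b + 0 := by cases b <;> rintro (_ | _) <;> simp
    cases d with
    | nil =>
      have := hb (decide (e = .nil))
      refine ⟨by simp [eqStep, eqWork], by simp [eqStep, eqWork], ?_, ?_⟩
      · simp [eqStep, eqVerdict, Bool.and_assoc, eq_comm]
      · simp [eqStep]; omega
    | cons d₁ d₂ =>
      have := hb (!decide (e = .nil))
      refine ⟨by simp [eqStep, eqWork], by simp [eqStep, eqWork]; omega, ?_, ?_⟩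
      · cases e <;> simp [eqStep, eqVerdict, Bool.and_assoc]
      · cases e <;> simp [eqStep, D.fst, D.snd] at this ⊢ <;> omega

theorem eqD : PolyTime fun p : D × D => decide (p.1 = p.2) := by
  set F : List (D × D) × Bool → List (D × D) × Bool := fun y => (eqStep y).2 with hF
  have hwork (i : ℕ) (y) : eqWork (F^[i] y) = eqWork y - i := by
    induction i with
    | zero => simp
    | succ i ih => rw [Function.iterate_succ_apply', hF, (eqStep_spec _).2.1, ← hF, ih]; omega
  have hverd (i : ℕ) (y) : eqVerdict (F^[i] y) = eqVerdict y := by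
    induction i with
    | zero => simp
    | succ i ih => rw [Function.iterate_succ_apply', hF, (eqStep_spec _).2.2.1, ← hF, ih]
  have hsz (i : ℕ) (y) : size (F^[i] y) ≤ size y + 8 * i := by
    induction i with
    | zero => simp
    | succ i ih =>
      rw [Function.iterate_succ_apply']
      have := (eqStep_spec (F^[i] y)).2.2.2
      simp only [hF] at this ih ⊢
      omega
  have hstart (p : D × D) : eqWork ([p], true) = size p.1 := by simp [eqWork]
  have key := loop eqStep_polyTime (base := fun p : D × D => ([p], true)) (by fun_prop)
    (n := fun p => size p.1) (PolyTime.size_bdd (by fun_prop))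
    (s := fun p => size p + 8 + 8 * size p)
    ((PolyBdd.size.add (.const 8)).add ((PolyBdd.const 8).mul .size))
    (fun p i hi => (hsz i _).trans (by
      obtain ⟨a, b⟩ := p
      simp only [size_pair, size_cons, size_nil, size_true] at hi ⊢
      omega))
    (fun p i hi => by
      rw [(eqStep_spec _).1, ← hF, hwork, hstart]
      simp; omega)
    (fun p => by
      rw [(eqStep_spec _).1, ← hF, hwork, hstart]
      simp)
  have key' := key.snd
  rw [← hF] at key'
  convert key' using 2 with p
  have h₁ := hwork (size p.1 + 1) ([p], true)
  have h₂ := hverd (size p.1 + 1) ([p], true)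
  rw [hstart] at h₁
  generalize F^[size p.1 + 1] ([p], true) = y at h₁ h₂
  obtain ⟨_ | ⟨q, k⟩, b⟩ := y
  · simpa [eqVerdict, eq_comm] using h₂
  · have := size_pos q.1
    simp [eqWork] at h₁
    omega

-- An injective representation reduces equality of values to equality of trees.
@[fun_prop]
theorem decideEq [InjCode β] [DecidableEq β] {f g : α → β} (hf : PolyTime f) (hg : PolyTime g) :
    PolyTime fun x => decide (f x = g x) := by
  have h := eqD.comp (g := fun x => (toD (f x), toD (g x)))
    ((comp (f := fun b : β => toD b) (same fun _ => rfl) hf).pair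
      (comp (f := fun b : β => toD b) (same fun _ => rfl) hg))
  simpa only [InjCode.injective.eq_iff] using h

@[fun_prop]
theorem reverse {l : α → List β} (hl : PolyTime l) : PolyTime fun x => (l x).reverse := by
  have : (fun x => (l x).reverse) = fun x => (l x).foldl (fun s b => b :: s) [] := by
    funext x; simp
  rw [this]
  exact foldl (step := fun _ s b => b :: s) hl (by fun_prop) (by fun_prop)
    (t := fun p => size p.2 + 1) ((PolyTime.size_bdd (by fun_prop)).add (.const 1))
    fun a s b => by simp; omega

@[fun_prop]
theorem append {l k : α → List β} (hl : PolyTime l) (hk : PolyTime k) :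
    PolyTime fun x => l x ++ k x := by
  have : (fun x => l x ++ k x) = fun x => (l x).reverse.foldl (fun s b => b :: s) (k x) := by
    funext x; simp
  rw [this]
  exact foldl (step := fun _ s b => b :: s) hl.reverse hk (by fun_prop)
    (t := fun p => size p.2 + 1) ((PolyTime.size_bdd (by fun_prop)).add (.const 1))
    fun a s b => by simp; omega

-- Folding from the end makes each step a prepending one, so the state grows by no more than the
-- size of `f x b`.
@[fun_prop]
theorem flatMap {l : α → List β} {f : α → β → List γ} (hl : PolyTime l)
    (hf : PolyTime fun p : α × β => f p.1 p.2) : PolyTime fun x => (l x).flatMap (f x) := by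
  have : (fun x => (l x).flatMap (f x)) =
      fun x => (l x).reverse.foldl (fun s b => f x b ++ s) [] := by
    funext x
    rw [List.foldl_reverse]
    induction l x with
    | nil => rfl
    | cons a l ih => rw [List.flatMap_cons, List.foldr_cons, ih]
  rw [this]
  have := hf.comp (g := fun p : α × List γ × β => (p.1, p.2.2)) (by fun_prop)
  refine foldl (step := fun x s b => f x b ++ s) hl.reverse (by fun_prop) (by fun_prop)
    (t := fun p => size (f p.1 p.2)) hf.size_bdd fun a s b => ?_
  have := size_append (f a b) s
  simp only; omega

@[fun_prop]
theorem map {l : α → List β} {f : α → β → γ} (hl : PolyTime l)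
    (hf : PolyTime fun p : α × β => f p.1 p.2) : PolyTime fun x => (l x).map (f x) := by
  have : (fun x => (l x).map (f x)) = fun x => (l x).flatMap fun b => [f x b] := by
    funext x; exact List.map_eq_flatMap
  rw [this]
  fun_prop

@[fun_prop]
theorem filter {l : α → List β} {c : α → β → Bool} (hl : PolyTime l)
    (hc : PolyTime fun p : α × β => c p.1 p.2) : PolyTime fun x => (l x).filter (c x) := by
  have : (fun x => (l x).filter (c x)) =
      fun x => (l x).flatMap fun b => bif c x b then [b] else [] := by
    funext x
    induction l x with
    | nil => rfl
    | cons a l ih => cases h : c x a <;> simp [h, ih]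
  rw [this]
  fun_prop

@[fun_prop]
theorem any {l : α → List β} {c : α → β → Bool} (hl : PolyTime l)
    (hc : PolyTime fun p : α × β => c p.1 p.2) : PolyTime fun x => (l x).any (c x) := by
  have : (fun x => (l x).any (c x)) = fun x => !((l x).filter (c x)).isEmpty := by
    funext x
    rw [Bool.eq_iff_iff]
    simp
  rw [this]
  fun_prop

@[fun_prop]
theorem all {l : α → List β} {c : α → β → Bool} (hl : PolyTime l)
    (hc : PolyTime fun p : α × β => c p.1 p.2) : PolyTime fun x => (l x).all (c x) := by
  have : (fun x => (l x).all (c x)) = fun x => !(l x).any fun b => !c x b := by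
    funext x
    rw [Bool.eq_iff_iff]
    simp
  rw [this]
  fun_prop

@[fun_prop]
theorem mem [InjCode β] [DecidableEq β] {f : α → β} {l : α → List β} (hf : PolyTime f)
    (hl : PolyTime l) : PolyTime fun x => decide (f x ∈ l x) := by
  have : (fun x => decide (f x ∈ l x)) = fun x => (l x).any fun b => decide (f x = b) := by
    funext x
    rw [Bool.eq_iff_iff]
    simp
  rw [this]
  fun_prop

@[fun_prop]
theorem zip {l : α → List β} {k : α → List γ} (hl : PolyTime l) (hk : PolyTime k) :
    PolyTime fun x => (l x).zip (k x) := by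
  let step : List γ × List (β × γ) → β → List γ × List (β × γ) := fun s b =>
    StackProg.listCase s.1 s fun c k => (k, (b, c) :: s.2)
  have h : ∀ (l : List β) (k : List γ) (r : List (β × γ)),
      (l.foldl step (k, r)).2 = (l.zip k).reverse ++ r := by
    intro l
    induction l with
    | nil => simp
    | cons b l ih =>
      rintro (_ | ⟨c, k⟩) r
      · exact (ih [] r).trans (by simp)
      · simp only [List.foldl_cons, List.zip_cons_cons, List.reverse_cons, List.append_assoc]
        exact ih k _
  have : (fun x => (l x).zip (k x)) = fun x => ((l x).foldl step (k x, [])).2.reverse := by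
    funext x; simp [h]
  rw [this]
  have := foldl (step := fun _ => step) hl (base := fun x => (k x, []))
    (by fun_prop) (by simp only [step]; fun_prop)
    (t := fun p => size p.2 + 8) ((PolyTime.size_bdd (by fun_prop)).add (.const 8))
    (fun a s b => by
      obtain ⟨_ | ⟨c, k⟩, s⟩ := s <;> simp [step]; omega)
  fun_prop

/-- Iteration as often as a list is long. -/
theorem iterate {f : α → β → β} {base : α → β} {l : α → List γ} (hl : PolyTime l)
    (hbase : PolyTime base) (hf : PolyTime fun p : α × β => f p.1 p.2)
    (hsize : ∀ a b, size (f a b) ≤ size b) : PolyTime fun x => (f x)^[(l x).length] (base x) := by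
  have : (fun x => (f x)^[(l x).length] (base x)) =
      fun x => (l x).foldl (fun s _ => f x s) (base x) := by
    funext x
    generalize base x = b
    induction l x generalizing b with
    | nil => rfl
    | cons c l ih => simp [ih]
  rw [this]
  exact foldl (step := fun x s _ => f x s) hl hbase
    (hf.comp (g := fun p : α × β × γ => (p.1, p.2.1)) (by fun_prop)) (PolyBdd.const 0)
    fun a s _ => hsize a s

end PolyTime

end StackProg

/-! ### Arithmetic on binary numbers -/

namespace StackProg

open Code

/-- The number with given binary digits, the least significant one first. -/
def ofBits (l : List Bool) : ℕ := l.foldr Nat.bit 0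

@[simp] theorem ofBits_nil : ofBits [] = 0 := rfl
@[simp] theorem ofBits_cons (b : Bool) (l : List Bool) : ofBits (b :: l) = 2 * ofBits l + b.toNat :=
  Nat.bit_val b _

@[simp] theorem ofBits_bits (n : ℕ) : ofBits n.bits = n := by
  induction n using Nat.binaryRec' with
  | zero => simp
  | bit b n h ih => rw [Nat.bits_append_bit _ _ h, ofBits_cons, ih, Nat.bit_val]

theorem ofBits_append_false {β : Type} (l : List Bool) (k : List β) :
    ofBits (l ++ k.map fun _ => false) = ofBits l := by
  have h : ofBits (k.map fun _ => false) = 0 := by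
    induction k with
    | nil => rfl
    | cons a k ih => rw [List.map_cons, ofBits_cons, ih]; rfl
  induction l with
  | nil => exact h
  | cons b l ih => rw [List.cons_append, ofBits_cons, ofBits_cons, ih]

theorem ofBits_drop_le (l : List Bool) (i : ℕ) : ofBits (l.drop i) ≤ ofBits l := by
  induction i generalizing l with
  | zero => simp
  | succ i ih =>
    cases l with
    | nil => simp
    | cons b l =>
      have := ih l
      simp only [List.drop_succ_cons, ofBits_cons]
      omega

/-- The digits are in the order of `encNat`; sizes are therefore logarithmic in the number. -/
instance : Code ℕ := ⟨fun n => toD n.bits⟩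

theorem toD_nat (n : ℕ) : toD n = toD n.bits := rfl

instance : InjCode ℕ := ⟨fun m n h => by
  have h' : m.bits = n.bits := InjCode.injective h
  rw [← ofBits_bits m, h', ofBits_bits]⟩

theorem size_bools_le (l : List Bool) : size l ≤ 4 * l.length + 1 := by
  induction l with
  | nil => simp
  | cons b l ih =>
    have := size_bool_le b
    simp; omega

theorem size_nat_le (n : ℕ) : size n ≤ 4 * n.size + 1 := by
  rw [← Nat.size_eq_bits_len]
  exact size_bools_le n.bits

theorem natSize_le_size (n : ℕ) : n.size ≤ size n := by
  rw [← Nat.size_eq_bits_len]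
  exact length_le_size n.bits

variable {α β γ : Type} [Code α] [Code β] [Code γ]

namespace PolyTime

@[fun_prop]
theorem bits {f : α → ℕ} (hf : PolyTime f) : PolyTime fun x => (f x).bits :=
  comp (f := fun n : ℕ => n.bits) (same fun _ => rfl) hf

-- Consing a digit is right except for a zero digit before the number zero, which has the empty
-- digit list; `g` corrects this case.
@[fun_prop]
theorem natBit {c : α → Bool} {f : α → ℕ} (hc : PolyTime c) (hf : PolyTime f) :
    PolyTime fun x => Nat.bit (c x) (f x) := by
  let g : Bool × ℕ → List Bool := fun p =>
    bif !p.1 && decide (p.2 = 0) then [] else p.1 :: p.2.bits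
  have hg : PolyTime g := by simp only [g]; fun_prop
  obtain ⟨P, t, ht, hs, hP⟩ := hg
  have h (p : Bool × ℕ) : toD (Nat.bit p.1 p.2) = toD (g p) := by
    obtain ⟨b, n⟩ := p
    rw [toD_nat]
    by_cases hn : n = 0 → b = true
    · rw [Nat.bits_append_bit _ _ hn]
      by_cases h0 : n = 0
      · simp [g, hn h0]
      · simp [g, h0]
    · push Not at hn
      obtain ⟨rfl, hb⟩ := hn
      simp only [Bool.not_eq_true] at hb
      subst hb
      rfl
  refine comp (f := fun p : Bool × ℕ => Nat.bit p.1 p.2) ⟨P, t, ht, ?_, fun x m => ?_⟩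
    (hc.pair hf)
  · simpa only [size, h] using hs
  · simpa only [top, h] using hP x m

@[fun_prop]
theorem ofBits {l : α → List Bool} (hl : PolyTime l) : PolyTime fun x => ofBits (l x) := by
  have : (fun x => StackProg.ofBits (l x)) =
      fun x => (l x).reverse.foldl (fun n b => Nat.bit b n) 0 := by
    funext x
    rw [List.foldl_reverse]
    rfl
  rw [this]
  refine foldl (step := fun _ n b => Nat.bit b n) hl.reverse (by fun_prop) (by fun_prop)
    (PolyBdd.const 4) fun a n b => ?_
  have h : size (Nat.bit b n) = size (Nat.bit b n).bits := rfl
  have h' : size n = size n.bits := rfl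
  by_cases hn : n = 0 → b = true
  · rw [h, Nat.bits_append_bit _ _ hn, h', size_cons]
    have := size_bool_le b
    omega
  · push Not at hn
    obtain ⟨rfl, hb⟩ := hn
    simp only [Bool.not_eq_true] at hb
    subst hb
    simp

end PolyTime

/-- The digit-wise pairs of two numbers, padded with zeros. -/
def digitPairs (m n : ℕ) : List (Bool × Bool) :=
  (m.bits ++ n.bits.map fun _ => false).zip (n.bits ++ m.bits.map fun _ => false)

theorem map_fst_digitPairs (m n : ℕ) :
    (digitPairs m n).map Prod.fst = m.bits ++ n.bits.map fun _ => false :=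
  List.map_fst_zip (by simp [Nat.add_comm])

theorem map_snd_digitPairs (m n : ℕ) :
    (digitPairs m n).map Prod.snd = n.bits ++ m.bits.map fun _ => false :=
  List.map_snd_zip (by simp [Nat.add_comm])

/-- One step of the addition of binary numbers. -/
def addStep (s : Bool × List Bool) (p : Bool × Bool) : Bool × List Bool :=
  (bif p.1 then p.2 || s.1 else p.2 && s.1,
    (bif p.1 then (bif p.2 then s.1 else !s.1) else (bif p.2 then !s.1 else s.1)) :: s.2)

/-- The state is the carry with the digits produced so far, in reverse. Here `k` collects the digits
still to be produced, the last carry being the top digit. -/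
theorem addStep_spec (l : List (Bool × Bool)) : ∀ (c : Bool) (r : List Bool), ∃ k,
    (l.foldl addStep (c, r)).2.reverse ++ [(l.foldl addStep (c, r)).1] = r.reverse ++ k ∧
      ofBits k = ofBits (l.map Prod.fst) + ofBits (l.map Prod.snd) + c.toNat := by
  induction l with
  | nil => exact fun c r => ⟨[c], by simp⟩
  | cons p l ih =>
    intro c r
    obtain ⟨k, hk, hk'⟩ := ih (addStep (c, r) p).1 (addStep (c, r) p).2
    refine ⟨(bif p.1 then (bif p.2 then c else !c) else (bif p.2 then !c else c)) :: k, ?_, ?_⟩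
    · rw [List.foldl_cons, hk]
      simp [addStep]
    · rw [ofBits_cons, hk']
      obtain ⟨a, b⟩ := p
      cases a <;> cases b <;> cases c <;> simp [addStep] <;> omega

theorem add_eq_foldl (m n : ℕ) : m + n = ofBits
    (((digitPairs m n).foldl addStep (false, [])).2.reverse ++
      [((digitPairs m n).foldl addStep (false, [])).1]) := by
  obtain ⟨k, hk, hk'⟩ := addStep_spec (digitPairs m n) false []
  rw [hk, List.reverse_nil, List.nil_append, hk', map_fst_digitPairs, map_snd_digitPairs,
    ofBits_append_false, ofBits_append_false, ofBits_bits, ofBits_bits]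
  simp

/-- One step of the comparison of binary numbers. -/
def leStep (r : Bool) (p : Bool × Bool) : Bool :=
  bif p.1 then p.2 && r else p.2 || r

/-- Digits come least significant first, so a later difference overrides the verdict so far and
equal digits keep it. -/
theorem leStep_spec (l : List (Bool × Bool)) : ∀ r : Bool, l.foldl leStep r = true ↔
    ofBits (l.map Prod.fst) < ofBits (l.map Prod.snd) ∨
      (ofBits (l.map Prod.fst) = ofBits (l.map Prod.snd) ∧ r = true) := by
  induction l with
  | nil => simp
  | cons p l ih =>
    intro r
    rw [List.foldl_cons, ih]
    obtain ⟨a, b⟩ := p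
    cases a <;> cases b <;> cases r <;> simp [leStep] <;> omega

theorem le_eq_foldl (m n : ℕ) : decide (m ≤ n) = (digitPairs m n).foldl leStep true := by
  rw [Bool.eq_iff_iff, leStep_spec, map_fst_digitPairs, map_snd_digitPairs,
    ofBits_append_false, ofBits_append_false, ofBits_bits, ofBits_bits]
  simp
  omega

/-- Horner's rule, with the most significant digit first in `l`. -/
theorem mul_eq_foldl (l : List Bool) (n : ℕ) :
    l.foldl (fun s b => Nat.bit false s + bif b then n else 0) 0 = ofBits l.reverse * n := by
  induction l using List.reverseRecOn with
  | nil => simp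
  | append_singleton l b ih =>
    rw [List.foldl_append, ih]
    cases b <;> simp [Nat.bit_val] <;> ring

namespace PolyTime

@[fun_prop]
theorem digitPairs {f g : α → ℕ} (hf : PolyTime f) (hg : PolyTime g) :
    PolyTime fun x => digitPairs (f x) (g x) := by
  unfold StackProg.digitPairs
  fun_prop

@[fun_prop]
theorem natAdd {f g : α → ℕ} (hf : PolyTime f) (hg : PolyTime g) :
    PolyTime fun x => f x + g x := by
  have h : PolyTime fun x => (StackProg.digitPairs (f x) (g x)).foldl addStep (false, []) := by
    refine foldl (step := fun _ => addStep) (by fun_prop) (by fun_prop)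
      (by unfold addStep; fun_prop) (PolyBdd.const 8) fun a s p => ?_
    obtain ⟨c, s⟩ := s
    simp only [addStep, size_pair, size_cons]
    have := size_pos c
    refine le_trans (add_le_add_left (add_le_add (size_bool_le _)
      (add_le_add_left (add_le_add_left (size_bool_le _) _) _)) _) (by omega)
  simp only [add_eq_foldl]
  fun_prop

@[fun_prop]
theorem natLe {f g : α → ℕ} (hf : PolyTime f) (hg : PolyTime g) :
    PolyTime fun x => decide (f x ≤ g x) := by
  simp only [le_eq_foldl]
  exact foldl (step := fun _ => leStep) (by fun_prop) (by fun_prop) (by unfold leStep; fun_prop)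
    (PolyBdd.const 3) fun a s p => (size_bool_le _).trans (by omega)

theorem natMul_aux : PolyTime fun p : ℕ × ℕ => p.1 * p.2 := by
  have h (p : ℕ × ℕ) : p.1 * p.2 = p.1.bits.reverse.foldl
      (fun s b => Nat.bit false s + bif b then p.2 else 0) 0 := by
    rw [mul_eq_foldl, List.reverse_reverse, ofBits_bits]
  simp only [h]
  refine foldl_of_bdd (step := fun (p : ℕ × ℕ) s b => Nat.bit false s + bif b then p.2 else 0)
    (by fun_prop) (by fun_prop) (by fun_prop) (s := fun p => 4 * size p + 1)
    (((PolyBdd.const 4).mul .size).add (.const 1)) fun p i => ?_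
  rw [mul_eq_foldl, List.take_reverse, List.reverse_reverse]
  obtain ⟨m, n⟩ := p
  -- Each intermediate value is `n` times the number formed by the leading digits of `m`, so its
  -- length is at most that of `m` and `n` together.
  have h₁ : StackProg.ofBits (m.bits.drop (m.bits.length - i)) * n < 2 ^ (m.size + n.size) := by
    rw [pow_add]
    refine Nat.mul_lt_mul'' ((ofBits_drop_le _ _).trans_lt ?_) (Nat.lt_size_self n)
    simpa using Nat.lt_size_self m
  have h₂ := size_nat_le (StackProg.ofBits (m.bits.drop (m.bits.length - i)) * n)
  have h₃ := Nat.size_le.2 h₁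
  have h₄ := natSize_le_size m
  have h₅ := natSize_le_size n
  simp only [size_pair]
  omega

@[fun_prop]
theorem natMul {f g : α → ℕ} (hf : PolyTime f) (hg : PolyTime g) :
    PolyTime fun x => f x * g x := natMul_aux.comp (hf.pair hg)

/-- The initial segment of the natural numbers with as many elements as a list. -/
theorem range_length {l : α → List β} (hl : PolyTime l) :
    PolyTime fun x => List.range (l x).length := by
  have h (l : List β) : l.foldl (fun (s : ℕ × List ℕ) _ => (s.1 + 1, s.1 :: s.2)) (0, []) =
      (l.length, (List.range l.length).reverse) := by
    induction l using List.reverseRecOn with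
    | nil => rfl
    | append_singleton l b ih => simp [List.foldl_append, ih, List.range_succ]
  have hnat (n : ℕ) : size n ≤ 4 * n + 1 := by
    have h₁ := size_nat_le n
    have h₂ := Nat.size_le.2 (Nat.lt_two_pow_self (n := n))
    omega
  have hsz (M n : ℕ) (hn : n ≤ M) : size (List.range n).reverse ≤ 1 + n * (4 * M + 2) := by
    induction n with
    | zero => simp
    | succ n ih =>
      have h₁ := ih (by omega)
      have h₂ := hnat n
      rw [List.range_succ, List.reverse_append, List.reverse_singleton, List.singleton_append,
        size_cons]
      linarith
  have key : PolyTime fun x =>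
      (l x).foldl (fun (s : ℕ × List ℕ) _ => (s.1 + 1, s.1 :: s.2)) (0, []) := by
    refine foldl_of_bdd (step := fun _ (s : ℕ × List ℕ) _ => (s.1 + 1, s.1 :: s.2)) hl
      (by fun_prop) (by fun_prop)
      (s := fun x => 4 * size (l x) + 1 + (1 + size (l x) * (4 * size (l x) + 2)) + 1) ?_ ?_
    · have := hl.size_bdd
      exact ((((PolyBdd.const 4).mul this).add (.const 1)).add ((PolyBdd.const 1).add (this.mul
        (((PolyBdd.const 4).mul this).add (.const 2))))).add (.const 1)
    · intro x i
      rw [h, size_pair]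
      have hi : ((l x).take i).length ≤ size (l x) :=
        (List.length_take_le' _ _).trans (length_le_size _)
      have h₁ := hsz _ _ hi
      have h₂ := hnat ((l x).take i).length
      have h₃ := Nat.mul_le_mul_right (4 * size (l x) + 2) hi
      omega
  have : (fun x => List.range (l x).length) = fun x =>
      ((l x).foldl (fun (s : ℕ × List ℕ) _ => (s.1 + 1, s.1 :: s.2)) (0, [])).2.reverse := by
    funext x
    simp [h]
  rw [this]
  fun_prop

end PolyTime

/-! ### Rational numbers. -/

/-- The comparison of rational numbers through numerators and denominators. -/
theorem rat_le_eq (a b : ℚ) : decide (a ≤ b) =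
    bif decide (a < 0) then
      bif decide (b < 0) then decide (b.num.natAbs * a.den ≤ a.num.natAbs * b.den) else true
    else
      bif decide (b < 0) then false else decide (a.num.natAbs * b.den ≤ b.num.natAbs * a.den) := by
  have key := Rat.le_iff a b
  by_cases ha : a < 0 <;> by_cases hb : b < 0
  · have h₁ : (a.num.natAbs : ℤ) = -a.num := Int.ofNat_natAbs_of_nonpos (Rat.num_neg.2 ha).le
    have h₂ : (b.num.natAbs : ℤ) = -b.num := Int.ofNat_natAbs_of_nonpos (Rat.num_neg.2 hb).le
    simp only [ha, hb, decide_true, cond_true, decide_eq_decide, key]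
    rw [← Int.ofNat_le]
    rw [Nat.cast_mul, Nat.cast_mul, h₁, h₂]
    constructor <;> intro h <;> linarith
  · simp only [ha, hb, decide_true, decide_false, cond_true, cond_false, decide_eq_true_eq]
    linarith
  · simp only [ha, hb, decide_true, decide_false, cond_true, cond_false, decide_eq_false_iff_not]
    linarith
  · have h₁ : (a.num.natAbs : ℤ) = a.num :=
      Int.natAbs_of_nonneg (Rat.num_nonneg.2 (not_lt.1 ha))
    have h₂ : (b.num.natAbs : ℤ) = b.num :=
      Int.natAbs_of_nonneg (Rat.num_nonneg.2 (not_lt.1 hb))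
    simp only [ha, hb, decide_false, cond_false, decide_eq_decide, key]
    rw [← Int.ofNat_le]
    rw [Nat.cast_mul, Nat.cast_mul, h₁, h₂]

/-- As for all types that occur in inputs, the tree mirrors the encoding: the sign is a one-element
list because `encRat` writes it by `encBits`. -/
instance : Code ℚ :=
  ⟨fun q => .list [toD [decide (q < 0)], toD q.num.natAbs, toD q.den]⟩

theorem toD_rat (q : ℚ) :
    toD q = .list [toD [decide (q < 0)], toD q.num.natAbs, toD q.den] := rfl

namespace PolyTime

@[fun_prop]
theorem ratNeg {f : α → ℚ} (hf : PolyTime f) : PolyTime fun x => decide (f x < 0) :=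
  comp (f := fun q : ℚ => decide (q < 0)) (of_toD (fun d => d.fst.fst) (by fun_prop)
    fun q => by simp [toD_rat]) hf

@[fun_prop]
theorem ratNum {f : α → ℚ} (hf : PolyTime f) : PolyTime fun x => (f x).num.natAbs :=
  comp (f := fun q : ℚ => q.num.natAbs) (of_toD (fun d => d.snd.fst) (by fun_prop)
    fun q => by simp [toD_rat]) hf

@[fun_prop]
theorem ratDen {f : α → ℚ} (hf : PolyTime f) : PolyTime fun x => (f x).den :=
  comp (f := fun q : ℚ => q.den) (of_toD (fun d => d.snd.snd.fst) (by fun_prop)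
    fun q => by simp [toD_rat]) hf

@[fun_prop]
theorem ratLe {f g : α → ℚ} (hf : PolyTime f) (hg : PolyTime g) :
    PolyTime fun x => decide (f x ≤ g x) := by
  simp only [rat_le_eq]
  fun_prop

end PolyTime

end StackProg

/-! ### The representation of instances -/

namespace StackProg

open Code Atch

/-- The bits that a symbol of the input contributes to the code of the input tree. -/
def symBits : Sym → List Bool
  | .lpar => [true]
  | .rpar => [false]
  | .zero => [true, false]
  | .one => [true, true, false, false]

/-- The word `w` stands for the tree `d` as an entry of a list. -/
def Rep (w : List Sym) (d : D) : Prop := w.flatMap symBits = true :: d.code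

/-- An opening bracket contributes the node by which the group hangs in the surrounding list, and
the closing bracket the leaf that ends the group's own list. Hence a letter-by-letter translation
yields the prefix code. -/
theorem rep_group {ws : List (List Sym)} {ds : List D} (h : List.Forall₂ Rep ws ds) :
    Rep (group ws) (D.list ds) := by
  have : (ws.flatten ++ [Sym.rpar]).flatMap symBits = (D.list ds).code := by
    induction h with
    | nil => rfl
    | @cons w d ws ds h _ ih =>
      unfold Rep at h
      simp only [List.flatten_cons, List.append_assoc, List.flatMap_append, h] at ih ⊢
      simp [D.code, ← ih]
  simp [Rep, group, symBits, this]

theorem rep_bits (l : List Bool) : Rep (encBits l) (toD l) := by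
  have h : (l.map fun b => if b then Sym.one else Sym.zero).flatMap symBits ++ [false] =
      (toD l).code := by
    induction l with
    | nil => rfl
    | cons b l ih => cases b <;> simp [symBits, D.code, ← ih]
  simp only [Rep, encBits, group, List.flatten_cons, List.flatten_nil, List.append_nil,
    List.flatMap_cons, List.flatMap_append, List.flatMap_nil, symBits]
  rw [h]
  rfl

theorem rep_list {β : Type} [Code β] {γ : Type} {f : γ → List Sym} {g : γ → β}
    (h : ∀ a, Rep (f a) (toD (g a))) (l : List γ) : Rep (encList f l) (toD (l.map g)) := by
  refine rep_group ?_
  induction l with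
  | nil => exact .nil
  | cons a l ih => exact .cons (h a) ih

theorem rep_list' {β : Type} [Code β] {f : β → List Sym}
    (h : ∀ a, Rep (f a) (toD a)) (l : List β) : Rep (encList f l) (toD l) := by
  simpa using rep_list (g := id) h l

theorem rep_fun {β : Type} [Code β] {γ : Type} {n : ℕ} {f : γ → List Sym} {g : γ → β}
    (h : ∀ a, Rep (f a) (toD (g a))) (k : Fin n → γ) :
    Rep (encFun f k) (toD (List.ofFn fun i => g (k i))) := by
  have := rep_list h (List.ofFn k)
  rwa [List.map_ofFn] at this

theorem rep_fun' {β : Type} [Code β] {n : ℕ} {f : β → List Sym}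
    (h : ∀ a, Rep (f a) (toD a)) (k : Fin n → β) : Rep (encFun f k) (toD (List.ofFn k)) :=
  rep_fun (g := id) h k

theorem rep_nat (n : ℕ) : Rep (encNat n) (toD n) := rep_bits n.bits

theorem rep_rat (q : ℚ) : Rep (encRat q) (toD q) :=
  rep_group (.cons (rep_bits _) (.cons (rep_nat _) (.cons (rep_nat _) .nil)))

/-- The tree of a property. -/
def propD (p : Property) : D := .list [toD p.1, toD p.2]

theorem propD_injective : Function.Injective propD := by
  rintro ⟨a, b⟩ ⟨a', b'⟩ h
  simp only [propD, D.list, D.cons.injEq, and_true] at h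
  rw [InjCode.injective h.1, InjCode.injective h.2]

theorem rep_property (p : Property) : Rep (encProperty p) (propD p) :=
  rep_group (.cons (rep_bits _) (.cons (rep_bits _) .nil))

instance : Code Obj :=
  ⟨Sum.elim (fun i => .list [toD [false], toD i]) fun j => .list [toD [true], toD j]⟩

instance : InjCode Obj := ⟨by
  rintro (i | i) (j | j) h
  · have h' : toD i = toD j := by injection h with _ h; injection h
    rw [InjCode.injective h']
  · injection h with h _; injection h with h; cases h
  · injection h with h _; injection h with h; cases h
  · have h' : toD i = toD j := by injection h with _ h; injection h
    rw [InjCode.injective h']⟩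

theorem rep_obj : ∀ o : Obj, Rep (encObj o) (toD o)
  | .inl _ => rep_group (.cons (rep_bits _) (.cons (rep_nat _) .nil))
  | .inr _ => rep_group (.cons (rep_bits _) (.cons (rep_nat _) .nil))

instance : Code Term :=
  ⟨fun t => match t with
    | .var x => .list [toD [false], toD x]
    | .const o => .list [toD [true], toD o]⟩

instance : InjCode Term := ⟨by
  rintro (i | i) (j | j) h
  · have h' : toD i = toD j := by injection h with _ h; injection h
    rw [InjCode.injective h']
  · injection h with h _; injection h with h; cases h
  · injection h with h _; injection h with h; cases h
  · have h' : toD i = toD j := by injection h with _ h; injection h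
    rw [InjCode.injective h']⟩

instance : DecidableEq Term
  | .var x, .var y => decidable_of_iff (x = y) (by simp)
  | .var _, .const _ => isFalse (by simp)
  | .const _, .var _ => isFalse (by simp)
  | .const o, .const o' => decidable_of_iff (o = o') (by simp)

theorem rep_term : ∀ t : Term, Rep (encTerm t) (toD t)
  | .var _ => rep_group (.cons (rep_bits _) (.cons (rep_nat _) .nil))
  | .const _ => rep_group (.cons (rep_bits _) (.cons (rep_obj _) .nil))

instance : Code Interval := ⟨fun I => .list [toD I.lower.toList, toD I.upper.toList]⟩

theorem rep_interval (I : Interval) : Rep (encInterval I) (toD I) :=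
  rep_group (.cons (rep_list' rep_rat _) (.cons (rep_list' rep_rat _) .nil))

section Hypergraph

variable (H : Hypergraph)

/-- The properties of the vertices. -/
def vertexProps : List (List D) := List.ofFn fun v => (H.vertexAttr v).map propD
/-- The participants of the hyperedges. -/
def edgeNodes : List (List Obj) := List.ofFn fun e => (H.nodes e).map H.name
/-- The properties of the hyperedges. -/
def edgeProps : List (List D) := List.ofFn fun e => (H.edgeAttr e).map propD
/-- The valid times of the hyperedges. -/
def validTimes : List Interval := List.ofFn H.validTime
/-- The confidences of the hyperedges. -/
def confs : List ℚ := List.ofFn H.conf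
/-- The causal order. -/
def precRows : List (List Bool) := List.ofFn fun e => List.ofFn (H.prec e)

end Hypergraph

instance : Code Hypergraph :=
  ⟨fun H => .list [toD (vertexProps H), toD (edgeNodes H), toD (edgeProps H), toD (validTimes H),
    toD (List.ofFn H.transTime), toD (confs H), toD (precRows H)]⟩

theorem rep_hypergraph (H : Hypergraph) : Rep (encHypergraph H) (toD H) := by
  have hp (l : List Property) : Rep (encList encProperty l) (toD (l.map propD)) :=
    rep_list (g := propD) rep_property l
  exact rep_group (.cons (rep_fun (g := List.map propD) hp _)
    (.cons (rep_fun (g := List.map H.name) (fun l => rep_list (fun o => rep_obj _) l) _)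
    (.cons (rep_fun (g := List.map propD) hp _)
    (.cons (rep_fun' rep_interval _) (.cons (rep_fun' rep_interval _) (.cons (rep_fun' rep_rat _)
    (.cons (rep_fun (g := List.ofFn) (fun r => rep_bits _) _) .nil)))))))

/-- The number of a range predicate. -/
def relCode : RangePred → ℕ
  | .within => 0
  | .covers => 1
  | .overlaps => 2

theorem rep_rangePred : ∀ r : RangePred, Rep (encRangePred r) (toD (relCode r))
  | .within => rep_nat 0
  | .covers => rep_nat 1
  | .overlaps => rep_nat 2

instance : Code Atom :=
  ⟨fun a => match a with
    | .hyperedge z ts => .list [toD 0, toD z, toD ts]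
    | .participant t z => .list [toD 1, toD t, toD z]
    | .vertexAttr t p => .list [toD 2, toD t, propD p]
    | .edgeAttr z p => .list [toD 3, toD z, propD p]
    | .window z r W => .list [toD 4, toD z, toD (relCode r), toD W.lo, toD W.hi]
    | .confGe z θ => .list [toD 5, toD z, toD θ]
    | .confGt z θ => .list [toD 6, toD z, toD θ]⟩

theorem rep_atom : ∀ a : Atom, Rep (encAtom a) (toD a)
  | .hyperedge _ _ =>
    rep_group (.cons (rep_nat _) (.cons (rep_term _) (.cons (rep_list' rep_term _) .nil)))
  | .participant _ _ =>
    rep_group (.cons (rep_nat _) (.cons (rep_term _) (.cons (rep_term _) .nil)))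
  | .vertexAttr _ _ =>
    rep_group (.cons (rep_nat _) (.cons (rep_term _) (.cons (rep_property _) .nil)))
  | .edgeAttr _ _ =>
    rep_group (.cons (rep_nat _) (.cons (rep_term _) (.cons (rep_property _) .nil)))
  | .window _ _ _ => rep_group (.cons (rep_nat _) (.cons (rep_term _) (.cons (rep_rangePred _)
      (.cons (rep_rat _) (.cons (rep_rat _) .nil)))))
  | .confGe _ _ => rep_group (.cons (rep_nat _) (.cons (rep_term _) (.cons (rep_rat _) .nil)))
  | .confGt _ _ => rep_group (.cons (rep_nat _) (.cons (rep_term _) (.cons (rep_rat _) .nil)))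

instance : Code Query := ⟨fun Q => .list [toD Q.atoms, toD Q.chains, toD Q.output]⟩

theorem rep_query (Q : Query) : Rep (encQuery Q) (toD Q) :=
  rep_group (.cons (rep_list' rep_atom _) (.cons (rep_list' (rep_list' rep_term) _)
    (.cons (rep_list' rep_nat _) .nil)))

instance : Code Instance := ⟨fun x => .list [toD x.db, toD x.query, toD x.tuple]⟩

theorem rep_instance (x : Instance) : Rep (encInstance x) (toD x) :=
  rep_group (.cons (rep_hypergraph _) (.cons (rep_query _) (.cons (rep_list' rep_obj _) .nil)))

/-! ### From polynomial-time functions to machines -/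

/-- Initial stack contents. -/
def inputStacks (w : List Sym) (a : List Bool) : ∀ k, List (Alphabet k)
  | .input => w
  | .data => ([] : List Bool)
  | .bufA => a
  | .bufB => ([] : List Bool)
  | .counter => ([] : List Bool)
  | .output => ([] : List Bool)

/-- Final stack contents. -/
def outputStacks (l : List Bool) : ∀ k, List (Alphabet k)
  | .input => ([] : List Sym)
  | .data => ([] : List Bool)
  | .bufA => ([] : List Bool)
  | .bufB => ([] : List Bool)
  | .counter => ([] : List Bool)
  | .output => l

/-- Push bits onto the first buffer. -/
def pushBits : List Bool → TreeProg
  | [] => .skip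
  | b :: l => .seq (.push .bufA b) (pushBits l)

theorem run_pushBits (l : List Bool) (w : List Sym) (a : List Bool) :
    Run (pushBits l) (inputStacks w a) (l.length + 1) (inputStacks w (l.reverse ++ a)) := by
  induction l generalizing a with
  | nil => exact Run.skip _
  | cons b l ih =>
    have h : Run (.push .bufA b : TreeProg) (inputStacks w a) 1 (inputStacks w (b :: a)) := by
      have := Run.push (Γ := Alphabet) .bufA b (inputStacks w a)
      refine (congrArg (Run _ _ 1) ?_).mp this
      funext k; cases k <;> rfl
    have h' := (h.seq (ih (b :: a))).mono (t' := (b :: l).length + 1) (by simp; omega)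
    simpa [pushBits] using h'

/-- Translate the input, reversed, to the first buffer. -/
def readInput : TreeProg :=
  .loop .input Option.isSome (.seq
    (.ite .input (fun o => match o with | some .lpar => true | _ => false) (pushBits [true])
    (.ite .input (fun o => match o with | some .rpar => true | _ => false) (pushBits [false])
    (.ite .input (fun o => match o with | some .zero => true | _ => false) (pushBits [true, false])
      (pushBits [true, true, false, false])))) (.pop .input))

theorem run_readInput (w : List Sym) (a : List Bool) :
    Run readInput (inputStacks w a) (10 * w.length + 1)
      (inputStacks [] ((w.flatMap symBits).reverse ++ a)) := by
  induction w generalizing a with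
  | nil => exact Run.loopFalse rfl
  | cons s w ih =>
    have h₁ : Run (.pop .input : TreeProg) (inputStacks (s :: w) ((symBits s).reverse ++ a)) 1
        (inputStacks w ((symBits s).reverse ++ a)) := by
      have := Run.pop (Γ := Alphabet) .input (inputStacks (s :: w) ((symBits s).reverse ++ a))
      refine (congrArg (Run _ _ 1) ?_).mp this
      funext k; cases k <;> rfl
    have h₂ := ih ((symBits s).reverse ++ a)
    have h₃ := run_pushBits (symBits s) (s :: w) a
    rw [← List.append_assoc, ← List.reverse_append] at h₂
    rw [List.flatMap_cons]
    refine Run.mono (Run.loopTrue (k := Stack.input) (t := 9) rfl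
      (Run.seq (t := 8) (t' := 1) ?_ h₁) h₂) (by simp; omega)
    cases s
    · exact Run.mono (Run.iteTrue (k := Stack.input) rfl h₃) (by simp [symBits])
    · exact Run.mono (Run.iteFalse (k := Stack.input) rfl (Run.iteTrue (k := Stack.input) rfl h₃))
        (by simp [symBits])
    · exact Run.mono (Run.iteFalse (k := Stack.input) rfl (Run.iteFalse (k := Stack.input) rfl
        (Run.iteTrue (k := Stack.input) rfl h₃))) (by simp [symBits])
    · exact Run.mono (Run.iteFalse (k := Stack.input) rfl (Run.iteFalse (k := Stack.input) rfl
        (Run.iteFalse (k := Stack.input) rfl h₃))) (by simp [symBits])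

/-- Move a Boolean from the data stack to the output. -/
def writeOutput : TreeProg :=
  .ite .data isTrue (.seq (.pop .data) (.seq (.pop .data) (.seq (.pop .data)
    (.push .output true)))) (.seq (.pop .data) (.push .output false))

theorem run_writeOutput (b : Bool) : Run writeOutput (top b []) 5 (outputStacks [b]) := by
  have h (b : Bool) : Run (.push .output b : TreeProg) (contents [] [] [] []) 1
      (outputStacks [b]) := by
    have := Run.push (Γ := Alphabet) .output b (contents [] [] [] [])
    refine (congrArg (Run _ _ 1) ?_).mp this
    funext k; cases k <;> rfl
  cases b
  · exact Run.mono (Run.iteFalse (k := Stack.data) rfl (Run.seq (run_pop_data ..) (h _)))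
      (by omega)
  · exact Run.mono (Run.iteTrue (k := Stack.data) rfl (Run.seq (run_pop_data ..)
      (Run.seq (run_pop_data ..) (Run.seq (run_pop_data ..) (h _))))) (by omega)

instance : Fintype Sym :=
  ⟨⟨↑[Sym.lpar, Sym.rpar, Sym.zero, Sym.one], by simp⟩, fun s => by cases s <;> simp⟩

theorem flatMap_symBits_length_le (w : List Sym) : (w.flatMap symBits).length ≤ 4 * w.length := by
  induction w with
  | nil => simp
  | cons s w ih =>
    have : (symBits s).length ≤ 4 := by cases s <;> simp [symBits]
    rw [List.flatMap_cons, List.length_append, List.length_cons]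
    omega

/-- A polynomial-time predicate on a type whose input words stand for the trees of its elements is
decided by a machine in polynomial time. -/
theorem PolyTime.computable {α : Type} [Code α] {ea : α → List Sym}
    (hea : ∀ x, Rep (ea x) (toD x)) {f : α → Bool} (hf : PolyTime f) :
    Nonempty (Turing.TM2ComputableInPolyTime ea Computability.encodeBool f) := by
  obtain ⟨P, t, ⟨p, hp⟩, -, hP⟩ := hf
  -- Reading reverses the input, emptying the buffer restores the order, and the pop removes the
  -- leading bit `true` of `Rep`.
  let prog : TreeProg := .seq readInput (.seq flushA (.seq (.pop .data) (.seq P writeOutput)))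
  have hlen (x : α) : size x ≤ 4 * (ea x).length := by
    have := flatMap_symBits_length_le (ea x)
    rw [hea x] at this
    simp only [List.length_cons] at this
    unfold size
    omega
  have hrun (x : α) : Run prog (inputStacks (ea x) [])
      (30 * (ea x).length + 8 + p.eval (4 * (ea x).length)) (outputStacks [f x]) := by
    have h₁ := run_readInput (ea x) []
    have h₂ := run_flushA [] ((ea x).flatMap symBits).reverse [] []
    have h₃ := hP x []
    have e : inputStacks [] ((ea x).flatMap symBits).reverse =
        contents [] ((ea x).flatMap symBits).reverse [] [] := by
      funext k; cases k <;> rfl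
    rw [List.append_nil, e, hea x] at h₁
    simp only [List.reverse_reverse, List.append_nil] at h₂
    rw [hea x] at h₂
    have h₄ : Run (.pop .data : TreeProg) (contents (true :: (toD x).code) [] [] []) 1
        (top x []) := by
      simpa [top] using run_pop_data true (toD x).code [] [] []
    have h₅ := flatMap_symBits_length_le (ea x)
    have h₆ : t x ≤ p.eval (4 * (ea x).length) := (hp x).trans (eval_mono p (hlen x))
    rw [hea x] at h₅
    refine Run.mono (h₁.seq (h₂.seq (h₄.seq (h₃.seq (run_writeOutput (f x)))))) ?_
    simp only [List.length_reverse, List.length_cons] at h₅ ⊢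
    omega
  refine ⟨{
    tm := prog.machine .input .output
    inputAlphabet := Equiv.refl Sym
    outputAlphabet := Equiv.refl Bool
    -- The constant 9 is the 8 of `hrun` and the halting step.
    time := .C 30 * .X + .C 9 + p.comp (.C 4 * .X)
    outputsFun := fun x => ?_ }⟩
  have hsteps := (hrun x).exists_steps
  refine ⟨⟨hsteps.choose, ?_⟩, hsteps.choose_spec.1.trans ?_⟩
  · have h := hsteps.choose_spec.2
    have e₁ : Turing.initList (prog.machine .input .output)
        (List.map (Equiv.refl Sym).invFun (ea x)) =
        ⟨some (some prog.start), false, inputStacks (ea x) []⟩ := by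
      unfold Turing.initList
      congr 1
      funext k
      cases k
      · exact List.map_id _
      all_goals rfl
    have e₂ : Turing.haltList (prog.machine .input .output)
        (List.map (Equiv.refl Bool).invFun (Computability.encodeBool (f x))) =
        ⟨none, false, outputStacks [f x]⟩ := by
      unfold Turing.haltList
      congr 1
      funext k
      cases k <;> rfl
    rw [Option.map_some, e₂]
    refine Eq.trans ?_ h
    exact congrArg _ (congrArg some e₁)
  · simp

end StackProg

/-! ### The evaluation algorithm -/

namespace StackProg

open Code Atch

variable {α β γ : Type} [Code α] [Code β] [Code γ]

/-! #### Access to the parts of an instance -/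

/-- The number of the kind of an atom. -/
def atomKind : Atom → ℕ
  | .hyperedge _ _ => 0
  | .participant _ _ => 1
  | .vertexAttr _ _ => 2
  | .edgeAttr _ _ => 3
  | .window _ _ _ => 4
  | .confGe _ _ => 5
  | .confGt _ _ => 6

/-- The first term of an atom. -/
def atomTerm : Atom → Term
  | .hyperedge z _ => z
  | .participant t _ => t
  | .vertexAttr t _ => t
  | .edgeAttr z _ => z
  | .window z _ _ => z
  | .confGe z _ => z
  | .confGt z _ => z

/-- The other terms of an atom. -/
def atomTerms : Atom → List Term
  | .hyperedge _ ts => ts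
  | .participant _ z => [z]
  | _ => []

/-- The property that an atom asks for. -/
def atomProp : Atom → D
  | .vertexAttr _ p => propD p
  | .edgeAttr _ p => propD p
  | _ => .nil

/-- The range predicate of an atom. -/
def atomRel : Atom → ℕ
  | .window _ r _ => relCode r
  | _ => 0

/-- The threshold of an atom, or the lower end of its window. -/
def atomLo : Atom → ℚ
  | .window _ _ W => W.lo
  | .confGe _ θ => θ
  | .confGt _ θ => θ
  | _ => 0

/-- The upper end of the window of an atom. -/
def atomHi : Atom → ℚ
  | .window _ _ W => W.hi
  | _ => 0

namespace PolyTime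

@[fun_prop]
theorem atomKind {f : α → Atom} (hf : PolyTime f) : PolyTime fun x => atomKind (f x) :=
  comp (f := StackProg.atomKind) (of_toD (fun d => d.fst) (by fun_prop)
    fun a => by cases a <;> rfl) hf

@[fun_prop]
theorem atomTerm {f : α → Atom} (hf : PolyTime f) : PolyTime fun x => atomTerm (f x) :=
  comp (f := StackProg.atomTerm) (of_toD (fun d => d.snd.fst) (by fun_prop)
    fun a => by cases a <;> rfl) hf

@[fun_prop]
theorem atomTerms {f : α → Atom} (hf : PolyTime f) : PolyTime fun x => atomTerms (f x) :=
  -- For `participant` the coded atom without its first two entries already is the list `[z]`.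
  comp (f := StackProg.atomTerms) (of_toD (fun d => bif decide (d.fst = toD 0) then d.snd.snd.fst
    else bif decide (d.fst = toD 1) then d.snd.snd else .nil) (by fun_prop)
    fun a => by cases a <;> rfl) hf

@[fun_prop]
theorem atomProp {f : α → Atom} (hf : PolyTime f) : PolyTime fun x => atomProp (f x) :=
  comp (f := StackProg.atomProp) (of_toD (fun d => bif decide (d.fst = toD 2) then d.snd.snd.fst
    else bif decide (d.fst = toD 3) then d.snd.snd.fst else .nil) (by fun_prop)
    fun a => by cases a <;> rfl) hf

@[fun_prop]
theorem atomRel {f : α → Atom} (hf : PolyTime f) : PolyTime fun x => atomRel (f x) :=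
  comp (f := StackProg.atomRel) (of_toD (fun d => bif decide (d.fst = toD 4) then d.snd.snd.fst
    else .nil) (by fun_prop) fun a => by cases a <;> rfl) hf

@[fun_prop]
theorem atomLo {f : α → Atom} (hf : PolyTime f) : PolyTime fun x => atomLo (f x) :=
  comp (f := StackProg.atomLo) (of_toD (fun d => bif decide (d.fst = toD 4) then
    d.snd.snd.snd.fst else bif decide (d.fst = toD 5) then d.snd.snd.fst else
    bif decide (d.fst = toD 6) then d.snd.snd.fst else toD (0 : ℚ)) (by fun_prop)
    fun a => by cases a <;> rfl) hf

@[fun_prop]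
theorem atomHi {f : α → Atom} (hf : PolyTime f) : PolyTime fun x => atomHi (f x) :=
  comp (f := StackProg.atomHi) (of_toD (fun d => bif decide (d.fst = toD 4) then
    d.snd.snd.snd.snd.fst else toD (0 : ℚ)) (by fun_prop) fun a => by cases a <;> rfl) hf

@[fun_prop]
theorem lower {f : α → Interval} (hf : PolyTime f) : PolyTime fun x => (f x).lower.toList :=
  comp (f := fun I : Interval => I.lower.toList) (of_toD (fun d => d.fst) (by fun_prop)
    fun _ => rfl) hf

@[fun_prop]
theorem upper {f : α → Interval} (hf : PolyTime f) : PolyTime fun x => (f x).upper.toList :=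
  comp (f := fun I : Interval => I.upper.toList) (of_toD (fun d => d.snd.fst) (by fun_prop)
    fun _ => rfl) hf

@[fun_prop]
theorem vertexProps {f : α → Hypergraph} (hf : PolyTime f) : PolyTime fun x => vertexProps (f x) :=
  comp (f := StackProg.vertexProps) (of_toD (fun d => d.fst) (by fun_prop) fun _ => rfl) hf

@[fun_prop]
theorem edgeNodes {f : α → Hypergraph} (hf : PolyTime f) : PolyTime fun x => edgeNodes (f x) :=
  comp (f := StackProg.edgeNodes) (of_toD (fun d => d.snd.fst) (by fun_prop) fun _ => rfl) hf

@[fun_prop]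
theorem edgeProps {f : α → Hypergraph} (hf : PolyTime f) : PolyTime fun x => edgeProps (f x) :=
  comp (f := StackProg.edgeProps) (of_toD (fun d => d.snd.snd.fst) (by fun_prop) fun _ => rfl) hf

@[fun_prop]
theorem validTimes {f : α → Hypergraph} (hf : PolyTime f) : PolyTime fun x => validTimes (f x) :=
  comp (f := StackProg.validTimes) (of_toD (fun d => d.snd.snd.snd.fst) (by fun_prop)
    fun _ => rfl) hf

@[fun_prop]
theorem confs {f : α → Hypergraph} (hf : PolyTime f) : PolyTime fun x => confs (f x) :=
  comp (f := StackProg.confs) (of_toD (fun d => d.snd.snd.snd.snd.snd.fst) (by fun_prop)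
    fun _ => rfl) hf

@[fun_prop]
theorem precRows {f : α → Hypergraph} (hf : PolyTime f) : PolyTime fun x => precRows (f x) :=
  comp (f := StackProg.precRows) (of_toD (fun d => d.snd.snd.snd.snd.snd.snd.fst) (by fun_prop)
    fun _ => rfl) hf

@[fun_prop]
theorem queryAtoms {f : α → Query} (hf : PolyTime f) : PolyTime fun x => (f x).atoms :=
  comp (f := Query.atoms) (of_toD (fun d => d.fst) (by fun_prop) fun _ => rfl) hf

@[fun_prop]
theorem queryChains {f : α → Query} (hf : PolyTime f) : PolyTime fun x => (f x).chains :=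
  comp (f := Query.chains) (of_toD (fun d => d.snd.fst) (by fun_prop) fun _ => rfl) hf

@[fun_prop]
theorem queryOutput {f : α → Query} (hf : PolyTime f) : PolyTime fun x => (f x).output :=
  comp (f := Query.output) (of_toD (fun d => d.snd.snd.fst) (by fun_prop) fun _ => rfl) hf

@[fun_prop]
theorem instanceDb {f : α → Instance} (hf : PolyTime f) : PolyTime fun x => (f x).db :=
  comp (f := Instance.db) (of_toD (fun d => d.fst) (by fun_prop) fun _ => rfl) hf

@[fun_prop]
theorem instanceQuery {f : α → Instance} (hf : PolyTime f) : PolyTime fun x => (f x).query :=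
  comp (f := Instance.query) (of_toD (fun d => d.snd.fst) (by fun_prop) fun _ => rfl) hf

@[fun_prop]
theorem instanceTuple {f : α → Instance} (hf : PolyTime f) : PolyTime fun x => (f x).tuple :=
  comp (f := Instance.tuple) (of_toD (fun d => d.snd.snd.fst) (by fun_prop) fun _ => rfl) hf

@[fun_prop]
theorem inl {f : α → ℕ} (hf : PolyTime f) : PolyTime fun x => (Sum.inl (f x) : Obj) :=
  comp (f := fun n : ℕ => (Sum.inl n : Obj))
    (of_toD (fun d => .cons (toD [false]) (.cons d .nil)) (by fun_prop) fun _ => rfl) hf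

@[fun_prop]
theorem inr {f : α → ℕ} (hf : PolyTime f) : PolyTime fun x => (Sum.inr (f x) : Obj) :=
  comp (f := fun n : ℕ => (Sum.inr n : Obj))
    (of_toD (fun d => .cons (toD [true]) (.cons d .nil)) (by fun_prop) fun _ => rfl) hf

@[fun_prop]
theorem termVar {f : α → ℕ} (hf : PolyTime f) : PolyTime fun x => Term.var (f x) :=
  comp (f := Term.var)
    (of_toD (fun d => .cons (toD [false]) (.cons d .nil)) (by fun_prop) fun _ => rfl) hf

@[fun_prop]
theorem termConst {f : α → Obj} (hf : PolyTime f) : PolyTime fun x => Term.const (f x) :=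
  comp (f := Term.const)
    (of_toD (fun d => .cons (toD [true]) (.cons d .nil)) (by fun_prop) fun _ => rfl) hf

end PolyTime

/-- Whether a term is a variable. -/
def isVar : Term → Bool
  | .var _ => true
  | .const _ => false

@[fun_prop]
theorem PolyTime.isVar {f : α → Term} (hf : PolyTime f) : PolyTime fun x => isVar (f x) :=
  comp (f := StackProg.isVar) (of_toD (fun d => toD (decide (d.fst = toD [false])))
    (comp (f := fun b : Bool => toD b) (same fun _ => rfl) (by fun_prop))
    fun t => by cases t <;> rfl) hf

/-! #### The database -/

/-- The names of the hyperedges. -/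
def edgeNames (H : Hypergraph) : List Obj := (List.range (edgeNodes H).length).map Sum.inr

/-- A hyperedge with its participants, properties, valid time and confidence. -/
abbrev EdgeRec := Obj × List Obj × List D × Interval × ℚ

/-- All hyperedges. -/
def edgeRecs (H : Hypergraph) : List EdgeRec :=
  (edgeNames H).zip ((edgeNodes H).zip ((edgeProps H).zip ((validTimes H).zip (confs H))))

/-- All vertices with their properties. -/
def vertexRecs (H : Hypergraph) : List (Obj × List D) :=
  ((List.range (vertexProps H).length).map Sum.inl).zip (vertexProps H)

/-- The pairs in the causal order. -/
def precPairs (H : Hypergraph) : List (Obj × Obj) :=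
  ((edgeNames H).zip (precRows H)).flatMap fun p =>
    ((p.2.zip (edgeNames H)).filter fun q => q.1).map fun q => (p.1, q.2)

@[fun_prop]
theorem PolyTime.edgeNames {f : α → Hypergraph} (hf : PolyTime f) :
    PolyTime fun x => edgeNames (f x) := by
  unfold StackProg.edgeNames
  have := range_length (l := fun x => StackProg.edgeNodes (f x)) (by fun_prop)
  fun_prop

@[fun_prop]
theorem PolyTime.edgeRecs {f : α → Hypergraph} (hf : PolyTime f) :
    PolyTime fun x => edgeRecs (f x) := by
  unfold StackProg.edgeRecs
  fun_prop

@[fun_prop]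
theorem PolyTime.vertexRecs {f : α → Hypergraph} (hf : PolyTime f) :
    PolyTime fun x => vertexRecs (f x) := by
  unfold StackProg.vertexRecs
  have := range_length (l := fun x => StackProg.vertexProps (f x)) (by fun_prop)
  fun_prop

@[fun_prop]
theorem PolyTime.precPairs {f : α → Hypergraph} (hf : PolyTime f) :
    PolyTime fun x => precPairs (f x) := by
  unfold StackProg.precPairs
  fun_prop

/-! #### Atoms and chains as lists of systems of equations -/

/-- A system of equations between terms and objects. -/
abbrev Eqs := List (Term × Obj)

/-- Whether two lists have the same length. -/
def sameLength {β γ : Type} (l : List β) (k : List γ) : Bool :=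
  decide ((l.map fun _ => ()) = k.map fun _ => ())

@[fun_prop]
theorem PolyTime.sameLength {l : α → List β} {k : α → List γ} (hl : PolyTime l)
    (hk : PolyTime k) : PolyTime fun x => sameLength (l x) (k x) := by
  unfold StackProg.sameLength
  fun_prop

/-- The test of a range predicate. -/
def windowTest (r : ℕ) (I : Interval) (lo hi : ℚ) : Bool :=
  bif decide (r = 0) then
    (I.lower.toList.any fun a => decide (lo ≤ a)) && I.upper.toList.any fun b => decide (b ≤ hi)
  else bif decide (r = 1) then
    (I.lower.toList.all fun a => decide (a ≤ lo)) && I.upper.toList.all fun b => decide (hi ≤ b)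
  else
    (I.lower.toList.all fun a => decide (a ≤ hi)) && I.upper.toList.all fun b => decide (lo ≤ b)

@[fun_prop]
theorem PolyTime.windowTest {r : α → ℕ} {I : α → Interval} {lo hi : α → ℚ} (hr : PolyTime r)
    (hI : PolyTime I) (hlo : PolyTime lo) (hhi : PolyTime hi) :
    PolyTime fun x => windowTest (r x) (I x) (lo x) (hi x) := by
  unfold StackProg.windowTest
  fun_prop

/-- Whether a hyperedge passes the test of an atom for a single hyperedge. -/
def edgeTest (a : Atom) (r : EdgeRec) : Bool :=
  bif decide (atomKind a = 3) then decide (atomProp a ∈ r.2.2.1)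
  else bif decide (atomKind a = 4) then windowTest (atomRel a) r.2.2.2.1 (atomLo a) (atomHi a)
  else bif decide (atomKind a = 5) then decide (atomLo a ≤ r.2.2.2.2)
  else !decide (r.2.2.2.2 ≤ atomLo a)

/-- The systems of equations of which one has to hold for an atom to hold. -/
def atomEqs (H : Hypergraph) (a : Atom) : List Eqs :=
  bif decide (atomKind a = 0) then
    ((edgeRecs H).filter fun r => sameLength (atomTerms a) r.2.1).map fun r =>
      (atomTerm a, r.1) :: (atomTerms a).zip r.2.1
  else bif decide (atomKind a = 1) then
    (edgeRecs H).flatMap fun r => r.2.1.map fun o =>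
      (atomTerm a, o) :: (atomTerms a).map fun z => (z, r.1)
  else bif decide (atomKind a = 2) then
    ((vertexRecs H).filter fun r => decide (atomProp a ∈ r.2)).map fun r => [(atomTerm a, r.1)]
  else
    ((edgeRecs H).filter fun r => edgeTest a r).map fun r => [(atomTerm a, r.1)]

@[fun_prop]
theorem PolyTime.edgeTest {f : α → Atom} {r : α → EdgeRec} (hf : PolyTime f) (hr : PolyTime r) :
    PolyTime fun x => edgeTest (f x) (r x) := by
  unfold StackProg.edgeTest
  fun_prop

@[fun_prop]
theorem PolyTime.atomEqs {h : α → Hypergraph} {f : α → Atom} (hh : PolyTime h)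
    (hf : PolyTime f) : PolyTime fun x => atomEqs (h x) (f x) := by
  unfold StackProg.atomEqs
  fun_prop

/-- The lists of at most `k` objects. -/
def listsUpTo (l : List Obj) : ℕ → List (List Obj)
  | 0 => [[]]
  | k + 1 => [] :: (listsUpTo l k).flatMap fun m => l.map fun o => o :: m

-- The recursion on the constant `k` unfolds into a fixed program; only the degree of the bound
-- depends on `k`. The same applies to `splits` and `choices`.
@[fun_prop]
theorem PolyTime.listsUpTo {l : α → List Obj} (hl : PolyTime l) (k : ℕ) :
    PolyTime fun x => listsUpTo (l x) k := by
  induction k with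
  | zero => unfold StackProg.listsUpTo; fun_prop
  | succ k ih => unfold StackProg.listsUpTo; fun_prop

/-- The systems of equations of which one has to hold for a chain of depth at most `d` to hold. -/
def chainEqs (d : ℕ) (H : Hypergraph) (zs : List Term) : List Eqs :=
  ((listsUpTo (edgeNames H) (d + 1)).filter fun es =>
    sameLength zs es && (es.zip es.tail).all fun p =>
      (precPairs H).any fun q => decide (p = q)).map fun es =>
      zs.zip es

@[fun_prop]
theorem PolyTime.chainEqs (d : ℕ) {h : α → Hypergraph} {zs : α → List Term} (hh : PolyTime h)
    (hzs : PolyTime zs) : PolyTime fun x => chainEqs d (h x) (zs x) := by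
  unfold StackProg.chainEqs
  fun_prop

/-! #### Consistency -/

/-- Whether two systems of equations give the same values to their common terms. -/
def compat (m m' : Eqs) : Bool :=
  m.all fun p => m'.all fun q => bif decide (p.1 = q.1) then decide (p.2 = q.2) else true

/-- Whether a system of equations has a solution. -/
def solvable (m : Eqs) : Bool :=
  compat m m && m.all fun p => isVar p.1 || decide (p.1 = Term.const p.2)

/-- One round of the removal of systems of equations without partner. -/
def prune (Rs : List (List Eqs)) : List (List Eqs) :=
  Rs.map fun R => R.filter fun m => Rs.all fun R' => R'.any fun m' => compat m m'

/-- The pairwise consistency test. -/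
def consistent (Rs : List (List Eqs)) : Bool :=
  (prune^[Rs.flatten.length] Rs).all fun R => !R.isEmpty

@[fun_prop]
theorem PolyTime.compat {m m' : α → Eqs} (hm : PolyTime m) (hm' : PolyTime m') :
    PolyTime fun x => compat (m x) (m' x) := by
  unfold StackProg.compat
  fun_prop

@[fun_prop]
theorem PolyTime.solvable {m : α → Eqs} (hm : PolyTime m) :
    PolyTime fun x => solvable (m x) := by
  unfold StackProg.solvable
  fun_prop

theorem size_map_le (l : List β) (f : β → β) (hf : ∀ b, size (f b) ≤ size b) :
    size (l.map f) ≤ size l := by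
  induction l with
  | nil => simp
  | cons b l ih =>
    have := hf b
    simp; omega

@[fun_prop]
theorem PolyTime.prune {f : α → List (List Eqs)} (hf : PolyTime f) :
    PolyTime fun x => prune (f x) := by
  unfold StackProg.prune
  fun_prop

-- A round only deletes systems, so the data never grow and `iterate` applies.
@[fun_prop]
theorem PolyTime.consistent {f : α → List (List Eqs)} (hf : PolyTime f) :
    PolyTime fun x => consistent (f x) := by
  have h := iterate (l := fun x => (f x).flatten) (f := fun _ => StackProg.prune)
    (by simp only [List.flatten_eq_flatMap]; fun_prop) hf (by fun_prop)
    fun _ Rs => size_map_le _ _ fun R => size_le_of_sublist List.filter_sublist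
  unfold StackProg.consistent
  fun_prop

/-! #### Acyclicity -/

/-- Whether the variables that `e` shares with the other sets all lie in one of them. -/
def earTest (e : List Term) (F : List (List Term)) : Bool :=
  F.isEmpty || F.any fun f => F.all fun g => e.all fun t =>
    !isVar t || !decide (t ∈ g) || decide (t ∈ f)

/-- All ways to single out an entry of a list. -/
def picks {β : Type} : List β → List (β × List β)
  | [] => []
  | b :: l => (b, l) :: (picks l).map fun p => (p.1, b :: p.2)

/-- Remove an ear if there is one. -/
def removeEar (F : List (List Term)) : List (List Term) :=
  listCase ((picks F).filter fun p => earTest p.1 p.2) F fun p _ => p.2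

/-- The acyclicity test by the removal of ears. -/
def acyclicTest (F : List (List Term)) : Bool := (removeEar^[F.length] F).isEmpty

theorem length_picks {β : Type} (l : List β) : (picks l).length = l.length := by
  induction l with
  | nil => rfl
  | cons b l ih => simp [picks, ih]

theorem perm_of_mem_picks {β : Type} {l : List β} {p : β × List β} (h : p ∈ picks l) :
    l.Perm (p.1 :: p.2) ∧ p.2.Sublist l := by
  induction l generalizing p with
  | nil => simp [picks] at h
  | cons b l ih =>
    simp only [picks, List.mem_cons, List.mem_map] at h
    obtain rfl | ⟨q, hq, rfl⟩ := h
    · exact ⟨.rfl, List.sublist_cons_self _ _⟩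
    · exact ⟨((ih hq).1.cons b).trans (List.Perm.swap _ _ _), (ih hq).2.cons_cons b⟩

theorem exists_mem_picks {β : Type} {l : List β} {b : β} (h : b ∈ l) :
    ∃ k, (b, k) ∈ picks l := by
  induction l with
  | nil => simp at h
  | cons c l ih =>
    obtain rfl | h := List.mem_cons.1 h
    · exact ⟨l, by simp [picks]⟩
    · obtain ⟨k, hk⟩ := ih h
      exact ⟨c :: k, List.mem_cons_of_mem _ (List.mem_map.2 ⟨_, hk, rfl⟩)⟩

-- The recursion is a right fold that also carries the suffix it has processed. Its values are lists
-- of at most as many pairs as `l` has entries, each an entry with a sublist of `l`, so their size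
-- is at most quadratic.
@[fun_prop]
theorem PolyTime.picks {l : α → List β} (hl : PolyTime l) : PolyTime fun x => picks (l x) := by
  let step : α → List β × List (β × List β) → β → List β × List (β × List β) := fun _ s b =>
    (b :: s.1, (b, s.1) :: s.2.map fun p => (p.1, b :: p.2))
  have h (k : List β) : k.foldr (fun b (s : List β × List (β × List β)) =>
      (b :: s.1, (b, s.1) :: s.2.map fun p => (p.1, b :: p.2))) ([], []) =
      (k, StackProg.picks k) := by
    induction k with
    | nil => rfl
    | cons b k ih => rw [List.foldr_cons, ih]; rfl
  have hp (L : List β) (P : List (β × List β)) (hP : ∀ p ∈ P, p.1 ∈ L ∧ p.2.Sublist L) :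
      size P ≤ 1 + P.length * (2 * size L + 2) := by
    induction P with
    | nil => simp
    | cons p P ih =>
      have h₁ := ih fun p h => hP p (by simp [h])
      have h₂ := hP p (by simp)
      have h₃ := size_le_of_mem h₂.1
      have h₄ := size_le_of_sublist h₂.2
      obtain ⟨b, k⟩ := p
      simp only [size_cons, size_pair, List.length_cons]
      simp only at h₃ h₄
      linarith
  have key := foldl_of_bdd (step := step) (l := fun x => (l x).reverse)
    (base := fun _ => ([], [])) (by fun_prop)
    (by fun_prop) (by simp only [step]; fun_prop)
    (s := fun x => size (l x) + (1 + size (l x) * (2 * size (l x) + 2)) + 1) ?_ ?_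
  · have : (fun x => StackProg.picks (l x)) =
        fun x => ((l x).reverse.foldl (step x) ([], [])).2 := by
      funext x
      simp only [step, List.foldl_reverse, h]
    rw [this]
    fun_prop
  · have := hl.size_bdd
    exact (this.add ((PolyBdd.const 1).add (this.mul (((PolyBdd.const 2).mul this).add
      (.const 2))))).add (.const 1)
  · intro x i
    have h₁ : ((l x).reverse.take i).foldl (step x) ([], []) =
        (((l x).reverse.take i).reverse, StackProg.picks ((l x).reverse.take i).reverse) := by
      rw [← h, List.foldr_reverse]
    have h₂ : (((l x).reverse.take i).reverse).Sublist (l x) := by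
      simpa using (List.take_sublist i (l x).reverse).reverse
    generalize ((l x).reverse.take i).reverse = k at h₁ h₂
    rw [h₁, size_pair]
    have h₃ := hp (l x) (StackProg.picks k) fun p hp =>
      ⟨h₂.subset ((perm_of_mem_picks hp).1.mem_iff.2 (by simp)),
        (perm_of_mem_picks hp).2.trans h₂⟩
    have h₄ := size_le_of_sublist h₂
    have h₅ : (StackProg.picks k).length * (2 * size (l x) + 2) ≤
        size (l x) * (2 * size (l x) + 2) := by
      rw [length_picks]
      exact Nat.mul_le_mul_right _ ((length_le_size k).trans h₄)
    omega

@[fun_prop]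
theorem PolyTime.earTest {e : α → List Term} {F : α → List (List Term)} (he : PolyTime e)
    (hF : PolyTime F) : PolyTime fun x => earTest (e x) (F x) := by
  unfold StackProg.earTest
  fun_prop

/-- These two alternatives are all that is needed: by `Acyc.of_cons` it does not matter which ear is
removed. -/
theorem removeEar_spec (F : List (List Term)) :
    (removeEar F = F ∧ ∀ p ∈ picks F, earTest p.1 p.2 = false) ∨
      ∃ p ∈ picks F, earTest p.1 p.2 = true ∧ removeEar F = p.2 := by
  unfold removeEar
  cases h : (picks F).filter fun p => earTest p.1 p.2 with
  | nil =>
    refine .inl ⟨rfl, fun p hp => ?_⟩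
    simpa using List.filter_eq_nil_iff.1 h p hp
  | cons p l =>
    have : p ∈ (picks F).filter fun p => earTest p.1 p.2 := by simp [h]
    obtain ⟨h₁, h₂⟩ := List.mem_filter.1 this
    exact .inr ⟨p, h₁, h₂, rfl⟩

@[fun_prop]
theorem PolyTime.acyclicTest {F : α → List (List Term)} (hF : PolyTime F) :
    PolyTime fun x => acyclicTest (F x) := by
  have h := iterate (l := F) (f := fun _ => StackProg.removeEar) hF hF
    (by unfold StackProg.removeEar; fun_prop) fun _ G => by
      obtain h | ⟨p, hp, -, h⟩ := removeEar_spec G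
      · rw [h.1]
      · rw [h]
        exact size_le_of_sublist (perm_of_mem_picks hp).2
  unfold StackProg.acyclicTest
  fun_prop

/-! #### The algorithm -/

/-- The ways to set aside at most `c` entries of a list. -/
def splits {β : Type} : ℕ → List β → List (List β × List β)
  | 0, l => [([], l)]
  | c + 1, l => splits c l ++ (splits c l).flatMap fun p =>
      (picks p.2).map fun q => (q.1 :: p.1, q.2)

@[fun_prop]
theorem PolyTime.splits (c : ℕ) {l : α → List β} (hl : PolyTime l) :
    PolyTime fun x => splits c (l x) := by
  induction c with
  | zero => unfold StackProg.splits; fun_prop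
  | succ c ih => unfold StackProg.splits; fun_prop

/-- The ways to extend a system of equations by systems for `c` chains. -/
def choices (d : ℕ) (H : Hypergraph) (m : Eqs) :
    ℕ → List (List Term) → List (Eqs × List (List Term))
  | 0, free => [(m, free)]
  | c + 1, free => (choices d H m c free).flatMap fun p => listCase p.2 [p] fun zs rest =>
      (chainEqs d H zs).map fun m' => (m' ++ p.1, rest)

@[fun_prop]
theorem PolyTime.choices (d c : ℕ) {h : α → Hypergraph} {m : α → Eqs}
    {free : α → List (List Term)} (hh : PolyTime h) (hm : PolyTime m) (hfree : PolyTime free) :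
    PolyTime fun x => choices d (h x) (m x) c (free x) := by
  induction c with
  | zero => unfold StackProg.choices; fun_prop
  | succ c ih => unfold StackProg.choices; fun_prop

/-- The relations of the atoms and of the given chains. -/
def relations (d : ℕ) (H : Hypergraph) (atoms : List Atom) (tied : List (List Term)) :
    List (List Eqs) :=
  (atoms.map fun a => atomEqs H a) ++ tied.map fun zs => chainEqs d H zs

/-- The evaluation of a query once the free chains are chosen. -/
def splitTest (c d : ℕ) (x : Instance) (free tied : List (List Term)) : Bool :=
  acyclicTest ((x.query.atoms.map fun a => atomTerm a :: atomTerms a) ++ tied) &&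
    (choices d x.db ((x.query.output.map Term.var).zip x.tuple) c free).any fun p =>
      solvable p.1 && consistent ((relations d x.db x.query.atoms tied).map fun R =>
        R.filter fun m => solvable m && compat p.1 m)

/-- The evaluation algorithm. -/
def evaluate (c d : ℕ) (x : Instance) : Bool :=
  (x.query.chains.all fun zs => (List.tail^[d + 1] zs).isEmpty) &&
    (sameLength x.query.output x.tuple && x.tuple.all fun o =>
      ((vertexRecs x.db).any fun r => decide (o = r.1)) || (edgeNames x.db).any fun e =>
        decide (o = e)) &&
    (splits c x.query.chains).any fun p => splitTest c d x p.1 p.2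

theorem PolyTime.iterate_tail {f : α → List β} (hf : PolyTime f) (n : ℕ) :
    PolyTime fun x => List.tail^[n] (f x) := by
  induction n with
  | zero => exact hf
  | succ n ih =>
    simp only [Function.iterate_succ_apply']
    fun_prop

@[fun_prop]
theorem PolyTime.splitTest (c d : ℕ) {f : α → Instance} {free tied : α → List (List Term)}
    (hf : PolyTime f) (hfree : PolyTime free) (htied : PolyTime tied) :
    PolyTime fun x => splitTest c d (f x) (free x) (tied x) := by
  unfold StackProg.splitTest relations
  fun_prop

theorem polyTime_evaluate (c d : ℕ) : PolyTime (evaluate c d) := by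
  have := PolyTime.iterate_tail (f := fun p : Instance × List Term => p.2) (by fun_prop) (d + 1)
  unfold evaluate
  fun_prop

end StackProg

/-! ### Acyclicity by the removal of ears -/

namespace StackProg

open Atch

/-- The points that `e` shares with the members of `F` all lie in a single member of `F`. -/
def Ear (e : Finset ℕ) (F : Multiset (Finset ℕ)) : Prop :=
  F = 0 ∨ ∃ f ∈ F, ∀ g ∈ F, e ∩ g ⊆ f

/-- Families that can be built by adding ears. -/
inductive Acyc : Multiset (Finset ℕ) → Prop
  | zero : Acyc 0
  | cons {e F} : Ear e F → Acyc F → Acyc (e ::ₘ F)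

/-- The ear condition sees a member only through its intersections with the others, so the order of
construction with `i` also serves with `k`. Where `i` contained the shared points of an ear `e`,
these points lie in `i ∩ e = k ∩ e`, and `k` takes over. -/
theorem Acyc.replace {M : Multiset (Finset ℕ)} (h : Acyc M) : ∀ {i k : Finset ℕ}
    {G : Multiset (Finset ℕ)}, M = i ::ₘ G → (∀ m ∈ G, i ∩ m = k ∩ m) → Acyc (k ::ₘ G) := by
  induction h with
  | zero => intro i k G hM; simp at hM
  | @cons e F he hF ih =>
    intro i k G hM hik
    obtain ⟨rfl, rfl⟩ | ⟨-, C, rfl, rfl⟩ := Multiset.cons_eq_cons.1 hM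
    · refine .cons ?_ hF
      obtain h | ⟨f, hf, h⟩ := he
      · exact .inl h
      · exact .inr ⟨f, hf, fun g hg => hik g hg ▸ h g hg⟩
    · refine Multiset.cons_swap k e C ▸ .cons ?_ (ih rfl fun m hm => hik m (by simp [hm]))
      obtain h | ⟨f, hf, h⟩ := he
      · simp at h
      have hie : i ∩ e = k ∩ e := hik e (by simp)
      have key : ∀ g ∈ k ::ₘ C, e ∩ g ⊆ f := by
        intro g hg
        obtain rfl | hg := Multiset.mem_cons.1 hg
        · rw [Finset.inter_comm, ← hie, Finset.inter_comm]
          exact h i (by simp)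
        · exact h g (by simp [hg])
      obtain rfl | hf := Multiset.mem_cons.1 hf
      · refine .inr ⟨k, by simp, fun g hg x hx => ?_⟩
        have h₁ : x ∈ f ∩ e := Finset.mem_inter.2 ⟨key g hg hx, (Finset.mem_inter.1 hx).1⟩
        rw [hie] at h₁
        exact (Finset.mem_inter.1 h₁).1
      · exact .inr ⟨f, by simp [hf], key⟩

/-- An ear of an acyclic family can be removed. -/
theorem Acyc.of_cons {M : Multiset (Finset ℕ)} (h : Acyc M) : ∀ {e : Finset ℕ}
    {F : Multiset (Finset ℕ)}, M = e ::ₘ F → Ear e F → Acyc F := by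
  induction h with
  | zero => intro e F hM; simp at hM
  | @cons k F' hk hF' ih =>
    intro e F hM he
    obtain ⟨rfl, rfl⟩ | ⟨-, G, rfl, rfl⟩ := Multiset.cons_eq_cons.1 hM
    · exact hF'
    obtain hk | ⟨l, hl, hk⟩ := hk
    · simp at hk
    obtain he | ⟨j, hj, he⟩ := he
    · simp at he
    have hk' : ∀ g ∈ G, k ∩ g ⊆ l := fun g hg => hk g (by simp [hg])
    have he' : ∀ g ∈ G, e ∩ g ⊆ j := fun g hg => he g (by simp [hg])
    have trans {a b c g : Finset ℕ} (h : a ∩ g ⊆ b) (h' : b ∩ g ⊆ c) : a ∩ g ⊆ c :=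
      fun x hx => h' (Finset.mem_inter.2 ⟨h hx, (Finset.mem_inter.1 hx).2⟩)
    obtain rfl | hj := Multiset.mem_cons.1 hj
    · obtain rfl | hl := Multiset.mem_cons.1 hl
      -- Here `e` and `k` contain each other's shared points, so they meet the rest in the same sets
      -- and `k` may replace `e`.
      · exact hF'.replace rfl fun m hm => Finset.Subset.antisymm
          (fun x hx => Finset.mem_inter.2 ⟨he' m hm hx, (Finset.mem_inter.1 hx).2⟩)
          (fun x hx => Finset.mem_inter.2 ⟨hk' m hm hx, (Finset.mem_inter.1 hx).2⟩)
      · exact .cons (.inr ⟨l, hl, hk'⟩)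
          (ih rfl (.inr ⟨l, hl, fun g hg => trans (he' g hg) (hk' g hg)⟩))
    -- Here `j` remains after `e` is removed; if the shared points of `k` lay in `e`, those shared
    -- with `G` lie in `j`.
    · refine .cons ?_ (ih rfl (.inr ⟨j, hj, he'⟩))
      obtain rfl | hl := Multiset.mem_cons.1 hl
      · exact .inr ⟨j, hj, fun g hg => trans (hk' g hg) (he' g hg)⟩
      · exact .inr ⟨l, hl, hk'⟩

theorem Acyc.exists_ear {M : Multiset (Finset ℕ)} (h : Acyc M) (h0 : M ≠ 0) :
    ∃ e F, M = e ::ₘ F ∧ Ear e F := by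
  cases h with
  | zero => exact absurd rfl h0
  | cons he _ => exact ⟨_, _, rfl, he⟩

/-! ### Join forests and constructions by ears. -/

section Forest

variable {ι : Type} [DecidableEq ι] (f : ι → Finset ℕ)

/-- Take an end of a longest path: by maximality all its neighbours lie on the path, and by
acyclicity only the second vertex of the path can be one. -/
theorem exists_leaf [Finite ι] [Nonempty ι] {T : SimpleGraph ι} (hT : T.IsAcyclic) :
    ∃ u, (T.neighborSet u).Subsingleton := by
  obtain ⟨u, v, p, hp, hmax⟩ := SimpleGraph.Walk.exists_isPath_forall_isPath_length_le_length T
  have h : ∀ w, T.Adj u w → w ∈ p.support := by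
    intro w hw
    by_contra hmem
    have := hmax _ _ (p.cons hw.symm) (hp.cons hmem)
    simp at this
  exact ⟨u, fun a ha b hb => (hT.eq_snd_of_adj_start hp ha (h a ha)).trans
    (hT.eq_snd_of_adj_start hp hb (h b hb)).symm⟩

/-- A leaf is an ear: a point that it shares with another member reaches that member through a
connected subgraph, hence through the only neighbour of the leaf. Working with subsets `s` keeps the
graph fixed during the induction. -/
theorem acyc_of_forest [Finite ι] {T : SimpleGraph ι} (hT : T.IsAcyclic) (n : ℕ) :
    ∀ s : Finset ι, s.card = n → (∀ x, (T.induce {i | i ∈ s ∧ x ∈ f i}).Preconnected) →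
      Acyc (s.val.map f) := by
  induction n with
  | zero =>
    intro s hs _
    rw [Finset.card_eq_zero.1 hs]
    exact .zero
  | succ n ih =>
    intro s hs hconn
    have hne : Nonempty {i | i ∈ s} := (Finset.card_pos.1 (by omega)).to_subtype
    obtain ⟨⟨u, hu⟩, hleaf⟩ := exists_leaf (hT.induce {i | i ∈ s})
    have hu : u ∈ s := hu
    have hnb : ∀ a b, a ∈ s → b ∈ s → T.Adj u a → T.Adj u b → a = b := fun a b ha hb hua hub =>
      congrArg Subtype.val (@hleaf ⟨a, ha⟩ hua ⟨b, hb⟩ hub)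
    have hcons : s.val.map f = f u ::ₘ (s.erase u).val.map f := by
      rw [← Multiset.map_cons, Finset.erase_val, Multiset.cons_erase hu]
    rw [hcons]
    refine .cons ?_ (ih (s.erase u) (by rw [Finset.card_erase_of_mem hu]; omega) fun x => ?_)
    · by_cases h0 : s.erase u = ∅
      · exact .inl (by simp [h0])
      obtain ⟨j, hj⟩ := Finset.nonempty_iff_ne_empty.2 h0
      have hstep : ∀ g ∈ s.erase u, ∀ x ∈ f u ∩ f g, ∃ w ∈ s.erase u, T.Adj u w ∧ x ∈ f w := by
        intro g hg x hx
        obtain ⟨hxu, hxg⟩ := Finset.mem_inter.1 hx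
        obtain ⟨hgu, hgs⟩ := Finset.mem_erase.1 hg
        obtain ⟨p⟩ := hconn x ⟨u, hu, hxu⟩ ⟨g, hgs, hxg⟩
        have hp : ¬p.Nil := SimpleGraph.Walk.not_nil_of_ne
          fun h => hgu (congrArg Subtype.val h).symm
        have hadj : T.Adj u p.snd := p.adj_snd hp
        exact ⟨p.snd, Finset.mem_erase.2 ⟨hadj.ne', p.snd.2.1⟩, hadj, p.snd.2.2⟩
      by_cases hw : ∃ w ∈ s.erase u, T.Adj u w
      · obtain ⟨w, hw, huw⟩ := hw
        refine .inr ⟨f w, Multiset.mem_map_of_mem f hw, fun g hg x hx => ?_⟩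
        obtain ⟨g, hgs, rfl⟩ := Multiset.mem_map.1 hg
        obtain ⟨w', hw', huw', hxw'⟩ := hstep g hgs x hx
        rwa [hnb w w' (Finset.mem_of_mem_erase hw) (Finset.mem_of_mem_erase hw') huw huw']
      -- An isolated leaf shares no point, so any other member will do.
      · refine .inr ⟨f j, Multiset.mem_map_of_mem f hj, fun g hg x hx => ?_⟩
        obtain ⟨g, hgs, rfl⟩ := Multiset.mem_map.1 hg
        obtain ⟨w', hw', huw', -⟩ := hstep g hgs x hx
        exact absurd ⟨w', hw', huw'⟩ hw
    -- Deleting a vertex with at most one neighbour does not disconnect the members that contain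
    -- `x`.
    · have h := (hconn x).induce_of_degree_eq_one (s := {i | i.1 ≠ u}) (by
        rintro ⟨i, hi⟩ hiu a ha b hb
        have : i = u := by simpa using hiu
        subst this
        exact Subtype.ext (hnb _ _ a.2.1 b.2.1 ha hb))
      refine h.map ⟨fun z => ⟨z.1.1, ?_⟩, fun h => h⟩ ?_
      · exact ⟨Finset.mem_erase.2 ⟨z.2, z.1.2.1⟩, z.1.2.2⟩
      · rintro ⟨i, hi, hxi⟩
        exact ⟨⟨⟨i, Finset.mem_of_mem_erase hi, hxi⟩, (Finset.mem_erase.1 hi).1⟩, rfl⟩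

/-- The ear `u` is hung as a new leaf on the member `w` that contains its shared points. Since all
edges have their ends in `s`, the vertex `u` is isolated in the old forest and the new edge closes
no cycle. A point of `u` that occurs elsewhere occurs in `w`, which gives connectivity. -/
theorem forest_of_acyc {M : Multiset (Finset ℕ)} (hM : Acyc M) :
    ∀ s : Finset ι, s.val.map f = M → ∃ T : SimpleGraph ι, T.IsAcyclic ∧
      (∀ i j, T.Adj i j → i ∈ s) ∧ ∀ x, (T.induce {i | i ∈ s ∧ x ∈ f i}).Preconnected := by
  induction hM with
  | zero =>
    intro s hs
    have : s = ∅ := by simpa using hs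
    subst this
    exact ⟨⊥, SimpleGraph.isAcyclic_bot, fun i j h => h.elim, fun x a => absurd a.2.1 (by simp)⟩
  | @cons e F he _ ih =>
    intro s hs
    obtain ⟨u, hu, rfl, hF⟩ := (Multiset.map_eq_cons f s.val F e).2 hs
    have hu : u ∈ s := hu
    obtain ⟨T, hT, hsupp, hconn⟩ := ih (s.erase u) (by rw [Finset.erase_val]; exact hF)
    have hsupp' : ∀ i j, T.Adj i j → i ∈ s := fun i j h => Finset.mem_of_mem_erase (hsupp i j h)
    have hmem : ∀ i, i ∈ s → i ≠ u → f i ∈ F := fun i hi hiu => by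
      rw [← hF, ← Finset.erase_val]
      exact Multiset.mem_map_of_mem f (Finset.mem_erase.2 ⟨hiu, hi⟩)
    obtain h0 | ⟨g, hg, he⟩ := he
    · refine ⟨T, hT, hsupp', fun x a b => ?_⟩
      have h : ∀ i, i ∈ s → i = u := fun i hi => by
        by_contra hiu
        have := hmem i hi hiu
        simp [h0] at this
      rw [show a = b from Subtype.ext ((h _ a.2.1).trans (h _ b.2.1).symm)]
    · obtain ⟨w, hw, rfl⟩ : ∃ w ∈ s.erase u, f w = g := by
        rw [← hF, ← Finset.erase_val] at hg
        obtain ⟨w, hw, h⟩ := Multiset.mem_map.1 hg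
        exact ⟨w, hw, h⟩
      obtain ⟨hwu, hws⟩ := Finset.mem_erase.1 hw
      have hnr : ¬T.Reachable u w := by
        rintro ⟨p⟩
        have hp : ¬p.Nil := SimpleGraph.Walk.not_nil_of_ne hwu.symm
        have := hsupp _ _ (p.adj_snd hp)
        simp at this
      refine ⟨T ⊔ SimpleGraph.edge u w, hT.sup_edge_of_not_reachable hnr, ?_, fun x => ?_⟩
      · intro i j h
        obtain h | h := SimpleGraph.sup_adj _ _ _ _ |>.1 h
        · exact hsupp' i j h
        · rw [SimpleGraph.edge_adj] at h
          obtain ⟨⟨rfl, rfl⟩ | ⟨rfl, rfl⟩, -⟩ := h <;> assumption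
      · set A : Set ι := {i | i ∈ s ∧ x ∈ f i}
        let φ : T.induce {i | i ∈ s.erase u ∧ x ∈ f i} →g (T ⊔ SimpleGraph.edge u w).induce A :=
          ⟨fun z => ⟨z.1, Finset.mem_of_mem_erase z.2.1, z.2.2⟩, fun h => Or.inl h⟩
        have h₁ : ∀ a b : A, a.1 ≠ u → b.1 ≠ u →
            ((T ⊔ SimpleGraph.edge u w).induce A).Reachable a b := fun a b ha hb =>
          (hconn x ⟨a, Finset.mem_erase.2 ⟨ha, a.2.1⟩, a.2.2⟩
            ⟨b, Finset.mem_erase.2 ⟨hb, b.2.1⟩, b.2.2⟩).map φ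
        have h₂ : ∀ a b : A, a.1 = u → b.1 ≠ u →
            ((T ⊔ SimpleGraph.edge u w).induce A).Reachable a b := by
          rintro ⟨a, ha⟩ b rfl hb
          have hxw : x ∈ f w := he _ (hmem b b.2.1 hb) (Finset.mem_inter.2 ⟨ha.2, b.2.2⟩)
          refine SimpleGraph.Reachable.trans (v := ⟨w, hws, hxw⟩) ?_ (h₁ _ b hwu hb)
          refine SimpleGraph.Adj.reachable (Or.inr ?_)
          rw [SimpleGraph.edge_adj]
          exact ⟨.inl ⟨rfl, rfl⟩, hwu.symm⟩
        intro a b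
        by_cases ha : a.1 = u <;> by_cases hb : b.1 = u
        · rw [show a = b from Subtype.ext (ha.trans hb.symm)]
        · exact h₂ a b ha hb
        · exact (h₂ b a hb ha).symm
        · exact h₁ a b ha hb

end Forest

theorem alphaAcyclic_iff (es : List (Finset ℕ)) : AlphaAcyclic es ↔ Acyc (es : Multiset _) := by
  have h : (Finset.univ : Finset (Fin es.length)).val.map es.get = (es : Multiset (Finset ℕ)) := by
    rw [Fin.univ_val_map, List.ofFn_get]
  constructor
  · rintro ⟨T, hT, hconn⟩
    rw [← h]
    refine acyc_of_forest es.get hT _ _ rfl fun x => ?_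
    have e : {i | i ∈ Finset.univ ∧ x ∈ es.get i} = {i | x ∈ es.get i} := by ext; simp
    rw [e]
    exact hconn x
  · intro hA
    obtain ⟨T, hT, -, hconn⟩ := forest_of_acyc es.get hA Finset.univ h
    refine ⟨T, hT, fun x => ?_⟩
    have e : {i | i ∈ Finset.univ ∧ x ∈ es.get i} = {i | x ∈ es.get i} := by ext; simp
    rw [← e]
    exact hconn x

/-! ### Correctness of the acyclicity test -/

theorem mem_termVars {ts : List Term} {x : ℕ} : x ∈ termVars ts ↔ Term.var x ∈ ts := by
  induction ts with
  | nil => simp [termVars]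
  | cons t ts ih =>
    have : termVars (t :: ts) = t.vars ∪ termVars ts := rfl
    rw [this, Finset.mem_union, ih, List.mem_cons]
    cases t <;> simp [Term.vars]

theorem earTest_iff (e : List Term) (F : List (List Term)) :
    earTest e F = true ↔ Ear (termVars e) ((F.map termVars : List (Finset ℕ)) : Multiset _) := by
  have h (f g : List Term) : (e.all fun t => !isVar t || !decide (t ∈ g) || decide (t ∈ f)) = true ↔
      termVars e ∩ termVars g ⊆ termVars f := by
    simp only [List.all_eq_true, Finset.subset_iff, Finset.mem_inter, mem_termVars]
    constructor
    · intro h x hx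
      have := h _ hx.1
      simpa [isVar, hx.2] using this
    · rintro h (x | o) ht
      · by_cases hg : Term.var x ∈ g
        · simp [h ⟨ht, hg⟩]
        · simp [hg]
      · simp [isVar]
  unfold earTest Ear
  simp only [Bool.or_eq_true, List.isEmpty_iff, List.any_eq_true, List.all_eq_true (l := F), h]
  simp

theorem acyclicTest_iff (F : List (List Term)) :
    acyclicTest F = true ↔ Acyc ((F.map termVars : List (Finset ℕ)) : Multiset _) := by
  have main (n : ℕ) : ∀ F : List (List Term), F.length = n → ((removeEar^[n] F).isEmpty = true ↔
      Acyc ((F.map termVars : List (Finset ℕ)) : Multiset _)) := by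
    induction n with
    | zero =>
      intro F hF
      rw [List.length_eq_zero_iff.1 hF]
      simpa using Acyc.zero
    | succ n ih =>
      intro F hF
      rw [Function.iterate_succ_apply]
      have hcoe {p : List Term × List (List Term)} (hp : p ∈ picks F) :
          ((F.map termVars : List (Finset ℕ)) : Multiset (Finset ℕ)) =
            termVars p.1 ::ₘ ((p.2.map termVars : List (Finset ℕ)) : Multiset (Finset ℕ)) := by
        rw [Multiset.cons_coe, Multiset.coe_eq_coe]
        exact (perm_of_mem_picks hp).1.map termVars
      obtain ⟨h, hno⟩ | ⟨p, hp, hear, h⟩ := removeEar_spec F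
      -- The family is non-empty, having `n + 1` members, so an acyclic one would have an ear; with
      -- none left, both sides are false.
      · rw [h, Function.iterate_fixed h]
        constructor
        · intro h0
          rw [List.isEmpty_iff.1 h0] at hF
          simp at hF
        · intro hA
          obtain ⟨e, G, hG, he⟩ := hA.exists_ear (by
            intro h0
            simp at h0
            simp [h0] at hF)
          have hmem : e ∈ F.map termVars := by
            rw [← Multiset.mem_coe, hG]
            simp
          obtain ⟨t, ht, rfl⟩ := List.mem_map.1 hmem
          obtain ⟨k, hk⟩ := exists_mem_picks ht
          have h₁ := hcoe hk
          rw [hG, Multiset.cons_inj_right] at h₁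
          rw [h₁] at he
          have := hno _ hk
          rw [(earTest_iff _ _).2 he] at this
          simp at this
      · rw [h, ih _ (by have := (perm_of_mem_picks hp).1.length_eq; simp at this; omega), hcoe hp]
        have he := (earTest_iff _ _).1 hear
        exact ⟨fun hA => .cons he hA, fun hA => hA.of_cons rfl he⟩
  exact main _ F rfl

end StackProg

/-! ### Correctness of the algorithm -/

namespace StackProg

open Code Atch

/-! #### The database -/

theorem zip_ofFn {n : ℕ} {β γ : Type} (f : Fin n → β) (g : Fin n → γ) :
    (List.ofFn f).zip (List.ofFn g) = List.ofFn fun i => (f i, g i) := by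
  apply List.ext_getElem <;> simp

theorem map_range_eq_ofFn {n : ℕ} {β : Type} (f : ℕ → β) :
    (List.range n).map f = List.ofFn fun i : Fin n => f i := by
  apply List.ext_getElem <;> simp

theorem edgeNames_eq (H : Hypergraph) :
    edgeNames H = List.ofFn fun e : Fin H.numE => (Sum.inr e.1 : Obj) := by
  unfold edgeNames edgeNodes
  rw [List.length_ofFn, map_range_eq_ofFn]

/-- The record of a hyperedge. -/
def edgeRec (H : Hypergraph) (e : Fin H.numE) : EdgeRec :=
  (Sum.inr e.1, (H.nodes e).map H.name, (H.edgeAttr e).map propD, H.validTime e, H.conf e)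

theorem mem_edgeRecs {H : Hypergraph} {r : EdgeRec} :
    r ∈ edgeRecs H ↔ ∃ e, edgeRec H e = r := by
  unfold edgeRecs
  rw [edgeNames_eq]
  unfold edgeNodes edgeProps validTimes confs
  rw [zip_ofFn, zip_ofFn, zip_ofFn, zip_ofFn, List.mem_ofFn']
  rfl

theorem mem_vertexRecs {H : Hypergraph} {r : Obj × List D} :
    r ∈ vertexRecs H ↔ ∃ v : Fin H.numV, (Sum.inl v.1, (H.vertexAttr v).map propD) = r := by
  unfold vertexRecs vertexProps
  rw [List.length_ofFn, map_range_eq_ofFn, zip_ofFn, List.mem_ofFn']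
  rfl

theorem mem_precPairs {H : Hypergraph} {p : Obj × Obj} : p ∈ precPairs H ↔
    ∃ e f : Fin H.numE, H.prec e f = true ∧ p = (Sum.inr e.1, Sum.inr f.1) := by
  unfold precPairs
  rw [edgeNames_eq]
  unfold precRows
  rw [zip_ofFn, List.mem_flatMap]
  constructor
  · rintro ⟨q, hq, hp⟩
    obtain ⟨e, rfl⟩ := (List.mem_ofFn' _ _).1 hq
    simp only [zip_ofFn] at hp
    obtain ⟨q, hq, rfl⟩ := List.mem_map.1 hp
    obtain ⟨hq, hb⟩ := List.mem_filter.1 hq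
    obtain ⟨f, rfl⟩ := (List.mem_ofFn' _ _).1 hq
    exact ⟨e, f, hb, rfl⟩
  · rintro ⟨e, f, h, rfl⟩
    refine ⟨_, (List.mem_ofFn' _ _).2 ⟨e, rfl⟩, ?_⟩
    simp only [zip_ofFn]
    exact List.mem_map.2 ⟨_, List.mem_filter.2 ⟨(List.mem_ofFn' _ _).2 ⟨f, rfl⟩, h⟩, rfl⟩

theorem sameLength_iff {β γ : Type} (l : List β) (k : List γ) :
    sameLength l k = true ↔ l.length = k.length := by
  unfold sameLength
  rw [decide_eq_true_eq]
  constructor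
  · intro h
    simpa using congrArg List.length h
  · intro h
    simp [h]

/-- An interval with an infinite end leaves every window, as the points built from `lo - 1` and `hi
+ 1` show; with two finite ends, non-emptiness puts both ends into the interval. Covering is decided
at the two ends of the window, and two intervals meet iff each begins before the other ends. -/
theorem windowTest_iff (r : RangePred) (I : Interval) (W : Window) :
    windowTest (relCode r) I W.lo W.hi = true ↔ r.Holds I W := by
  obtain ⟨l, u, hlu⟩ := I
  obtain ⟨lo, hi, hW⟩ := W
  cases r
  · simp only [windowTest, relCode, RangePred.Holds, Interval.points]
    obtain _ | a := l <;> obtain _ | b := u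
    · simp only [Option.toList_none, List.any_nil]
      simp only [Set.subset_def]
      simp
      refine ⟨lo - 1, by simp⟩
    · simp [Set.subset_def]
      exact ⟨min b (lo - 1), by simp, by simp⟩
    · simp [Set.subset_def]
      exact ⟨max a (hi + 1), by simp, by simp⟩
    · have hab : a ≤ b := hlu a rfl b rfl
      simp [Set.subset_def]
      constructor
      · exact fun h x h₁ h₂ => ⟨h.1.trans h₁, h₂.trans h.2⟩
      · exact fun h => ⟨(h a le_rfl hab).1, (h b hab le_rfl).2⟩
  · simp only [windowTest, relCode, RangePred.Holds, Interval.points]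
    have key : (∀ a ∈ l, a ≤ lo) ∧ (∀ b ∈ u, hi ≤ b) ↔
        Set.Icc lo hi ⊆ {t | (∀ a ∈ l, a ≤ t) ∧ (∀ b ∈ u, t ≤ b)} := by
      constructor
      · exact fun h t ht => ⟨fun a ha => (h.1 a ha).trans ht.1, fun b hb => ht.2.trans (h.2 b hb)⟩
      · exact fun h => ⟨(h ⟨le_rfl, hW⟩).1, (h ⟨hW, le_rfl⟩).2⟩
    rw [← key]
    simp
  · simp only [windowTest, relCode, RangePred.Holds, Interval.points]
    have key : (∀ a ∈ l, a ≤ hi) ∧ (∀ b ∈ u, lo ≤ b) ↔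
        ({t | (∀ a ∈ l, a ≤ t) ∧ (∀ b ∈ u, t ≤ b)} ∩ Set.Icc lo hi).Nonempty := by
      constructor
      · intro h
        obtain _ | a := l
        · obtain _ | b := u
          · exact ⟨lo, by simp, le_rfl, hW⟩
          · exact ⟨min b hi, by simp, le_min (h.2 b rfl) hW, min_le_right _ _⟩
        · refine ⟨max a lo, ⟨?_, fun b hb => max_le (hlu a rfl b hb) (h.2 b hb)⟩, le_max_right _ _,
            max_le (h.1 a rfl) hW⟩
          intro a' ha'
          obtain rfl : a = a' := by simpa using ha'
          exact le_max_left _ _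
      · rintro ⟨t, ⟨h₁, h₂⟩, h₃, h₄⟩
        exact ⟨fun a ha => (h₁ a ha).trans h₄, fun b hb => h₃.trans (h₂ b hb)⟩
    rw [← key]
    simp

/-! #### Systems of equations -/

/-- A valuation solves a system of equations. -/
def Sat (ν : ℕ → Obj) (m : Eqs) : Prop := ∀ p ∈ m, p.1.val ν = p.2

/-- The variables of a system of equations. -/
def eqVars (m : Eqs) : Finset ℕ := termVars (m.map Prod.fst)

theorem mem_eqVars {m : Eqs} {x : ℕ} : x ∈ eqVars m ↔ ∃ o, (Term.var x, o) ∈ m := by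
  simp [eqVars, mem_termVars]

theorem sat_zip (ν : ℕ → Obj) : ∀ (ts : List Term) (os : List Obj), ts.length = os.length →
    (Sat ν (ts.zip os) ↔ ts.map (Term.val ν) = os)
  | [], [], _ => by simp [Sat]
  | t :: ts, o :: os, h => by
    have := sat_zip ν ts os (by simpa using h)
    simp only [Sat, List.zip_cons_cons, List.forall_mem_cons, List.map_cons, List.cons.injEq]
      at this ⊢
    rw [this]

theorem sat_cons (ν : ℕ → Obj) (p : Term × Obj) (m : Eqs) :
    Sat ν (p :: m) ↔ p.1.val ν = p.2 ∧ Sat ν m := List.forall_mem_cons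

theorem sat_singleton (ν : ℕ → Obj) (p : Term × Obj) : Sat ν [p] ↔ p.1.val ν = p.2 := by
  simp [Sat]

theorem compat_iff (m m' : Eqs) :
    compat m m' = true ↔ ∀ p ∈ m, ∀ q ∈ m', p.1 = q.1 → p.2 = q.2 := by
  have h (p q : Term × Obj) : (bif decide (p.1 = q.1) then decide (p.2 = q.2) else true) = true ↔
      (p.1 = q.1 → p.2 = q.2) := by
    by_cases h : p.1 = q.1 <;> simp [h]
  unfold compat
  simp only [List.all_eq_true, h]

theorem solvable_iff (m : Eqs) : solvable m = true ↔
    (∀ p ∈ m, ∀ q ∈ m, p.1 = q.1 → p.2 = q.2) ∧ ∀ o o', (Term.const o, o') ∈ m → o = o' := by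
  unfold solvable
  rw [Bool.and_eq_true, compat_iff, List.all_eq_true]
  refine and_congr_right fun _ => ⟨fun h o o' ho => ?_, fun h => ?_⟩
  · simpa [isVar] using h _ ho
  · rintro ⟨x | o, o'⟩ hp
    · simp [isVar]
    · simpa [isVar] using h o o' hp

theorem Sat.compat {ν : ℕ → Obj} {m m' : Eqs} (h : Sat ν m) (h' : Sat ν m') :
    compat m m' = true :=
  (compat_iff _ _).2 fun p hp q hq e => by rw [← h p hp, ← h' q hq, e]

theorem Sat.solvable {ν : ℕ → Obj} {m : Eqs} (h : Sat ν m) : solvable m = true :=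
  (solvable_iff _).2 ⟨(compat_iff _ _).1 (h.compat h), fun _ _ ho => h _ ho⟩

/-- A valuation can be changed into a solution of a solvable system. -/
theorem exists_override (ν : ℕ → Obj) {m : Eqs} (hm : solvable m = true) :
    ∃ ν', Sat ν' m ∧ ∀ x ∉ eqVars m, ν' x = ν x := by
  classical
  obtain ⟨h₁, h₂⟩ := (solvable_iff m).1 hm
  refine ⟨fun x => if h : ∃ o, (Term.var x, o) ∈ m then h.choose else ν x, ?_, ?_⟩
  · rintro ⟨x | o, o'⟩ hp
    · have h : ∃ o, (Term.var x, o) ∈ m := ⟨o', hp⟩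
      simp only [Term.val, h, dif_pos]
      exact h₁ _ h.choose_spec _ hp rfl
    · exact h₂ o o' hp
  · intro x hx
    rw [mem_eqVars] at hx
    simp only [hx, dif_neg, not_false_eq_true]

theorem mem_objects_inl (H : Hypergraph) (v : Fin H.numV) : (Sum.inl v.1 : Obj) ∈ H.objects :=
  ⟨.inl v, rfl⟩

theorem mem_objects_inr (H : Hypergraph) (e : Fin H.numE) : (Sum.inr e.1 : Obj) ∈ H.objects :=
  ⟨.inr e, rfl⟩

theorem mem_propD {p : Property} {l : List Property} : propD p ∈ l.map propD ↔ p ∈ l :=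
  List.mem_map_of_injective propD_injective

/-! #### Atoms -/

section Atoms

variable (H : Hypergraph)

theorem atomEqs_hyperedge (z : Term) (ts : List Term) (m : Eqs) :
    m ∈ atomEqs H (.hyperedge z ts) ↔ ∃ e, ts.length = (H.nodes e).length ∧
      (z, Sum.inr e.1) :: ts.zip ((H.nodes e).map H.name) = m := by
  have : atomEqs H (.hyperedge z ts) = ((edgeRecs H).filter fun r => sameLength ts r.2.1).map
    fun r => (z, r.1) :: ts.zip r.2.1 := rfl
  rw [this, List.mem_map]
  simp only [List.mem_filter, mem_edgeRecs, sameLength_iff]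
  constructor
  · rintro ⟨_, ⟨⟨e, rfl⟩, h⟩, rfl⟩
    exact ⟨e, by simpa [edgeRec] using h, rfl⟩
  · rintro ⟨e, h, rfl⟩
    exact ⟨_, ⟨⟨e, rfl⟩, by simpa [edgeRec] using h⟩, rfl⟩

theorem atomEqs_participant (t z : Term) (m : Eqs) :
    m ∈ atomEqs H (.participant t z) ↔ ∃ e, ∃ o ∈ H.nodes e,
      [(t, H.name o), (z, Sum.inr e.1)] = m := by
  have : atomEqs H (.participant t z) = (edgeRecs H).flatMap fun r => r.2.1.map fun o =>
      [(t, o), (z, r.1)] := rfl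
  rw [this, List.mem_flatMap]
  simp only [mem_edgeRecs, List.mem_map]
  constructor
  · rintro ⟨_, ⟨e, rfl⟩, o, ho, rfl⟩
    obtain ⟨o', ho', rfl⟩ := List.mem_map.1 ho
    exact ⟨e, o', ho', rfl⟩
  · rintro ⟨e, o, ho, rfl⟩
    exact ⟨_, ⟨e, rfl⟩, _, List.mem_map.2 ⟨o, ho, rfl⟩, rfl⟩

theorem atomEqs_vertexAttr (t : Term) (p : Property) (m : Eqs) :
    m ∈ atomEqs H (.vertexAttr t p) ↔ ∃ v : Fin H.numV, p ∈ H.vertexAttr v ∧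
      [(t, Sum.inl v.1)] = m := by
  have : atomEqs H (.vertexAttr t p) = ((vertexRecs H).filter fun r =>
      decide (propD p ∈ r.2)).map fun r => [(t, r.1)] := rfl
  rw [this, List.mem_map]
  simp only [List.mem_filter, mem_vertexRecs, decide_eq_true_eq]
  constructor
  · rintro ⟨_, ⟨⟨v, rfl⟩, h⟩, rfl⟩
    exact ⟨v, mem_propD.1 h, rfl⟩
  · rintro ⟨v, h, rfl⟩
    exact ⟨_, ⟨⟨v, rfl⟩, mem_propD.2 h⟩, rfl⟩

/-- Common to the four kinds of atoms that test a single hyperedge. -/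
theorem mem_map_filter_edgeRecs {a : Atom} {z : Term} {P : Fin H.numE → Prop}
    (hP : ∀ e, edgeTest a (edgeRec H e) = true ↔ P e) (m : Eqs) :
    m ∈ ((edgeRecs H).filter fun r => edgeTest a r).map (fun r => [(z, r.1)]) ↔
      ∃ e, P e ∧ [(z, Sum.inr e.1)] = m := by
  rw [List.mem_map]
  simp only [List.mem_filter, mem_edgeRecs]
  constructor
  · rintro ⟨_, ⟨⟨e, rfl⟩, h⟩, rfl⟩
    exact ⟨e, (hP e).1 h, rfl⟩
  · rintro ⟨e, h, rfl⟩
    exact ⟨_, ⟨⟨e, rfl⟩, (hP e).2 h⟩, rfl⟩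

theorem atomEqs_edgeAttr (z : Term) (p : Property) (m : Eqs) :
    m ∈ atomEqs H (.edgeAttr z p) ↔ ∃ e : Fin H.numE, p ∈ H.edgeAttr e ∧
      [(z, Sum.inr e.1)] = m :=
  mem_map_filter_edgeRecs H (a := .edgeAttr z p) (fun e => by
    change decide (propD p ∈ (H.edgeAttr e).map propD) = true ↔ _
    rw [decide_eq_true_eq, mem_propD]) m

theorem atomEqs_window (z : Term) (r : RangePred) (W : Window) (m : Eqs) :
    m ∈ atomEqs H (.window z r W) ↔ ∃ e : Fin H.numE, r.Holds (H.validTime e) W ∧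
      [(z, Sum.inr e.1)] = m :=
  mem_map_filter_edgeRecs H (a := .window z r W) (fun _ => windowTest_iff _ _ _) m

theorem atomEqs_confGe (z : Term) (θ : ℚ) (m : Eqs) :
    m ∈ atomEqs H (.confGe z θ) ↔ ∃ e : Fin H.numE, θ ≤ H.conf e ∧ [(z, Sum.inr e.1)] = m :=
  mem_map_filter_edgeRecs H (a := .confGe z θ) (fun e => by
    change decide (θ ≤ H.conf e) = true ↔ _
    rw [decide_eq_true_eq]) m

theorem atomEqs_confGt (z : Term) (θ : ℚ) (m : Eqs) :
    m ∈ atomEqs H (.confGt z θ) ↔ ∃ e : Fin H.numE, θ < H.conf e ∧ [(z, Sum.inr e.1)] = m :=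
  mem_map_filter_edgeRecs H (a := .confGt z θ) (fun e => by
    change (!decide (H.conf e ≤ θ)) = true ↔ _
    simp) m

theorem atom_holds_iff (ν : ℕ → Obj) (a : Atom) :
    a.Holds H ν ↔ ∃ m ∈ atomEqs H a, Sat ν m := by
  cases a with
  | hyperedge z ts =>
    simp only [Atom.Holds, atomEqs_hyperedge]
    constructor
    · rintro ⟨e, hz, hts⟩
      have hl : ts.length = (H.nodes e).length := by simpa using congrArg List.length hts
      exact ⟨_, ⟨e, hl, rfl⟩, (sat_cons _ _ _).2 ⟨hz, (sat_zip _ _ _ (by simpa using hl)).2 hts⟩⟩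
    · rintro ⟨_, ⟨e, hl, rfl⟩, h⟩
      obtain ⟨hz, h⟩ := (sat_cons _ _ _).1 h
      exact ⟨e, hz, (sat_zip _ _ _ (by simpa using hl)).1 h⟩
  | participant t z =>
    simp only [Atom.Holds, atomEqs_participant]
    constructor
    · rintro ⟨e, hz, o, ho, ht⟩
      exact ⟨_, ⟨e, o, ho, rfl⟩, (sat_cons _ _ _).2 ⟨ht, (sat_singleton _ _).2 hz⟩⟩
    · rintro ⟨_, ⟨e, o, ho, rfl⟩, h⟩
      obtain ⟨ht, h⟩ := (sat_cons _ _ _).1 h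
      exact ⟨e, (sat_singleton _ _).1 h, o, ho, ht⟩
  | vertexAttr t p =>
    simp only [Atom.Holds, atomEqs_vertexAttr]
    constructor
    · rintro ⟨v, h, hp⟩
      exact ⟨_, ⟨v, hp, rfl⟩, (sat_singleton _ _).2 h⟩
    · rintro ⟨_, ⟨v, hp, rfl⟩, h⟩
      exact ⟨v, (sat_singleton _ _).1 h, hp⟩
  | edgeAttr z p =>
    simp only [Atom.Holds, atomEqs_edgeAttr]
    constructor
    · rintro ⟨v, h, hp⟩
      exact ⟨_, ⟨v, hp, rfl⟩, (sat_singleton _ _).2 h⟩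
    · rintro ⟨_, ⟨v, hp, rfl⟩, h⟩
      exact ⟨v, (sat_singleton _ _).1 h, hp⟩
  | window z r W =>
    simp only [Atom.Holds, atomEqs_window]
    constructor
    · rintro ⟨v, h, hp⟩
      exact ⟨_, ⟨v, hp, rfl⟩, (sat_singleton _ _).2 h⟩
    · rintro ⟨_, ⟨v, hp, rfl⟩, h⟩
      exact ⟨v, (sat_singleton _ _).1 h, hp⟩
  | confGe z θ =>
    simp only [Atom.Holds, atomEqs_confGe]
    constructor
    · rintro ⟨v, h, hp⟩
      exact ⟨_, ⟨v, hp, rfl⟩, (sat_singleton _ _).2 h⟩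
    · rintro ⟨_, ⟨v, hp, rfl⟩, h⟩
      exact ⟨v, (sat_singleton _ _).1 h, hp⟩
  | confGt z θ =>
    simp only [Atom.Holds, atomEqs_confGt]
    constructor
    · rintro ⟨v, h, hp⟩
      exact ⟨_, ⟨v, hp, rfl⟩, (sat_singleton _ _).2 h⟩
    · rintro ⟨_, ⟨v, hp, rfl⟩, h⟩
      exact ⟨v, (sat_singleton _ _).1 h, hp⟩

theorem atom_vars (a : Atom) : termVars (atomTerm a :: atomTerms a) = a.vars := by
  cases a <;> simp [atomTerm, atomTerms, Atom.vars, termVars]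

/-- The first part makes the systems of an atom a relation over its variable set, as the acyclic
join requires; the second keeps the values of solutions inside the hypergraph. -/
theorem eqVars_of_mem_atomEqs {a : Atom} {m : Eqs} (h : m ∈ atomEqs H a) :
    eqVars m = a.vars ∧ ∀ p ∈ m, p.2 ∈ H.objects := by
  rw [← atom_vars]
  cases a with
  | hyperedge z ts =>
    obtain ⟨e, hl, rfl⟩ := (atomEqs_hyperedge _ _ _ _).1 h
    constructor
    · simp [eqVars, atomTerm, atomTerms, List.map_fst_zip (l₁ := ts)
        (l₂ := (H.nodes e).map H.name) (by simp [hl])]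
    · rw [List.forall_mem_cons]
      refine ⟨mem_objects_inr H e, fun p hp => ?_⟩
      obtain ⟨o, -, ho⟩ := List.mem_map.1 (List.of_mem_zip hp).2
      exact ⟨o, ho⟩
  | participant t z =>
    obtain ⟨e, o, ho, rfl⟩ := (atomEqs_participant _ _ _ _).1 h
    refine ⟨rfl, ?_⟩
    rw [List.forall_mem_cons, List.forall_mem_singleton]
    exact ⟨⟨o, rfl⟩, mem_objects_inr H e⟩
  | vertexAttr t p =>
    obtain ⟨v, -, rfl⟩ := (atomEqs_vertexAttr _ _ _ _).1 h
    exact ⟨rfl, List.forall_mem_singleton.2 (mem_objects_inl H v)⟩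
  | edgeAttr z p =>
    obtain ⟨e, -, rfl⟩ := (atomEqs_edgeAttr _ _ _ _).1 h
    exact ⟨rfl, List.forall_mem_singleton.2 (mem_objects_inr H e)⟩
  | window z r W =>
    obtain ⟨e, -, rfl⟩ := (atomEqs_window _ _ _ _ _).1 h
    exact ⟨rfl, List.forall_mem_singleton.2 (mem_objects_inr H e)⟩
  | confGe z θ =>
    obtain ⟨e, -, rfl⟩ := (atomEqs_confGe _ _ _ _).1 h
    exact ⟨rfl, List.forall_mem_singleton.2 (mem_objects_inr H e)⟩
  | confGt z θ =>
    obtain ⟨e, -, rfl⟩ := (atomEqs_confGt _ _ _ _).1 h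
    exact ⟨rfl, List.forall_mem_singleton.2 (mem_objects_inr H e)⟩

end Atoms

/-! #### Chains -/

theorem mem_listsUpTo {l : List Obj} {k : ℕ} {m : List Obj} :
    m ∈ listsUpTo l k ↔ m.length ≤ k ∧ ∀ o ∈ m, o ∈ l := by
  induction k generalizing m with
  | zero => simp [listsUpTo]; rintro rfl; simp
  | succ k ih =>
    simp only [listsUpTo, List.mem_cons, List.mem_flatMap, List.mem_map, ih]
    constructor
    · rintro (rfl | ⟨m, ⟨h₁, h₂⟩, o, ho, rfl⟩)
      · simp
      · refine ⟨by simpa using h₁, ?_⟩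
        exact List.forall_mem_cons.2 ⟨ho, h₂⟩
    · rintro ⟨h₁, h₂⟩
      obtain _ | ⟨o, m⟩ := m
      · simp
      · exact .inr ⟨m, ⟨by simpa using h₁, fun o ho => h₂ o (by simp [ho])⟩, o, h₂ o (by simp), rfl⟩

theorem isChain_iff_zip_tail {β : Type} {R : β → β → Prop} (l : List β) :
    l.IsChain R ↔ ∀ p ∈ l.zip l.tail, R p.1 p.2 := by
  induction l with
  | nil => simp
  | cons a l ih =>
    cases l with
    | nil => simp
    | cons b l =>
      rw [List.isChain_cons_cons, ih]
      simp only [List.tail_cons, List.zip_cons_cons, List.forall_mem_cons]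

theorem mem_chainEqs {d : ℕ} {H : Hypergraph} {zs : List Term} {m : Eqs} :
    m ∈ chainEqs d H zs ↔ ∃ es : List (Fin H.numE), es.length ≤ d + 1 ∧ zs.length = es.length ∧
      es.IsChain (fun e f => H.prec e f = true) ∧
      zs.zip (es.map fun e => H.name (.inr e)) = m := by
  unfold chainEqs
  rw [List.mem_map]
  simp only [List.mem_filter, mem_listsUpTo, Bool.and_eq_true, sameLength_iff, List.all_eq_true,
    List.any_eq_true, decide_eq_true_eq, exists_eq_right', mem_precPairs]
  constructor
  · rintro ⟨os, ⟨⟨h₁, h₂⟩, h₃, h₄⟩, rfl⟩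
    obtain ⟨es, rfl⟩ : ∃ es : List (Fin H.numE), es.map (fun e => H.name (.inr e)) = os := by
      clear h₁ h₃ h₄
      induction os with
      | nil => exact ⟨[], rfl⟩
      | cons o os ih =>
        obtain ⟨es, rfl⟩ := ih fun o ho => h₂ o (by simp [ho])
        have := h₂ o (by simp)
        rw [edgeNames_eq, List.mem_ofFn'] at this
        obtain ⟨e, rfl⟩ := this
        exact ⟨e :: es, rfl⟩
    refine ⟨es, by simpa using h₁, by simpa using h₃, ?_, rfl⟩
    rw [isChain_iff_zip_tail]
    rintro ⟨e, f⟩ hp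
    have hp' : (H.name (.inr e), H.name (.inr f)) ∈ (es.map fun e => H.name (.inr e)).zip
        (es.map fun e => H.name (.inr e)).tail := by
      rw [← List.map_tail, List.zip_map]
      exact List.mem_map.2 ⟨(e, f), hp, rfl⟩
    obtain ⟨e', f', h, he⟩ := h₄ _ hp'
    simp only [Hypergraph.name, Sum.map_inr, Prod.mk.injEq, Sum.inr.injEq] at he
    rwa [Fin.ext he.1, Fin.ext he.2]
  · rintro ⟨es, h₁, h₂, h₃, rfl⟩
    refine ⟨_, ⟨⟨by simpa using h₁, ?_⟩, by simpa using h₂, ?_⟩, rfl⟩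
    · intro o ho
      obtain ⟨e, -, rfl⟩ := List.mem_map.1 ho
      rw [edgeNames_eq, List.mem_ofFn']
      exact ⟨e, rfl⟩
    · intro p hp
      rw [← List.map_tail, List.zip_map] at hp
      obtain ⟨⟨e, f⟩, hq, rfl⟩ := List.mem_map.1 hp
      exact ⟨e, f, (isChain_iff_zip_tail es).1 h₃ _ hq, rfl⟩

/-- The depth bound makes the enumeration of lists of at most `d + 1` hyperedges exhaustive. -/
theorem chain_holds_iff {d : ℕ} {H : Hypergraph} {zs : List Term} (hd : zs.length ≤ d + 1)
    (ν : ℕ → Obj) : ChainHolds H ν zs ↔ ∃ m ∈ chainEqs d H zs, Sat ν m := by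
  simp only [mem_chainEqs, ChainHolds]
  constructor
  · rintro ⟨es, h₁, h₂⟩
    have hl : zs.length = es.length := by simpa using congrArg List.length h₁
    exact ⟨_, ⟨es, hl ▸ hd, hl, h₂, rfl⟩, (sat_zip _ _ _ (by simpa using hl)).2 h₁⟩
  · rintro ⟨_, ⟨es, -, hl, h₂, rfl⟩, h⟩
    exact ⟨es, (sat_zip _ _ _ (by simpa using hl)).1 h, h₂⟩

theorem eqVars_of_mem_chainEqs {d : ℕ} {H : Hypergraph} {zs : List Term} {m : Eqs}
    (h : m ∈ chainEqs d H zs) : eqVars m = termVars zs ∧ ∀ p ∈ m, p.2 ∈ H.objects := by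
  obtain ⟨es, -, hl, -, rfl⟩ := mem_chainEqs.1 h
  constructor
  · rw [eqVars, List.map_fst_zip (by simp [hl])]
  · intro p hp
    obtain ⟨e, -, he⟩ := List.mem_map.1 (List.of_mem_zip hp).2
    exact ⟨_, he⟩

end StackProg

/-! ### Correctness of the algorithm -/

namespace StackProg

open Code Atch

/-! #### Pairwise consistency -/

theorem Sat.congr {ν ν' : ℕ → Obj} {m : Eqs} (h : Sat ν m) (hν : ∀ x ∈ eqVars m, ν' x = ν x) :
    Sat ν' m := by
  rintro ⟨x | o, o'⟩ hp
  · exact (hν x (mem_eqVars.2 ⟨o', hp⟩)).trans (h _ hp)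
  · exact h _ hp

theorem Sat.apply_eq {ν ν' : ℕ → Obj} {m m' : Eqs} (h : Sat ν m) (h' : Sat ν' m')
    (hc : StackProg.compat m' m = true) {x : ℕ} (hx : x ∈ eqVars m) (hx' : x ∈ eqVars m') : ν' x = ν x := by
  obtain ⟨o, ho⟩ := mem_eqVars.1 hx
  obtain ⟨o', ho'⟩ := mem_eqVars.1 hx'
  have h₁ : ν x = o := h _ ho
  have h₂ : ν' x = o' := h' _ ho'
  rw [h₁, h₂]
  exact (compat_iff _ _).1 hc _ ho' _ ho rfl

/-- Pruning acts position by position, so each relation stays attached to its index in `L` and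
thereby to its variable set. -/
theorem exists_map_eq_iterate_prune {ι : Type} (L : List ι) (f : ι → List Eqs) (n : ℕ) :
    ∃ g : ι → List Eqs, prune^[n] (L.map f) = L.map g ∧ ∀ i, ∀ m ∈ g i, m ∈ f i := by
  induction n with
  | zero => exact ⟨f, rfl, fun _ _ h => h⟩
  | succ n ih =>
    obtain ⟨g, hg, hgf⟩ := ih
    rw [Function.iterate_succ_apply', hg]
    unfold prune
    rw [List.map_map]
    exact ⟨_, rfl, fun i m hm => hgf i m (List.mem_filter.1 hm).1⟩

theorem prune_eq_self_or_lt (Rs : List (List Eqs)) :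
    prune Rs = Rs ∨ (prune Rs).flatten.length < Rs.flatten.length := by
  have h : (prune Rs).flatten = Rs.flatten.filter fun m => Rs.all fun R' => R'.any fun m' =>
      compat m m' := by
    rw [List.filter_flatten]
    rfl
  rw [or_iff_not_imp_right, not_lt]
  intro hle
  have hall := List.length_filter_eq_length_iff.1
    (le_antisymm (List.length_filter_le _ _) (h ▸ hle))
  unfold prune
  conv_rhs => rw [← List.map_id Rs]
  refine List.map_congr_left fun R hR => List.filter_eq_self.2 fun m hm => ?_
  exact hall m (List.mem_flatten.2 ⟨R, hR, hm⟩)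

/-- A round that changes anything deletes a system, so the number of systems bounds the number of
rounds until a fixed point. -/
theorem prune_iterate_eq (n : ℕ) (Rs : List (List Eqs)) (hn : Rs.flatten.length ≤ n) :
    prune (prune^[n] Rs) = prune^[n] Rs := by
  induction n generalizing Rs with
  | zero =>
    refine (prune_eq_self_or_lt Rs).resolve_right fun h => ?_
    omega
  | succ n ih =>
    rw [Function.iterate_succ_apply]
    obtain h | h := prune_eq_self_or_lt Rs
    · rw [h, Function.iterate_fixed h, h]
    · exact ih _ (by omega)

/-- Systems solved by one valuation are pairwise compatible, so they are partners of each other and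
are never deleted. -/
theorem consistent_of_sat {Rs : List (List Eqs)} {ν : ℕ → Obj}
    (h : ∀ R ∈ Rs, ∃ m ∈ R, Sat ν m) : consistent Rs = true := by
  have key (n : ℕ) : ∀ R ∈ prune^[n] Rs, ∃ m ∈ R, Sat ν m := by
    induction n with
    | zero => exact h
    | succ n ih =>
      rw [Function.iterate_succ_apply']
      intro R hR
      obtain ⟨R, hR', rfl⟩ := List.mem_map.1 hR
      obtain ⟨m, hm, hs⟩ := ih R hR'
      refine ⟨m, List.mem_filter.2 ⟨hm, ?_⟩, hs⟩
      simp only [List.all_eq_true, List.any_eq_true]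
      intro R' hR'
      obtain ⟨m', hm', hs'⟩ := ih R' hR'
      exact ⟨m', hm', hs.compat hs'⟩
  unfold consistent
  simp only [List.all_eq_true]
  intro R hR
  obtain ⟨m, hm, -⟩ := key _ R hR
  cases R with
  | nil => simp at hm
  | cons => rfl

/-- On an acyclic family, non-empty pairwise consistent relations have a common solution. -/
theorem Acyc.exists_sat {ι : Type} {M : Multiset (Finset ℕ)} (hM : Acyc M) (vars : ι → Finset ℕ)
    (rel : ι → List Eqs) : ∀ (P : Multiset ι), P.map vars = M →
    (∀ p ∈ P, ∀ m ∈ rel p, solvable m = true ∧ eqVars m = vars p) → (∀ p ∈ P, rel p ≠ []) →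
    (∀ p ∈ P, ∀ q ∈ P, ∀ m ∈ rel p, ∃ m' ∈ rel q, compat m m' = true) →
    ∃ ν, ∀ p ∈ P, ∃ m ∈ rel p, Sat ν m := by
  classical
  induction hM with
  | zero =>
    intro P hP _ _ _
    obtain rfl := Multiset.map_eq_zero.1 hP
    exact ⟨fun _ => .inl 0, by simp⟩
  | @cons e F he hF ih =>
    intro P hP hvars hne hcomp
    obtain ⟨a, haP, rfl, hF'⟩ := (Multiset.map_eq_cons vars P F e).2 hP
    have hsub : ∀ p ∈ P.erase a, p ∈ P := fun p hp => Multiset.mem_of_mem_erase hp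
    obtain ⟨ν, hν⟩ := ih (P.erase a) hF' (fun p hp => hvars p (hsub p hp))
      (fun p hp => hne p (hsub p hp)) fun p hp q hq => hcomp p (hsub p hp) q (hsub q hq)
    suffices h : ∃ m ∈ rel a, ∃ ν', Sat ν' m ∧ ∀ p ∈ P.erase a, ∃ m' ∈ rel p, Sat ν' m' by
      obtain ⟨m, hm, ν', hs, h⟩ := h
      refine ⟨ν', fun p hp => ?_⟩
      rw [← Multiset.cons_erase haP, Multiset.mem_cons] at hp
      obtain rfl | hp := hp
      · exact ⟨m, hm, hs⟩
      · exact h p hp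
    obtain h0 | ⟨f, hf, hear⟩ := he
    · obtain ⟨m, hm⟩ := List.exists_mem_of_ne_nil _ (hne a haP)
      obtain ⟨ν', hs, -⟩ := exists_override ν (hvars a haP m hm).1
      rw [h0, Multiset.map_eq_zero] at hF'
      exact ⟨m, hm, ν', hs, by simp [hF']⟩
    · rw [← hF', Multiset.mem_map] at hf
      obtain ⟨q, hq, rfl⟩ := hf
      -- All variables that the ear shares with other members lie in `vars q`. A partner `m` of the
      -- system chosen at `q` therefore agrees with `ν` on them, and overriding `ν` by `m` does not
      -- disturb the other members.
      obtain ⟨mq, hmq, hsq⟩ := hν q hq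
      obtain ⟨m, hm, hc⟩ := hcomp q (hsub q hq) a haP mq hmq
      obtain ⟨hsol, hva⟩ := hvars a haP m hm
      obtain ⟨ν', hs, hν'⟩ := exists_override ν hsol
      refine ⟨m, hm, ν', hs, fun p hp => ?_⟩
      obtain ⟨mp, hmp, hsp⟩ := hν p hp
      refine ⟨mp, hmp, hsp.congr fun x hx => ?_⟩
      by_cases hxm : x ∈ eqVars m
      · have hxq : x ∈ eqVars mq := by
          rw [(hvars q (hsub q hq) mq hmq).2]
          refine hear (vars p) (hF' ▸ Multiset.mem_map_of_mem _ hp) (Finset.mem_inter.2 ⟨?_, ?_⟩)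
          · rwa [← hva]
          · rwa [← (hvars p (hsub p hp) mp hmp).2]
        exact (hs.apply_eq hsq hc hxm hxq).symm
      · exact hν' x hxm

/-- At a fixed point of pruning each remaining system has a partner in each relation, which is the
hypothesis of `Acyc.exists_sat`. -/
theorem exists_sat_of_consistent (L : List (Finset ℕ × List Eqs))
    (hL : Acyc ↑(L.map Prod.fst)) (hv : ∀ p ∈ L, ∀ m ∈ p.2, solvable m = true ∧ eqVars m = p.1)
    (hc : consistent (L.map Prod.snd) = true) : ∃ ν, ∀ p ∈ L, ∃ m ∈ p.2, Sat ν m := by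
  obtain ⟨g, hg, hsub⟩ := exists_map_eq_iterate_prune L Prod.snd (L.map Prod.snd).flatten.length
  have hfix := prune_iterate_eq _ (L.map Prod.snd) le_rfl
  unfold consistent at hc
  rw [hg] at hfix hc
  obtain ⟨ν, hν⟩ := hL.exists_sat Prod.fst g (L : Multiset (Finset ℕ × List Eqs)) rfl
    (fun p hp m hm => hv p hp m (hsub p m hm))
    (fun p hp h => by
      have := List.all_eq_true.1 hc _ (List.mem_map.2 ⟨p, hp, rfl⟩)
      simp [h] at this)
    (fun p hp q hq m hm => by
      unfold prune at hfix
      rw [List.map_map] at hfix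
      have h := List.map_inj_left.1 hfix p hp
      have := List.filter_eq_self.1 h m hm
      simp only [List.all_eq_true, List.any_eq_true] at this
      exact this _ (List.mem_map.2 ⟨q, hq, rfl⟩))
  refine ⟨ν, fun p hp => ?_⟩
  obtain ⟨m, hm, hs⟩ := hν p hp
  exact ⟨m, hsub p m hm, hs⟩

/-! #### The choice of the free chains -/

theorem perm_of_mem_splits {β : Type} {c : ℕ} {l : List β} {p : List β × List β}
    (h : p ∈ splits c l) : l.Perm (p.1 ++ p.2) ∧ p.1.length ≤ c := by
  induction c generalizing p with
  | zero =>
    obtain rfl := List.mem_singleton.1 h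
    exact ⟨.rfl, le_rfl⟩
  | succ c ih =>
    simp only [splits, List.mem_append, List.mem_flatMap, List.mem_map] at h
    obtain h | ⟨q, hq, r, hr, rfl⟩ := h
    · exact ⟨(ih h).1, (ih h).2.trans (Nat.le_succ c)⟩
    · obtain ⟨h₁, h₂⟩ := ih hq
      refine ⟨?_, by simpa using h₂⟩
      refine h₁.trans (((perm_of_mem_picks hr).1.append_left q.1).trans ?_)
      exact List.perm_middle

/-- Induction on `c`: a split with `b` free comes from one in which `b` is still tied, by picking it
out. The order of the entries is not controlled. -/
theorem exists_mem_splits {β : Type} {c : ℕ} {l free tied : List β} (h : l.Perm (free ++ tied))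
    (hc : free.length ≤ c) :
    ∃ p ∈ splits c l, p.1.Perm free ∧ p.2.Perm tied := by
  induction c generalizing free tied with
  | zero =>
    obtain rfl := List.length_eq_zero_iff.1 (Nat.le_zero.1 hc)
    exact ⟨_, List.mem_singleton.2 rfl, .rfl, h⟩
  | succ c ih =>
    cases free with
    | nil =>
      obtain ⟨p, hp, h'⟩ := ih (free := []) h (by simp)
      exact ⟨p, List.mem_append_left _ hp, h'⟩
    | cons b free =>
      obtain ⟨p, hp, h₁, h₂⟩ := ih (free := free) (tied := b :: tied)
        (h.trans List.perm_middle.symm) (by simpa using hc)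
      obtain ⟨k, hk⟩ := exists_mem_picks (h₂.mem_iff.2 (List.mem_cons_self (a := b) (l := tied)))
      refine ⟨(b :: p.1, k), List.mem_append_right _ (List.mem_flatMap.2 ⟨p, hp,
        List.mem_map.2 ⟨_, hk, rfl⟩⟩), h₁.cons b, ?_⟩
      exact ((perm_of_mem_picks hk).1.symm.trans h₂).cons_inv

theorem Sat.append_iff {ν : ℕ → Obj} {m m' : Eqs} : Sat ν (m ++ m') ↔ Sat ν m ∧ Sat ν m' :=
  List.forall_mem_append

/-- With at most `c` free chains this says that none is left untreated. -/
theorem length_of_mem_choices {d : ℕ} {H : Hypergraph} {m : Eqs} {c : ℕ}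
    {free : List (List Term)} {p : Eqs × List (List Term)} (h : p ∈ choices d H m c free) :
    p.2.length = free.length - c := by
  induction c generalizing p with
  | zero =>
    obtain rfl := List.mem_singleton.1 h
    rfl
  | succ c ih =>
    simp only [choices, List.mem_flatMap] at h
    obtain ⟨⟨mq, zss⟩, hq, hp⟩ := h
    have := ih hq
    cases zss with
    | nil =>
      obtain rfl : p = (mq, []) := by simpa [listCase] using hp
      simp only [List.length_nil] at this ⊢
      omega
    | cons zs rest =>
      obtain ⟨m', -, rfl⟩ := List.mem_map.1 (show p ∈ (chainEqs d H zs).map _ from hp)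
      simp only [List.length_cons] at this ⊢
      omega

/-- Each round moves one chain from the list into the system; solving an appended system is solving
both parts, so the total demand on `ν` is unchanged. -/
theorem exists_mem_choices_iff {d : ℕ} {H : Hypergraph} {m : Eqs} (c : ℕ)
    {free : List (List Term)} {ν : ℕ → Obj} :
    (∃ p ∈ choices d H m c free, Sat ν p.1 ∧ ∀ zs ∈ p.2, ∃ m' ∈ chainEqs d H zs, Sat ν m') ↔
      Sat ν m ∧ ∀ zs ∈ free, ∃ m' ∈ chainEqs d H zs, Sat ν m' := by
  induction c with
  | zero => simp [choices]
  | succ c ih =>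
    rw [← ih]
    simp only [choices, List.mem_flatMap]
    constructor
    · rintro ⟨p, ⟨⟨mq, zss⟩, hq, hp⟩, h₁, h₂⟩
      refine ⟨_, hq, ?_⟩
      cases zss with
      | nil =>
        obtain rfl : p = (mq, []) := by simpa [listCase] using hp
        exact ⟨h₁, h₂⟩
      | cons zs rest =>
        obtain ⟨m', hm', rfl⟩ := List.mem_map.1 (show p ∈ (chainEqs d H zs).map _ from hp)
        obtain ⟨h₃, h₄⟩ := Sat.append_iff.1 h₁
        exact ⟨h₄, List.forall_mem_cons.2 ⟨⟨m', hm', h₃⟩, h₂⟩⟩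
    · rintro ⟨⟨mq, zss⟩, hq, h₁, h₂⟩
      cases zss with
      | nil => exact ⟨_, ⟨_, hq, List.mem_singleton.2 rfl⟩, h₁, h₂⟩
      | cons zs rest =>
        obtain ⟨⟨m', hm', h₃⟩, h₄⟩ := List.forall_mem_cons.1 h₂
        exact ⟨_, ⟨_, hq, List.mem_map.2 ⟨m', hm', rfl⟩⟩, Sat.append_iff.2 ⟨h₃, h₁⟩, h₄⟩

/-! #### Matches -/

theorem mem_foldr_union {β : Type} (f : β → Finset ℕ) (l : List β) (x : ℕ) :
    x ∈ l.foldr (fun b s => f b ∪ s) ∅ ↔ ∃ b ∈ l, x ∈ f b := by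
  induction l with
  | nil => simp
  | cons b l ih => simp [ih]

theorem Query.mem_vars {Q : Query} {x : ℕ} : x ∈ Q.vars ↔
    (∃ a ∈ Q.atoms, x ∈ a.vars) ∨ (∃ zs ∈ Q.chains, x ∈ termVars zs) ∨ x ∈ Q.output := by
  simp only [Query.vars, Finset.mem_union, mem_foldr_union, List.mem_toFinset, or_assoc]

theorem Sat.mem_objects {H : Hypergraph} {ν : ℕ → Obj} {m : Eqs} (h : Sat ν m)
    (hm : ∀ p ∈ m, p.2 ∈ H.objects) {x : ℕ} (hx : x ∈ eqVars m) : ν x ∈ H.objects := by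
  obtain ⟨o, ho⟩ := mem_eqVars.1 hx
  have h' : ν x = o := h _ ho
  rw [h']
  exact hm _ ho

theorem sat_output {l : List ℕ} {t : List Obj} (h : l.length = t.length) (ν : ℕ → Obj) :
    Sat ν ((l.map Term.var).zip t) ↔ t = l.map ν := by
  rw [sat_zip _ _ _ (by simpa using h), List.map_map, eq_comm]
  rfl

/-- The condition that variables denote objects of `H` disappears: each variable of `Q` occurs in an
atom, a chain or the output, and the equations found there have objects of `H` on the right. -/
theorem mem_answers_iff {d : ℕ} {Q : Query} {H : Hypergraph} {t : List Obj}
    {free tied : List (List Term)} (hp : Q.chains.Perm (free ++ tied))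
    (hd : ∀ zs ∈ Q.chains, zs.length ≤ d + 1) (hl : Q.output.length = t.length)
    (ht : ∀ o ∈ t, o ∈ H.objects) : t ∈ Q.answers H ↔ ∃ ν,
      (Sat ν ((Q.output.map Term.var).zip t) ∧ ∀ zs ∈ free, ∃ m ∈ chainEqs d H zs, Sat ν m) ∧
      (∀ a ∈ Q.atoms, ∃ m ∈ atomEqs H a, Sat ν m) ∧
      ∀ zs ∈ tied, ∃ m ∈ chainEqs d H zs, Sat ν m := by
  have hch (ν : ℕ → Obj) : (∀ zs ∈ Q.chains, ChainHolds H ν zs) ↔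
      (∀ zs ∈ free, ∃ m ∈ chainEqs d H zs, Sat ν m) ∧
      ∀ zs ∈ tied, ∃ m ∈ chainEqs d H zs, Sat ν m := by
    rw [← List.forall_mem_append]
    exact ⟨fun h zs hz => (chain_holds_iff (hd zs (hp.mem_iff.2 hz)) ν).1 (h zs (hp.mem_iff.2 hz)),
      fun h zs hz => (chain_holds_iff (hd zs hz) ν).2 (h zs (hp.mem_iff.1 hz))⟩
  refine exists_congr fun ν => ?_
  rw [sat_output hl]
  constructor
  · rintro ⟨⟨-, h₂, h₃⟩, h₄⟩
    obtain ⟨h₅, h₆⟩ := (hch ν).1 h₃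
    exact ⟨⟨h₄, h₅⟩, fun a ha => (atom_holds_iff H ν a).1 (h₂ a ha), h₆⟩
  · rintro ⟨⟨h₄, h₅⟩, h₂, h₆⟩
    have h₃ := (hch ν).2 ⟨h₅, h₆⟩
    refine ⟨⟨fun x hx => ?_, fun a ha => (atom_holds_iff H ν a).2 (h₂ a ha), h₃⟩, h₄⟩
    obtain ⟨a, ha, hx⟩ | ⟨zs, hz, hx⟩ | hx := Query.mem_vars.1 hx
    · obtain ⟨m, hm, hs⟩ := h₂ a ha
      obtain ⟨hv, ho⟩ := eqVars_of_mem_atomEqs H hm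
      exact hs.mem_objects ho (hv ▸ hx)
    · obtain ⟨m, hm, hs⟩ := (chain_holds_iff (hd zs hz) ν).1 (h₃ zs hz)
      obtain ⟨hv, ho⟩ := eqVars_of_mem_chainEqs hm
      exact hs.mem_objects ho (hv ▸ hx)
    · exact ht _ (h₄ ▸ List.mem_map.2 ⟨x, hx, rfl⟩)

theorem splitTest_iff {c d : ℕ} {x : Instance} {free tied : List (List Term)}
    (hp : x.query.chains.Perm (free ++ tied)) (hc : free.length ≤ c)
    (hd : ∀ zs ∈ x.query.chains, zs.length ≤ d + 1)
    (hl : x.query.output.length = x.tuple.length) (ht : ∀ o ∈ x.tuple, o ∈ x.db.objects) :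
    splitTest c d x free tied = true ↔
      AlphaAcyclic (x.query.atoms.map Atom.vars ++ tied.map termVars) ∧
        x.tuple ∈ x.query.answers x.db := by
  have hvars : ((x.query.atoms.map fun a => atomTerm a :: atomTerms a) ++ tied).map termVars =
      x.query.atoms.map Atom.vars ++ tied.map termVars := by
    rw [List.map_append, List.map_map]
    congr 1
    exact List.map_congr_left fun a _ => atom_vars a
  unfold splitTest
  rw [Bool.and_eq_true, acyclicTest_iff, alphaAcyclic_iff, hvars]
  refine and_congr_right fun hac => ?_
  rw [mem_answers_iff hp hd hl ht]
  simp only [List.any_eq_true, Bool.and_eq_true]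
  have hnil {p} (h : p ∈ choices d x.db ((x.query.output.map Term.var).zip x.tuple) c free) :
      p.2 = [] := List.length_eq_zero_iff.1 (by rw [length_of_mem_choices h]; omega)
  constructor
  · rintro ⟨p, hpc, hps, hcon⟩
    let L : List (Finset ℕ × List Eqs) :=
      (x.query.atoms.map fun a => (a.vars, (atomEqs x.db a).filter fun m =>
        solvable m && compat p.1 m)) ++
      tied.map fun zs => (termVars zs, (chainEqs d x.db zs).filter fun m =>
        solvable m && compat p.1 m)
    have hfst : L.map Prod.fst = x.query.atoms.map Atom.vars ++ tied.map termVars := by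
      simp [L, Function.comp_def]
    have hsnd : L.map Prod.snd = (relations d x.db x.query.atoms tied).map fun R =>
        R.filter fun m => solvable m && compat p.1 m := by
      simp [L, relations, Function.comp_def]
    obtain ⟨ν, hν⟩ := exists_sat_of_consistent L (hfst ▸ hac) (by
      intro q hq m hm
      obtain hq | hq := List.mem_append.1 hq
      · obtain ⟨a, -, rfl⟩ := List.mem_map.1 hq
        obtain ⟨h₁, h₂⟩ := List.mem_filter.1 hm
        exact ⟨(Bool.and_eq_true _ _ ▸ h₂).1, (eqVars_of_mem_atomEqs _ h₁).1⟩
      · obtain ⟨a, -, rfl⟩ := List.mem_map.1 hq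
        obtain ⟨h₁, h₂⟩ := List.mem_filter.1 hm
        exact ⟨(Bool.and_eq_true _ _ ▸ h₂).1, (eqVars_of_mem_chainEqs h₁).1⟩) (hsnd ▸ hcon)
    -- The solution `ν` of the relations may violate the equations `p.1` of the output and the free
    -- chains. Overriding it by `p.1` does no harm, because the systems kept by the filter agree
    -- with `p.1` on common variables.
    obtain ⟨ν', hs, hν'⟩ := exists_override ν hps
    have hkeep {R : List Eqs} (h : ∃ m ∈ R.filter fun m => solvable m && compat p.1 m, Sat ν m) :
        ∃ m ∈ R, Sat ν' m := by
      obtain ⟨m, hm, hsm⟩ := h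
      obtain ⟨h₁, h₂⟩ := List.mem_filter.1 hm
      rw [Bool.and_eq_true] at h₂
      refine ⟨m, h₁, hsm.congr fun y hy => ?_⟩
      by_cases hyp : y ∈ eqVars p.1
      · exact hsm.apply_eq hs h₂.2 hy hyp
      · exact hν' y hyp
    refine ⟨ν', (exists_mem_choices_iff c).1 ⟨p, hpc, hs, by simp [hnil hpc]⟩, fun a ha => ?_,
      fun zs hz => ?_⟩
    · exact hkeep (hν _ (List.mem_append_left _ (List.mem_map.2 ⟨a, ha, rfl⟩)))
    · exact hkeep (hν _ (List.mem_append_right _ (List.mem_map.2 ⟨zs, hz, rfl⟩)))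
  -- A match selects one system in each relation, and these pass the filter and survive the pruning.
  · rintro ⟨ν, h₁, h₂, h₃⟩
    obtain ⟨p, hpc, hs, -⟩ := (exists_mem_choices_iff c).2 h₁
    refine ⟨p, hpc, hs.solvable, consistent_of_sat (ν := ν) fun R hR => ?_⟩
    obtain ⟨R, hR', rfl⟩ := List.mem_map.1 hR
    have : ∃ m ∈ R, Sat ν m := by
      obtain h | h := List.mem_append.1 hR'
      · obtain ⟨a, ha, rfl⟩ := List.mem_map.1 h
        exact h₂ a ha
      · obtain ⟨zs, hz, rfl⟩ := List.mem_map.1 h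
        exact h₃ zs hz
    obtain ⟨m, hm, hsm⟩ := this
    exact ⟨m, List.mem_filter.2 ⟨hm, by rw [hsm.solvable, hs.compat hsm]; rfl⟩, hsm⟩

theorem isEmpty_iterate_tail {β : Type} (n : ℕ) (l : List β) :
    (List.tail^[n] l).isEmpty = true ↔ l.length ≤ n := by
  induction n generalizing l with
  | zero => cases l <;> simp
  | succ n ih =>
    rw [Function.iterate_succ_apply, ih]
    cases l <;> simp

theorem nameTest_iff (H : Hypergraph) (o : Obj) :
    (((vertexRecs H).any fun r => decide (o = r.1)) || (edgeNames H).any fun e =>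
      decide (o = e)) = true ↔ o ∈ H.objects := by
  simp only [Bool.or_eq_true, List.any_eq_true, decide_eq_true_eq, mem_vertexRecs]
  constructor
  · rintro (⟨_, ⟨v, rfl⟩, rfl⟩ | ⟨e, he, rfl⟩)
    · exact mem_objects_inl H v
    · rw [edgeNames_eq, List.mem_ofFn'] at he
      obtain ⟨e, rfl⟩ := he
      exact mem_objects_inr H e
  · rintro ⟨v | e, rfl⟩
    · exact .inl ⟨_, ⟨v, rfl⟩, rfl⟩
    · exact .inr ⟨_, by rw [edgeNames_eq, List.mem_ofFn']; exact ⟨e, rfl⟩, rfl⟩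

/-- Needed because `splits` returns the tied chains only up to order. -/
theorem AlphaAcyclic.of_perm {F G : List (Finset ℕ)} (hF : AlphaAcyclic F) (h : F.Perm G) :
    AlphaAcyclic G := by
  rw [alphaAcyclic_iff] at hF ⊢
  rwa [← Multiset.coe_eq_coe.2 h]

/-- On every acyclic split the test decides the answer exactly, so it does not matter which split is
found. The length and the entries of the tuple are checked beforehand, since the `zip` with the
output variables would truncate silently and an output variable may occur nowhere else. -/
theorem evaluate_iff (c d : ℕ) (x : Instance) : evaluate c d x = true ↔
    x.query.Tractable c d ∧ x.tuple ∈ x.query.answers x.db := by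
  unfold evaluate
  simp only [Bool.and_eq_true, List.all_eq_true, isEmpty_iterate_tail, sameLength_iff,
    nameTest_iff, List.any_eq_true (l := splits c x.query.chains)]
  constructor
  · rintro ⟨⟨hd, hl, ht⟩, p, hps, hp⟩
    obtain ⟨hperm, hc⟩ := perm_of_mem_splits hps
    obtain ⟨h₁, h₂⟩ := (splitTest_iff hperm hc hd hl ht).1 hp
    exact ⟨⟨hd, p.1, p.2, hperm, hc, h₁⟩, h₂⟩
  · rintro ⟨⟨hd, free, tied, hperm, hc, hac⟩, hans⟩
    have hl : x.query.output.length = x.tuple.length := by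
      obtain ⟨ν, -, h⟩ := hans
      simp [h]
    have ht : ∀ o ∈ x.tuple, o ∈ x.db.objects := by
      obtain ⟨ν, hν, h⟩ := hans
      intro o ho
      rw [h] at ho
      obtain ⟨y, hy, rfl⟩ := List.mem_map.1 ho
      exact hν.objects y (Query.mem_vars.2 (.inr (.inr hy)))
    obtain ⟨p, hps, -, h₂⟩ := exists_mem_splits hperm hc
    obtain ⟨hperm', hc'⟩ := perm_of_mem_splits hps
    refine ⟨⟨hd, hl, ht⟩, p, hps, (splitTest_iff hperm' hc' hd hl ht).2 ⟨?_, hans⟩⟩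
    exact AlphaAcyclic.of_perm hac ((h₂.symm.map _).append_left _)

theorem evaluation_eq (c d : ℕ) : evaluation c d = evaluate c d := by
  funext x
  rw [Bool.eq_iff_iff, evaluate_iff]
  simp only [evaluation, decide_eq_true_eq]

end StackProg

theorem mainTheorem4 (c d : ℕ) :
    Nonempty (Turing.TM2ComputableInPolyTime Atch.encInstance Computability.encodeBool
      (Atch.evaluation c d)) := by
  rw [StackProg.evaluation_eq]
  exact StackProg.PolyTime.computable StackProg.rep_instance (StackProg.polyTime_evaluate c d)
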